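/- **Setting.** Let $p$ be a prime, $n\ge 1$, $\mathbb W=W(\mathbb F_{p^n})$ with Frobenius lift $a\mapsto a^\phi$, and $E_0=\mathbb W[[u_1,\dots,u_{n-1}]]$, with maximal ideal $\mathfrak m$ and the $\mathfrak m$-adic topology. Let $G_n$ be the unique $p$-typical formal group law over $E_0$ with $$[p]_{G_n}(x)=px+_{G_n}u_1x^p+_{G_n}\cdots+_{G_n}u_{n-1}x^{p^{n-1}}+_{G_n}x^{p^n},$$ and let $H_n$ be its reduction modulo $\mathfrak m$, the Honda formal group law over $\mathbb F_{p^n}$ with $[p]_{H_n}(x)=x^{p^n}$; it is defined over $\mathbb F_p$. Let $\mathbb S_n=\mathrm{Aut}(H_n/\mathbb F_{p^n})$, a group of power series $g$ under composition, and let $\mathbb G_n=\mathrm{Aut}(H_n,\mathbb F_{p^n})\cong\mathbb S_n\rtimes\mathrm{Gal}(\mathbb F_{p^n}/\mathbb F_p)$, with its profinite topology. For $g\in\mathbb S_n$ there are, by Lubin–Tate theory, a unique continuous $\mathbb W$-algebra map $\phi_g:E_0\to E_0$ and a unique isomorphism $\psi_g:(\phi_g)_*G_n\to G_n$ of formal group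 laws lifting $g$. The group $\mathbb G_n$ acts on $E_0$: $(g,\sigma)$ acts by $\phi_g\circ\sigma$, where $\sigma$ acts on the coefficients in $\mathbb W$ and fixes the $u_i$. Put $t_0(g,\sigma)=\psi_g'(0)\in E_0^\times$. For a topological abelian group $M$ with $\mathbb G_n$-action, $H^1(\mathbb G_n,M)$ is the group of continuous crossed homomorphisms ($c(gh)=c(g)\cdot g\,c(h)$) modulo the maps $g\mapsto (gm)/m$; it is written multiplicatively for $M=E_0^\times$. Every $g\in\mathbb S_n$ is uniquely of the form $g=a_0+a_1S+\cdots+a_{n-1}S^{n-1}$ with $a_j\in\mathbb W$ in $\mathrm{End}(H_n/\mathbb F_{p^n})\cong\mathbb W\langle S\rangle/(S^n=p,\ Sa=a^\phi S)$, $S=x^p$. Let $A(g)\in \mathrm{GL}_n(\mathbb W)$ be the matrix of right multiplication by $g$ in the left $\mathbb W$-basis $1,S,\dots,S^{n-1}$, and put $\det(g,\sigma)=\det A(g)\in\mathbb Z_p^\times$. Let $r(n)=(p^n-1)/(p-1)$. For $p>2$ let $$\zeta(g,\sigma)=\tfrac1p\log\bigl(g'(0)^{-r(n)}\det(g)\bigr)\in\mathbb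 Z_p,$$ where $g'(0)^{-r(n)}\in\mathbb F_p^\times$ stands for its Teichmüller lift, so that the argument of $\log$ lies in $1+p\mathbb Z_p$. The homomorphism $\zeta$ defines a class $\zeta\in H^1(\mathbb G_n,E_0)$. For $x\in E_0$ put $\exp(px)=\sum_{i\ge0}p^ix^i/i!\in E_0^\times$; applied to representatives, this defines a map $\exp(p-)$ from $H^1(\mathbb G_n,E_0)$ to $H^1(\mathbb G_n,E_0^\times)$. Let $\mathfrak Z_n=\lim_k\mathbb Z/p^k(p^n-1)$. For $x\in E_0^\times$ and $a\in\mathfrak Z_n$, let $x^a\in E_0^\times$ be the unique unit with $x^a\equiv x^{a_k}$ modulo $\mathfrak m^{k+1}$ for all $k\ge 0$, where $a_k$ is any integer representing $a$ in $\mathbb Z/p^k(p^n-1)$. For a crossed homomorphism $c$, let $c^a$ be its pointwise power. Let $\lambda=\lim_k p^{nk}r(n)\in\mathfrak Z_n$. Each continuous crossed homomorphism $c:\mathbb G_n\to E_0^\times$ defines an invertible Morava module: the free $E_0$-module on a generator $x$ with the twisted action $g(ax)=(ga)\,c(g)\,x$. Write $E_0[\det]$ for the one defined by $c=\det$ and $E_0(S^{2\lambda})$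 for the one defined by $c=t_0^{\lambda}$. **Proposition 3.4.** Let $p>2$. The functions $\zeta:\mathbb G_n\to E_0$ and $\det,\ t_0^{\lambda},\ t_0^{-\lambda}:\mathbb G_n\to E_0^\times$ are continuous crossed homomorphisms, and $$\exp(p\zeta)=t_0^{-\lambda}\cdot\det\quad\text{in } H^1(\mathbb G_n,E_0^\times),$$ whichever crossed homomorphism is used to represent the class $\zeta$. Moreover, there is an isomorphism of $E_0$-modules $E_0[\det]/p\cong E_0(S^{2\lambda})/p$ that commutes with the action of $\mathbb G_n$. -/

import Mathlib

namespace Morava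

open scoped PowerSeries

/-- `f` is a homomorphism of formal group laws `F → F'`:
`f(0) = 0` and `f(F(x, y)) = F'(f(x), f(y))`. -/
def IsHom {R : Type*} [CommRing R] (F F' : FormalGroup R) (f : R⟦X⟧) : Prop :=
  PowerSeries.constantCoeff f = 0 ∧
    f.subst F.toPowerSeries =
      F'.toPowerSeries.subst
        ![f.subst (MvPowerSeries.X 0 : MvPowerSeries (Fin 2) R),
          f.subst (MvPowerSeries.X 1 : MvPowerSeries (Fin 2) R)]

section Hom
variable {R : Type*} [CommRing R] {F F' F'' : FormalGroup R}

theorem hasSubst_of_zero {σ : Type*} {a : MvPowerSeries σ R}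
    (h : MvPowerSeries.constantCoeff a = 0) : PowerSeries.HasSubst a :=
  PowerSeries.HasSubst.of_constantCoeff_zero h

theorem hasSubst_pair {a b : MvPowerSeries (Fin 2) R}
    (ha : MvPowerSeries.constantCoeff a = 0) (hb : MvPowerSeries.constantCoeff b = 0) :
    MvPowerSeries.HasSubst ![a, b] :=
  MvPowerSeries.hasSubst_of_constantCoeff_zero (by intro s; fin_cases s <;> simpa)

theorem constantCoeff_subst_zero {σ : Type*} {a : MvPowerSeries σ R} {f : R⟦X⟧}
    (ha : MvPowerSeries.constantCoeff a = 0) (hf : PowerSeries.constantCoeff f = 0) :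
    MvPowerSeries.constantCoeff (f.subst a) = 0 :=
  PowerSeries.constantCoeff_subst_eq_zero ha f hf

theorem subst_pair_subst {f : R⟦X⟧} {P a b : MvPowerSeries (Fin 2) R}
    (hP : MvPowerSeries.constantCoeff P = 0)
    (ha : MvPowerSeries.constantCoeff a = 0) (hb : MvPowerSeries.constantCoeff b = 0) :
    MvPowerSeries.subst ![a, b] (f.subst P) = f.subst (MvPowerSeries.subst ![a, b] P) := by
  rw [PowerSeries.subst, PowerSeries.subst,
    MvPowerSeries.subst_comp_subst_apply (hasSubst_of_zero hP).const (hasSubst_pair ha hb)]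

theorem subst_pair_pair {P a b c d : MvPowerSeries (Fin 2) R}
    (ha : MvPowerSeries.constantCoeff a = 0) (hb : MvPowerSeries.constantCoeff b = 0)
    (hc : MvPowerSeries.constantCoeff c = 0) (hd : MvPowerSeries.constantCoeff d = 0) :
    MvPowerSeries.subst ![c, d] (MvPowerSeries.subst ![a, b] P) =
      MvPowerSeries.subst ![MvPowerSeries.subst ![c, d] a, MvPowerSeries.subst ![c, d] b] P := by
  rw [MvPowerSeries.subst_comp_subst_apply (hasSubst_pair ha hb) (hasSubst_pair hc hd)]
  congr! 2 with s
  fin_cases s <;> rfl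

theorem subst_pair_X_zero {a b : MvPowerSeries (Fin 2) R}
    (ha : MvPowerSeries.constantCoeff a = 0) (hb : MvPowerSeries.constantCoeff b = 0) :
    MvPowerSeries.subst ![a, b] (MvPowerSeries.X 0 : MvPowerSeries (Fin 2) R) = a :=
  MvPowerSeries.subst_X (hasSubst_pair ha hb) 0

theorem subst_pair_X_one {a b : MvPowerSeries (Fin 2) R}
    (ha : MvPowerSeries.constantCoeff a = 0) (hb : MvPowerSeries.constantCoeff b = 0) :
    MvPowerSeries.subst ![a, b] (MvPowerSeries.X 1 : MvPowerSeries (Fin 2) R) = b :=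
  MvPowerSeries.subst_X (hasSubst_pair ha hb) 1

theorem subst_X_pair (P : MvPowerSeries (Fin 2) R) :
    MvPowerSeries.subst ![MvPowerSeries.X 0, (MvPowerSeries.X 1 : MvPowerSeries (Fin 2) R)] P =
      P := by
  have : ![MvPowerSeries.X 0, MvPowerSeries.X 1] =
      (MvPowerSeries.X : Fin 2 → MvPowerSeries (Fin 2) R) := by
    funext s; fin_cases s <;> rfl
  rw [this, MvPowerSeries.subst_self]; rfl

theorem IsHom.id (F : FormalGroup R) : IsHom F F PowerSeries.X := by
  refine ⟨by simp, ?_⟩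
  rw [PowerSeries.subst_X (hasSubst_of_zero F.zero_constantCoeff),
    PowerSeries.subst_X (hasSubst_of_zero (by simp)),
    PowerSeries.subst_X (hasSubst_of_zero (by simp))]
  rw [subst_X_pair]

theorem IsHom.comp {f g : R⟦X⟧} (hg : IsHom F' F'' g) (hf : IsHom F F' f) :
    IsHom F F'' (g.subst f) := by
  have hX (i : Fin 2) : MvPowerSeries.constantCoeff
    (MvPowerSeries.X i : MvPowerSeries (Fin 2) R) = 0 := by simp
  have hf0 : MvPowerSeries.constantCoeff (f : MvPowerSeries Unit R) = 0 := hf.1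
  have key (P : MvPowerSeries (Fin 2) R) (hP : MvPowerSeries.constantCoeff P = 0) :
      PowerSeries.subst P (g.subst f : R⟦X⟧) = g.subst (f.subst P) := by
    rw [← PowerSeries.subst_comp_subst_apply (hasSubst_of_zero hf0) (hasSubst_of_zero hP)]
  refine ⟨constantCoeff_subst_zero hf0 hg.1, ?_⟩
  rw [key _ F.zero_constantCoeff, key _ (hX 0), key _ (hX 1), hf.2,
    ← subst_pair_subst F'.zero_constantCoeff (constantCoeff_subst_zero (hX 0) hf.1)
      (constantCoeff_subst_zero (hX 1) hf.1), hg.2,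
    subst_pair_pair (constantCoeff_subst_zero (hX 0) hg.1) (constantCoeff_subst_zero (hX 1) hg.1)
      (constantCoeff_subst_zero (hX 0) hf.1) (constantCoeff_subst_zero (hX 1) hf.1)]
  have c0 := constantCoeff_subst_zero (hX 0) hf.1
  have c1 := constantCoeff_subst_zero (hX 1) hf.1
  rw [subst_pair_subst (hX 0) c0 c1, subst_pair_subst (hX 1) c0 c1, subst_pair_X_zero c0 c1,
    subst_pair_X_one c0 c1]

theorem IsHom.inv {f q : R⟦X⟧} (hf : IsHom F F' f) (hq : PowerSeries.constantCoeff q = 0)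
    (h₁ : f.subst q = PowerSeries.X) (h₂ : q.subst f = PowerSeries.X) : IsHom F' F q := by
  have hX (i : Fin 2) : MvPowerSeries.constantCoeff
    (MvPowerSeries.X i : MvPowerSeries (Fin 2) R) = 0 := by simp
  have hf0 : MvPowerSeries.constantCoeff (f : MvPowerSeries Unit R) = 0 := hf.1
  have hq0 : MvPowerSeries.constantCoeff (q : MvPowerSeries Unit R) = 0 := hq
  have key (P : MvPowerSeries (Fin 2) R) (hP : MvPowerSeries.constantCoeff P = 0) :
      f.subst (q.subst P) = P := by
    rw [← PowerSeries.subst_comp_subst_apply (hasSubst_of_zero hq0) (hasSubst_of_zero hP), h₁,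
      PowerSeries.subst_X (hasSubst_of_zero hP)]
  have key' (P : MvPowerSeries (Fin 2) R) (hP : MvPowerSeries.constantCoeff P = 0) :
      q.subst (f.subst P) = P := by
    rw [← PowerSeries.subst_comp_subst_apply (hasSubst_of_zero hf0) (hasSubst_of_zero hP), h₂,
      PowerSeries.subst_X (hasSubst_of_zero hP)]
  have c0 := constantCoeff_subst_zero (hX 0) hq
  have c1 := constantCoeff_subst_zero (hX 1) hq
  have hs := hasSubst_pair c0 c1
  refine ⟨hq, ?_⟩
  have h := congrArg (MvPowerSeries.subst
    ![q.subst (MvPowerSeries.X 0 : MvPowerSeries (Fin 2) R),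
      q.subst (MvPowerSeries.X 1 : MvPowerSeries (Fin 2) R)]) hf.2
  rw [subst_pair_subst F.zero_constantCoeff c0 c1,
    subst_pair_pair (constantCoeff_subst_zero (hX 0) hf.1) (constantCoeff_subst_zero (hX 1) hf.1)
      c0 c1, subst_pair_subst (hX 0) c0 c1, subst_pair_subst (hX 1) c0 c1,
    subst_pair_X_zero c0 c1, subst_pair_X_one c0 c1, key _ (hX 0), key _ (hX 1),
    subst_X_pair] at h
  rw [← h]
  refine key' _ ?_
  exact MvPowerSeries.constantCoeff_subst_eq_zero hs (by intro s; fin_cases s <;> assumption)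
    F.zero_constantCoeff

theorem IsHom.map {S : Type*} [CommRing S] (φ : R →+* S) {f : R⟦X⟧} (hf : IsHom F F' f) :
    IsHom (F.map φ) (F'.map φ) (PowerSeries.map φ f) := by
  have hX (i : Fin 2) : MvPowerSeries.constantCoeff
    (MvPowerSeries.X i : MvPowerSeries (Fin 2) R) = 0 := by simp
  have c0 := constantCoeff_subst_zero (hX 0) hf.1
  have c1 := constantCoeff_subst_zero (hX 1) hf.1
  refine ⟨by
    rw [← PowerSeries.coeff_zero_eq_constantCoeff_apply, PowerSeries.coeff_map,
      PowerSeries.coeff_zero_eq_constantCoeff_apply, hf.1, map_zero], ?_⟩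
  have h := congrArg (MvPowerSeries.map φ) hf.2
  rw [PowerSeries.map_subst (hasSubst_of_zero F.zero_constantCoeff),
    MvPowerSeries.map_subst (hasSubst_pair c0 c1)] at h
  rw [FormalGroup.map_toPowerSeries, FormalGroup.map_toPowerSeries, h]
  congr 1
  funext s
  fin_cases s
  · simp [PowerSeries.map_subst (hasSubst_of_zero (hX 0))]
  · simp [PowerSeries.map_subst (hasSubst_of_zero (hX 1))]
end Hom

/-! ### The ground rings -/

section Rings
variable (p n : ℕ) [Fact p.Prime]

/-- The finite field `𝔽_{p^n}`. -/
abbrev Fq := GaloisField p n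

/-- The Witt vectors `𝕎 = W(𝔽_{p^n})`. -/
abbrev W := WittVector p (Fq p n)

/-- The Galois group `Gal(𝔽_{p^n}/𝔽_p)`. -/
abbrev Gal := Fq p n ≃ₐ[ZMod p] Fq p n

/-- The Lubin-Tate ring `E₀ = 𝕎⟦u₁, …, u_{n-1}⟧`; the variable `u_i` has index `i - 1`. -/
abbrev E0 := MvPowerSeries (Fin (n - 1)) (W p n)

/-- `E₀` carries the topology defined by its maximal ideal. -/
noncomputable instance : TopologicalSpace (E0 p n) :=
  (IsLocalRing.maximalIdeal (E0 p n)).adicTopology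

instance : IsTopologicalRing (E0 p n) :=
  (IsLocalRing.maximalIdeal (E0 p n)).adic_basis.toRing_subgroups_basis.toRingFilterBasis.isTopologicalRing

/-- Reduction modulo the maximal ideal, `E₀ → 𝔽_{p^n}`. -/
noncomputable def residue : E0 p n →+* Fq p n :=
  (WittVector.constantCoeff (p := p) (R := Fq p n)).comp MvPowerSeries.constantCoeff

variable {p n} in
theorem isUnit_of_residue_ne_zero {x : E0 p n} (h : residue p n x ≠ 0) : IsUnit x :=
  MvPowerSeries.isUnit_iff_constantCoeff.2 (WittVector.isUnit_of_coeff_zero_ne_zero _ h)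

theorem residue_surjective : Function.Surjective (residue p n) := fun a =>
  ⟨MvPowerSeries.C (WittVector.teichmuller p a), by simp [residue]⟩

/-- The inclusion `ℤ_p = W(𝔽_p) → 𝕎`. -/
noncomputable def toW : ℤ_[p] →+* W p n :=
  (WittVector.map (algebraMap (ZMod p) (Fq p n))).comp (WittVector.equiv p).symm.toRingHom

/-- The inclusion `ℤ_p → E₀`. -/
noncomputable def toE0 : ℤ_[p] →+* E0 p n := MvPowerSeries.C.comp (toW p n)

/-- The element of `ℤ_p` that a given element of `ℤ_p ⊆ 𝕎` comes from. -/
noncomputable def ofW : W p n → ℤ_[p] := Function.invFun (toW p n)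

/-- The Galois action on `E₀`: it acts on the coefficients in `𝕎` and fixes the `u_i`. -/
noncomputable def galAct (σ : Gal p n) : E0 p n →+* E0 p n :=
  MvPowerSeries.map (WittVector.map (σ : Fq p n →+* Fq p n))

end Rings

/-! ### The universal deformation and the Honda formal group law -/

/-- A formal group law `F` over a torsion-free ring `R` is `p`-typical if it has a logarithm of the
form `x + ∑_{i > 0} ℓ_i x^{p^i}`, with coefficients in the total ring of fractions of `R`. -/
def IsPTypical (p : ℕ) {R : Type*} [CommRing R] (F : FormalGroup R) : Prop :=
  ∃ l : (FractionRing R)⟦X⟧,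
    PowerSeries.coeff 1 l = 1 ∧
    (∀ m, PowerSeries.coeff m l ≠ 0 → ∃ i, m = p ^ i) ∧
    l.subst (F.map (algebraMap R (FractionRing R))).toPowerSeries =
      l.subst (MvPowerSeries.X 0 : MvPowerSeries (Fin 2) (FractionRing R)) +
        l.subst (MvPowerSeries.X 1 : MvPowerSeries (Fin 2) (FractionRing R))

/-- The formal sum `f 0 +_F f 1 +_F ⋯ +_F f (m - 1)`. -/
noncomputable def formalSum {R : Type*} [CommRing R] (F : FormalGroup R) (f : ℕ → R⟦X⟧) :
    ℕ → R⟦X⟧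
  | 0 => 0
  | m + 1 => F.toPowerSeries.subst ![formalSum F f m, f m]

section Deformation
variable (p n : ℕ) [Fact p.Prime]

/-- The sequence `p, u₁, …, u_{n-1}, 1` of elements of `E₀` (and `0` afterwards). -/
noncomputable def pSeriesCoeff (i : ℕ) : E0 p n :=
  if i = 0 then (p : E0 p n)
  else if h : i - 1 < n - 1 then MvPowerSeries.X ⟨i - 1, h⟩
  else if i = n then 1 else 0

/-- `G` is `p`-typical over `E₀`, with `p`-series
`[p]_G(x) = p x +_G u₁ x^p +_G ⋯ +_G u_{n-1} x^{p^{n-1}} +_G x^{p^n}`. -/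
def IsUniversalDeformation (G : FormalGroup (E0 p n)) : Prop :=
  IsPTypical p G ∧
    formalSum G (fun _ => PowerSeries.X) p =
      formalSum G (fun i => PowerSeries.C (pSeriesCoeff p n i) * PowerSeries.X ^ p ^ i) (n + 1)

instance {R : Type*} [CommRing R] : Nonempty (FormalGroup R) := ⟨FormalGroup.𝔾ₐ⟩

/-- The universal deformation `G_n` over `E₀`: the unique `p`-typical formal group law with the
`p`-series prescribed in `IsUniversalDeformation`. -/
noncomputable def univ : FormalGroup (E0 p n) := Classical.epsilon (IsUniversalDeformation p n)

/-- The Honda formal group law `H_n` over `𝔽_{p^n}`, with `p`-series `x^{p^n}`: the reduction of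
`G_n` modulo the maximal ideal. -/
noncomputable def honda : FormalGroup (Fq p n) := (univ p n).map (residue p n)

end Deformation

/-! ### The Morava stabilizer group -/

section Stabilizer
variable (p n : ℕ) [Fact p.Prime]

/-- The group `𝔾_n = Aut(H_n, 𝔽_{p^n})` of automorphisms of the pair `(H_n, 𝔽_{p^n})`: an
automorphism `σ` of `𝔽_{p^n}` with an isomorphism `f : σ_* H_n → H_n`. As `H_n` is defined over
`𝔽_p`, one has `σ_* H_n = H_n`, and this is `𝕊_n ⋊ Gal`, with `𝕊_n = Aut(H_n/𝔽_{p^n}) ∋ f`. -/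
@[ext]
structure Stab where
  /-- The isomorphism of formal group laws, as a power series. -/
  f : (Fq p n)⟦X⟧
  /-- The field automorphism. -/
  σ : Gal p n
  isHom : IsHom ((honda p n).map (σ : Fq p n →+* Fq p n)) (honda p n) f
  isIso : PowerSeries.coeff 1 f ≠ 0

end Stabilizer

namespace Stab
variable {p n : ℕ} [Fact p.Prime]

theorem map_map (σ τ : Gal p n) :
    ((honda p n).map (τ : Fq p n →+* Fq p n)).map (σ : Fq p n →+* Fq p n) =
      (honda p n).map ((σ * τ : Gal p n) : Fq p n →+* Fq p n) := by
  ext m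
  simp

theorem map_one : (honda p n).map ((1 : Gal p n) : Fq p n →+* Fq p n) = honda p n := by
  ext m
  simp

theorem coeff_one_subst {f g : (Fq p n)⟦X⟧} (hg : PowerSeries.constantCoeff g = 0) :
    PowerSeries.coeff 1 (f.subst g : (Fq p n)⟦X⟧) =
      PowerSeries.coeff 1 f * PowerSeries.coeff 1 g := by
  rw [PowerSeries.coeff_subst' (PowerSeries.HasSubst.of_constantCoeff_zero' hg),
    finsum_eq_single _ 1]
  · simp
  · intro d hd
    obtain rfl | hd' : d = 0 ∨ 1 < d := by omega
    · simp [PowerSeries.coeff_one]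
    · have h : PowerSeries.X ^ d ∣ g ^ d := pow_dvd_pow_of_dvd (PowerSeries.X_dvd_iff.2 hg) d
      rw [PowerSeries.X_pow_dvd_iff.1 h 1 hd', smul_zero]

/-- `(f, σ) (g, τ) = (f ∘ σ_* g, σ τ)`. -/
noncomputable instance : Mul (Stab p n) where
  mul a b :=
    { f := a.f.subst (PowerSeries.map (a.σ : Fq p n →+* Fq p n) b.f)
      σ := a.σ * b.σ
      isHom := by
        have h := b.isHom.map (a.σ : Fq p n →+* Fq p n)
        rw [map_map] at h
        exact a.isHom.comp h
      isIso := by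
        have h := (b.isHom.map (a.σ : Fq p n →+* Fq p n)).1
        rw [coeff_one_subst h, PowerSeries.coeff_map]
        exact mul_ne_zero a.isIso (by simpa using b.isIso) }

theorem mul_f (a b : Stab p n) :
    (a * b).f = a.f.subst (PowerSeries.map (a.σ : Fq p n →+* Fq p n) b.f) := rfl

theorem mul_σ (a b : Stab p n) : (a * b).σ = a.σ * b.σ := rfl

noncomputable instance : One (Stab p n) where
  one :=
    { f := PowerSeries.X
      σ := 1
      isHom := by rw [map_one]; exact IsHom.id _
      isIso := by simp }

theorem one_f : (1 : Stab p n).f = PowerSeries.X := rfl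

theorem one_σ : (1 : Stab p n).σ = 1 := rfl

theorem hasSubst (a : Stab p n) : PowerSeries.HasSubst a.f :=
  PowerSeries.HasSubst.of_constantCoeff_zero' a.isHom.1

theorem hasSubst_map (σ : Gal p n) (a : Stab p n) :
    PowerSeries.HasSubst (PowerSeries.map (σ : Fq p n →+* Fq p n) a.f) :=
  PowerSeries.HasSubst.of_constantCoeff_zero' (a.isHom.map _).1

/-- The compositional inverse of the power series of an element of `𝔾_n`. -/
noncomputable def invSeries (a : Stab p n) : (Fq p n)⟦X⟧ :=
  PowerSeries.substInvOfIsUnit a.f a.isIso.isUnit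

theorem map_mul_map (σ τ : Gal p n) (f : (Fq p n)⟦X⟧) :
    PowerSeries.map (σ : Fq p n →+* Fq p n) (PowerSeries.map (τ : Fq p n →+* Fq p n) f) =
      PowerSeries.map ((σ * τ : Gal p n) : Fq p n →+* Fq p n) f := by
  ext m; simp

theorem map_subst {f g : (Fq p n)⟦X⟧} (hg : PowerSeries.HasSubst g) (φ : Fq p n →+* Fq p n) :
    PowerSeries.map φ (f.subst g : (Fq p n)⟦X⟧) =
      (PowerSeries.map φ f).subst (PowerSeries.map φ g) :=
  PowerSeries.map_subst hg f

/-- `(f, σ)⁻¹ = (σ⁻¹_* f⁻¹, σ⁻¹)`. -/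
noncomputable instance : Inv (Stab p n) where
  inv a :=
    { f := PowerSeries.map ((a.σ⁻¹ : Gal p n) : Fq p n →+* Fq p n) a.invSeries
      σ := a.σ⁻¹
      isHom := by
        have h := (a.isHom.inv (q := a.invSeries) (by simp [invSeries])
          (PowerSeries.subst_substInvOfIsUnit_right _ a.isHom.1 _)
          (PowerSeries.subst_substInvOfIsUnit_left _ a.isHom.1 _)).map
            ((a.σ⁻¹ : Gal p n) : Fq p n →+* Fq p n)
        rwa [map_map, inv_mul_cancel, map_one] at h
      isIso := by
        rw [PowerSeries.coeff_map]
        simpa [invSeries] using a.isIso }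

theorem inv_f (a : Stab p n) :
    (a⁻¹).f = PowerSeries.map ((a.σ⁻¹ : Gal p n) : Fq p n →+* Fq p n) a.invSeries := rfl

theorem inv_σ (a : Stab p n) : (a⁻¹).σ = a.σ⁻¹ := rfl

theorem map_one_series (f : (Fq p n)⟦X⟧) :
    PowerSeries.map ((1 : Gal p n) : Fq p n →+* Fq p n) f = f := by
  ext m; simp

noncomputable instance : Group (Stab p n) :=
  Group.ofLeftAxioms
    (fun a b c => by
      refine Stab.ext ?_ (mul_assoc _ _ _)
      have h := hasSubst_map (a.σ * b.σ) c
      rw [← map_mul_map] at h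
      rw [mul_f, mul_f, mul_f, mul_f, mul_σ, ← map_mul_map,
        PowerSeries.subst_comp_subst_apply (hasSubst_map _ _) h, map_subst (hasSubst_map _ _)])
    (fun a => by
      refine Stab.ext ?_ (one_mul _)
      rw [mul_f, one_f, one_σ, map_one_series, PowerSeries.subst_X a.hasSubst])
    (fun a => by
      refine Stab.ext ?_ (inv_mul_cancel _)
      rw [mul_f, inv_f, inv_σ, one_f, ← map_subst a.hasSubst, invSeries,
        PowerSeries.subst_substInvOfIsUnit_left _ a.isHom.1, PowerSeries.map_X])

/-- `𝔾_n` is topologized as a subspace of the product of the discrete sets of coefficients and of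
the discrete group `Gal`. -/
noncomputable instance : TopologicalSpace (Stab p n) :=
  TopologicalSpace.induced (fun γ i => PowerSeries.coeff i γ.f)
      (@Pi.topologicalSpace ℕ (fun _ => Fq p n) fun _ => ⊥) ⊓
    TopologicalSpace.induced (fun γ => γ.σ) ⊥

end Stab

/-! ### The action on `E₀` and the crossed homomorphism `t₀` -/

section Action
variable {p n : ℕ} [Fact p.Prime]

/-- A `𝕎`-algebra endomorphism `φ` of `E₀` together with a power series `ψ` over `E₀` that lifts a
given power series `f` over `𝔽_{p^n}`. -/
structure Lift (f : (Fq p n)⟦X⟧) where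
  /-- The endomorphism of `E₀`. -/
  φ : E0 p n →ₐ[W p n] E0 p n
  /-- The lift of `f`. -/
  ψ : (E0 p n)⟦X⟧
  reduces : PowerSeries.map (residue p n) ψ = f

instance (f : (Fq p n)⟦X⟧) : Nonempty (Lift f) := by
  obtain ⟨ψ, hψ⟩ := PowerSeries.map_surjective (residue p n) (residue_surjective p n) f
  exact ⟨⟨AlgHom.id _ _, ψ, hψ⟩⟩

/-- `φ` is continuous and `ψ` is a homomorphism `φ_* G_n → G_n` (necessarily an isomorphism when
`f'(0) ≠ 0`). -/
def Lift.IsDeformation {f : (Fq p n)⟦X⟧} (P : Lift f) : Prop :=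
  Continuous P.φ ∧ IsHom ((univ p n).map (P.φ : E0 p n →+* E0 p n)) (univ p n) P.ψ

/-- For `f ∈ 𝕊_n`, the unique pair `(φ_f, ψ_f)` with `φ_f : E₀ → E₀` a continuous `𝕎`-algebra map
and `ψ_f : φ_{f*} G_n → G_n` an isomorphism lifting `f`, provided by Lubin-Tate theory. -/
noncomputable def lubinTate (f : (Fq p n)⟦X⟧) : Lift f := Classical.epsilon Lift.IsDeformation

/-- The action of `𝔾_n = 𝕊_n ⋊ Gal` on `E₀`: `(f, σ)` acts by `φ_f ∘ σ`. -/
noncomputable def act (γ : Stab p n) : E0 p n →+* E0 p n :=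
  (lubinTate γ.f).φ.toRingHom.comp (galAct p n γ.σ)

theorem isUnit_coeff_one (γ : Stab p n) : IsUnit (PowerSeries.coeff 1 (lubinTate γ.f).ψ) := by
  refine isUnit_of_residue_ne_zero ?_
  rw [← PowerSeries.coeff_map, (lubinTate γ.f).reduces]
  exact γ.isIso

/-- `t₀ : 𝔾_n → E₀ˣ`, `t₀(f, σ) = ψ_f'(0)`. -/
noncomputable def t₀ (γ : Stab p n) : (E0 p n)ˣ := (isUnit_coeff_one γ).unit

end Action

/-! ### The determinant and `ζ` -/

section Determinant
variable {p n : ℕ} [Fact p.Prime]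

/-- `f(x) = ∑^{H_n}_{m ≥ 0} e_m x^{p^m}` (infinite formal sum): for each `M` the sum of the first
`M` terms agrees with `f` modulo `x^{p^M}`. -/
def IsHondaExpansion (f : (Fq p n)⟦X⟧) (e : ℕ → Fq p n) : Prop :=
  ∀ M, PowerSeries.X ^ p ^ M ∣
    f - formalSum (honda p n) (fun m => PowerSeries.C (e m) * PowerSeries.X ^ p ^ m) M

/-- The unique coefficients with `f(x) = ∑^{H_n} e_m x^{p^m}`. -/
noncomputable def hondaCoeff (f : (Fq p n)⟦X⟧) : ℕ → Fq p n :=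
  Classical.epsilon (IsHondaExpansion f)

/-- The Witt vector `a_j` in `f = a_0 + a_1 S + ⋯ + a_{n-1} S^{n-1}`, where `S = x^p`. A Witt
vector `∑_i p^i [c_i]` acts on `H_n` by `∑^{H_n}_i c_i x^{p^{ni}}`, since `p` acts by `x^{p^n}`.
Hence `a_j = ∑_i p^i [e_{ni+j}]`, and `p^i [c]` is the Witt vector with `i`-th coordinate
`c^{p^i}` and all other coordinates zero. -/
noncomputable def wittCoeff (f : (Fq p n)⟦X⟧) (j : ℕ) : W p n :=
  WittVector.mk p fun i => hondaCoeff f (n * i + j) ^ p ^ i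

/-- The matrix `A(f)` of right multiplication by `f` on the endomorphism ring of `H_n`, in the left
`𝕎`-basis `1, S, …, S^{n-1}`, where `S^n = p` and `S a = a^φ S`. -/
noncomputable def detMatrix (f : (Fq p n)⟦X⟧) : Matrix (Fin n) (Fin n) (W p n) := fun i j =>
  if (j : ℕ) ≤ i then (WittVector.frobenius)^[j] (wittCoeff f (i - j))
  else p * (WittVector.frobenius)^[j] (wittCoeff f (n + i - j))

/-- The determinant `det : 𝔾_n → ℤ_p`, `(f, σ) ↦ det A(f)`. -/
noncomputable def det (γ : Stab p n) : ℤ_[p] := ofW p n (detMatrix γ.f).det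

variable (p n) in
/-- `r(n) = (p^n - 1) / (p - 1)`. -/
def r : ℕ := (p ^ n - 1) / (p - 1)

/-- `θ(f, σ) = f'(0)^{-r(n)} det(f) ∈ 1 + p ℤ_p`, where `f'(0)^{-r(n)} ∈ 𝔽_pˣ` is replaced by its
Teichmüller lift. -/
noncomputable def theta (γ : Stab p n) : ℤ_[p] :=
  ofW p n (WittVector.teichmuller p ((PowerSeries.coeff 1 γ.f)⁻¹ ^ r p n)) * det γ

open Classical in
/-- `ℓ(w) = (1/p) log w` for `w ∈ 1 + p ℤ_p`; it takes values in `ℤ_p`. -/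
noncomputable def ell (w : ℤ_[p]) : ℤ_[p] :=
  let q : ℚ_[p] := (p : ℚ_[p])⁻¹ * ∑' i : ℕ, (-1) ^ i * ((w : ℚ_[p]) - 1) ^ (i + 1) / (i + 1)
  if h : ‖q‖ ≤ 1 then ⟨q, h⟩ else 0

/-- `ζ = ℓ ∘ θ : 𝔾_n → ℤ_p`. -/
noncomputable def zeta (γ : Stab p n) : ℤ_[p] := ell (theta γ)

end Determinant

/-! ### The ring `𝔷_n` and powers with exponents in it -/

section Exponents
variable (p n : ℕ)

/-- `𝔷_n = lim_k ℤ/p^k(p^n - 1)`, with the inverse limit topology. -/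
def Zfrak : Subring (∀ k : ℕ, ZMod (p ^ k * (p ^ n - 1))) where
  carrier := {a | ∀ k, ZMod.castHom (mul_dvd_mul_right (pow_dvd_pow p k.le_succ) _)
    (ZMod (p ^ k * (p ^ n - 1))) (a (k + 1)) = a k}
  mul_mem' ha hb k := by
    rw [Pi.mul_apply, map_mul, ha k, hb k, Pi.mul_apply]
  one_mem' k := by simp only [Pi.one_apply, map_one]
  add_mem' ha hb k := by
    rw [Pi.add_apply, map_add, ha k, hb k, Pi.add_apply]
  zero_mem' k := by simp only [Pi.zero_apply, map_zero]
  neg_mem' ha k := by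
    rw [Pi.neg_apply, map_neg, ha k, Pi.neg_apply]

variable {p n} in
theorem natCast_pow_mul_r_eq (hp : 0 < p) {k m : ℕ} (hkm : k ≤ n * m) :
    ((p ^ (n * (m + 1)) * r p n : ℕ) : ZMod (p ^ k * (p ^ n - 1))) =
      ((p ^ (n * m) * r p n : ℕ) : ZMod (p ^ k * (p ^ n - 1))) := by
  rw [ZMod.natCast_eq_natCast_iff, Nat.ModEq.comm]
  refine (Nat.modEq_iff_dvd' ?_).2 ?_
  · gcongr
    omega
  · rw [← Nat.sub_mul, mul_add, mul_one, pow_add,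
      show p ^ (n * m) * p ^ n - p ^ (n * m) = p ^ (n * m) * (p ^ n - 1) by
        rw [Nat.mul_sub, mul_one]]
    exact Dvd.dvd.mul_right (mul_dvd_mul_right (pow_dvd_pow p hkm) _) _

/-- `λ = lim_k p^{nk} r(n) ∈ 𝔷_n`. -/
def lam [Fact p.Prime] [NeZero n] : Zfrak p n :=
  ⟨fun k => ((p ^ (n * k) * r p n : ℕ) : ZMod (p ^ k * (p ^ n - 1))), fun k => by
    rw [map_natCast]
    exact natCast_pow_mul_r_eq (Fact.out : p.Prime).pos
      (Nat.le_mul_of_pos_left k (NeZero.pos n))⟩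

theorem tendsto_lam [Fact p.Prime] [NeZero n] :
    Filter.Tendsto (fun k : ℕ => ((p ^ (n * k) * r p n : ℕ) : Zfrak p n)) Filter.atTop
      (nhds (lam p n)) := by
  rw [tendsto_subtype_rng, tendsto_pi_nhds]
  intro k
  refine tendsto_const_nhds.congr' ?_
  filter_upwards [Filter.eventually_ge_atTop k] with m hm
  have hn : ∀ j, j ≤ n * j := fun j => Nat.le_mul_of_pos_left j (NeZero.pos n)
  have key : ((p ^ (n * m) * r p n : ℕ) : ZMod (p ^ k * (p ^ n - 1))) =
      ((p ^ (n * k) * r p n : ℕ) : ZMod (p ^ k * (p ^ n - 1))) := by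
    induction m, hm using Nat.le_induction with
    | base => rfl
    | succ m hm ih =>
      rw [natCast_pow_mul_r_eq (Fact.out : p.Prime).pos (hm.trans (hn m)), ih]
  simp only [lam, ← key]
  simp

variable {p n} in
/-- The power `x^a`, for `x ∈ E₀ˣ` and `a ∈ 𝔷_n`: the unique unit that is congruent to `x^{a_k}`
modulo `𝔪^{k+1}` for each `k`, where `a_k` is an integer representing `a` in `ℤ/p^k(p^n - 1)`. -/
noncomputable def unitPow [Fact p.Prime] (x : (E0 p n)ˣ) (a : Zfrak p n) : (E0 p n)ˣ :=
  Classical.epsilon fun y : (E0 p n)ˣ => ∀ k : ℕ,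
    (y : E0 p n) - (x : E0 p n) ^ (a.1 k).val ∈ IsLocalRing.maximalIdeal (E0 p n) ^ (k + 1)

end Exponents

/-! ### The exponential -/

section Exponential
variable (p n : ℕ) [Fact p.Prime]

/-- `p^i / i!`, which lies in `ℤ_p`. -/
noncomputable def expCoeff (i : ℕ) : ℤ_[p] :=
  ⟨(p : ℚ_[p]) ^ i / (i.factorial : ℚ_[p]), by
    have hi : (i.factorial : ℚ_[p]) ≠ 0 := by exact_mod_cast i.factorial_ne_zero
    have h1 : (1 : ℝ) < p := by exact_mod_cast (Fact.out : p.Prime).one_lt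
    rw [norm_div, Padic.norm_p_pow, Padic.norm_eq_zpow_neg_valuation hi,
      ← zpow_sub₀ (by positivity), zpow_le_one_iff_right₀ h1, Padic.valuation_natCast]
    have := padicValNat_factorial_le p i
    omega⟩

variable {p n} in
/-- `exp(p x) = ∑_i p^i x^i / i!` for `x ∈ E₀`. -/
noncomputable def expP (x : E0 p n) : E0 p n := ∑' i : ℕ, toE0 p n (expCoeff p i) * x ^ i

end Exponential

/-! ### Continuous cohomology in degree one -/

section Cohomology
variable {Γ M : Type*} [Group Γ] [TopologicalSpace Γ] [CommGroup M] [TopologicalSpace M]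
  [IsTopologicalGroup M]

/-- Continuous crossed homomorphisms `c : Γ → M`, `c(gh) = c(g) · g c(h)`, for the action `ρ` of
`Γ` on the (multiplicatively written) abelian group `M`. -/
def Z1 (ρ : Γ → M →* M) : Subgroup (Γ → M) where
  carrier := {c | Continuous c ∧ ∀ g h, c (g * h) = c g * ρ g (c h)}
  mul_mem' := fun {a b} ha hb => ⟨ha.1.mul hb.1, fun g h => by
    simp only [Pi.mul_apply, ha.2 g h, hb.2 g h, map_mul]
    exact mul_mul_mul_comm _ _ _ _⟩
  one_mem' := ⟨continuous_const, fun g h => by simp⟩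
  inv_mem' := fun {a} ha => ⟨ha.1.inv, fun g h => by
    simp only [Pi.inv_apply, ha.2 g h, map_inv, mul_inv]⟩

/-- Coboundaries `g ↦ (g m) / m`. -/
def B1 (ρ : Γ → M →* M) : Subgroup (Z1 ρ) where
  carrier := {c | ∃ m : M, ∀ g, c.1 g = ρ g m / m}
  mul_mem' := by
    rintro a b ⟨m, hm⟩ ⟨m', hm'⟩
    refine ⟨m * m', fun g => ?_⟩
    rw [Subgroup.coe_mul, Pi.mul_apply, hm, hm', map_mul, mul_div_mul_comm]
  one_mem' := ⟨1, fun g => by simp⟩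
  inv_mem' := by
    rintro a ⟨m, hm⟩
    refine ⟨m⁻¹, fun g => ?_⟩
    rw [Subgroup.coe_inv, Pi.inv_apply, hm, map_inv, inv_div_inv, inv_div]

/-- The continuous cohomology group `H¹(Γ, M)`, written multiplicatively. -/
abbrev H1 (ρ : Γ → M →* M) := Z1 ρ ⧸ B1 ρ

/-- The class of a continuous crossed homomorphism. -/
def cls {ρ : Γ → M →* M} (c : Z1 ρ) : H1 ρ := QuotientGroup.mk c

end Cohomology

section Coefficients
variable (p n : ℕ) [Fact p.Prime]

/-- The action of `𝔾_n` on the additive group of `E₀`. -/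
noncomputable def addAct (γ : Stab p n) : Multiplicative (E0 p n) →* Multiplicative (E0 p n) :=
  AddMonoidHom.toMultiplicative (act γ : E0 p n →+ E0 p n)

/-- The action of `𝔾_n` on the units of `E₀`. -/
noncomputable def unitAct (γ : Stab p n) : (E0 p n)ˣ →* (E0 p n)ˣ :=
  Units.map (act γ : E0 p n →* E0 p n)

/-- The ideal `p E₀`. -/
noncomputable abbrev pIdeal : Ideal (E0 p n) := Ideal.span {(p : E0 p n)}

variable {p n}

theorem pIdeal_le_comap (γ : Stab p n) : pIdeal p n ≤ (pIdeal p n).comap (act γ) := by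
  rw [pIdeal, Ideal.span_singleton_le_iff_mem, Ideal.mem_comap, map_natCast]
  exact Ideal.mem_span_singleton_self _

/-- A crossed homomorphism `c : 𝔾_n → E₀ˣ` defines the invertible Morava module `E₀⟨c⟩`, free on a
generator `x` with `γ x = c(γ) x`, so that `γ (a x) = c(γ) φ_γ(a) x`. This is the action of `γ` on
`E₀⟨c⟩ / p`, a free module of rank one over `E₀ / p`, in terms of the generator `x`. -/
noncomputable def twistedActModP (c : Z1 (unitAct p n)) (γ : Stab p n) (a : E0 p n ⧸ pIdeal p n) :
    E0 p n ⧸ pIdeal p n :=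
  Ideal.Quotient.mk (pIdeal p n) (c.1 γ : E0 p n) *
    Ideal.quotientMap (pIdeal p n) (act γ) (pIdeal_le_comap γ) a

/-- The Morava modules `E₀⟨c⟩ / p` and `E₀⟨c'⟩ / p` are isomorphic. -/
def IsoModP (c c' : Z1 (unitAct p n)) : Prop :=
  ∃ Φ : (E0 p n ⧸ pIdeal p n) ≃ₗ[E0 p n] (E0 p n ⧸ pIdeal p n),
    ∀ γ a, Φ (twistedActModP c γ a) = twistedActModP c' γ (Φ a)

end Coefficients

end Morava

set_option linter.unusedSectionVars false

/-! Everything takes place in `ℤ_p`. For a unit `x` of `E₀` the powers `x^{p^{nk}}` converge to the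
Teichmüller lift of the residue of `x`, so `x^λ` is the Teichmüller lift of the `r(n)`-th power of
that residue. Since `ψ_g` lifts `g`, this gives `t₀^λ = τ`, where `τ(g) = [g'(0)^{r(n)}]` lies in
`ℤ_pˣ` (`unitPow_lam`, `toE0_tau`). On the other side `A(g)` is triangular modulo `p`, with diagonal
entries `g'(0)^{p^j}` for `0 ≤ j < n`, and these exponents add up to `r(n)`. Hence `det ≡ τ` modulo
`p` (`dvd_det_sub_tau`), and the identity of `E₀/p` is the required isomorphism of Morava modules.

The quotient `θ = det/τ` lies in `1 + pℤ_p`. For `p > 2` the maps `x ↦ exp(px)` and `(1/p) log` are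
inverse bijections between `ℤ_p` and `1 + pℤ_p`, so `exp(pζ) = τ⁻¹ det` already holds as functions
(`expP_zeta`). Changing `ζ` by the coboundary of `m` changes the exponential by the coboundary of
`exp(pm)`, because `𝔾_n` acts by continuous ring maps that fix `ℤ_p` (`act_expP`). Of the pair
`(φ_g, ψ_g)` this uses only that `φ_g` is a `𝕎`-algebra map, which is automatically local, and that
`ψ_g` reduces to `g`.

The labour lies in showing that `det` is a continuous homomorphism to `ℤ_pˣ`, which needs the
structure of `End(H_n)`. The group law `univ` is a choice, so it has to be shown to exist and to be
unique. Existence is Hazewinkel's functional equation lemma (`ArakiDatum.exists_log_subst_eq`).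
Uniqueness holds because the `p`-series determines the logarithm (`ArakiDatum.eq_fgl`). Setting all
`u_i = 0` yields a lift of `H_n` to `𝕎` whose logarithm only involves the powers `x^{p^{nk}}`, and
therefore `𝕎` acts on it and on `H_n`. The leading exponent of an endomorphism of `H_n` is a power
of `p`, so every endomorphism is a sum of terms `a_j S^j` with `a_j ∈ 𝕎` (`Curve.IsEndo.eq_sum`).
These coordinates are unique, with a quantitative form that gives continuity
(`Curve.pow_dvd_of_sum_mem_fil`). Then `A(fg) = A(g) A(f)`. Finally `S g = g^φ S` together with `det
A(S) ≠ 0` makes `det A(g)` invariant under Frobenius, so that it lies in `ℤ_p`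
(`Curve.IsEndo.frobenius_det`). -/

namespace Morava
open scoped PowerSeries

/-! ### Power series modulo terms of high total degree -/

section LowDegree
variable {τ R S : Type*} [CommRing R] [CommRing S]

/-- The ideal of power series without terms of total degree less than `M`. -/
def lowIdeal (τ R : Type*) [CommRing R] (M : ℕ) : Ideal (MvPowerSeries τ R) where
  carrier := {f | ∀ d : τ →₀ ℕ, d.degree < M → MvPowerSeries.coeff d f = 0}
  add_mem' ha hb d hd := by rw [map_add, ha d hd, hb d hd, add_zero]
  zero_mem' d _ := by simp
  smul_mem' c x hx d hd := by
    classical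
    rw [smul_eq_mul, MvPowerSeries.coeff_mul]
    refine Finset.sum_eq_zero fun q hq => ?_
    have h := congrArg Finsupp.degree (Finset.HasAntidiagonal.mem_antidiagonal.1 hq)
    rw [map_add] at h
    rw [hx q.2 (by omega), mul_zero]

theorem mem_lowIdeal_one {f : MvPowerSeries τ R} :
    f ∈ lowIdeal τ R 1 ↔ MvPowerSeries.constantCoeff f = 0 := by
  refine ⟨fun h => h 0 (by simp), fun h d hd => ?_⟩
  have : d = 0 := (Finsupp.degree_eq_zero_iff d).1 (by omega)
  rw [this]; exact h

theorem lowIdeal_anti {M N : ℕ} (h : M ≤ N) : lowIdeal τ R N ≤ lowIdeal τ R M :=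
  fun _ hf d hd => hf d (hd.trans_le h)

theorem mul_mem_lowIdeal {M N : ℕ} {f g : MvPowerSeries τ R} (hf : f ∈ lowIdeal τ R M)
    (hg : g ∈ lowIdeal τ R N) : f * g ∈ lowIdeal τ R (M + N) := by
  classical
  intro d hd
  rw [MvPowerSeries.coeff_mul]
  refine Finset.sum_eq_zero fun q hq => ?_
  have h := congrArg Finsupp.degree (Finset.HasAntidiagonal.mem_antidiagonal.1 hq)
  rw [map_add] at h
  by_cases h1 : q.1.degree < M
  · rw [hf _ h1, zero_mul]
  · rw [hg q.2 (by omega), mul_zero]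

theorem pow_mem_lowIdeal {M : ℕ} {f : MvPowerSeries τ R} (hf : f ∈ lowIdeal τ R M) (k : ℕ) :
    f ^ k ∈ lowIdeal τ R (k * M) := by
  induction k with
  | zero => intro d hd; simp at hd
  | succ k ih => rw [pow_succ, Nat.succ_mul]; exact mul_mem_lowIdeal ih hf

theorem pow_mem_lowIdeal_of_constantCoeff {f : MvPowerSeries τ R}
    (hf : MvPowerSeries.constantCoeff f = 0) (k : ℕ) : f ^ k ∈ lowIdeal τ R k := by
  simpa using pow_mem_lowIdeal (mem_lowIdeal_one.2 hf) k

/-- Congruent series without constant term have powers congruent to one degree more. -/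
theorem pow_sub_pow_mem_lowIdeal {M k : ℕ} (hk : 2 ≤ k) {f g : MvPowerSeries τ R}
    (hf : MvPowerSeries.constantCoeff f = 0) (hg : MvPowerSeries.constantCoeff g = 0)
    (h : f - g ∈ lowIdeal τ R M) : f ^ k - g ^ k ∈ lowIdeal τ R (M + 1) := by
  rw [← Commute.mul_geom_sum₂ (Commute.all f g) k]
  refine mul_mem_lowIdeal h (Ideal.sum_mem _ fun i hi => ?_)
  rw [Finset.mem_range] at hi
  rcases Nat.eq_zero_or_pos i with rfl | hi0
  · exact Ideal.mul_mem_left _ _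
      (lowIdeal_anti (by omega) (pow_mem_lowIdeal_of_constantCoeff hg _))
  · exact Ideal.mul_mem_right _ _
      (lowIdeal_anti (by omega) (pow_mem_lowIdeal_of_constantCoeff hf _))

theorem map_mem_lowIdeal (φ : R →+* S) {M : ℕ} {f : MvPowerSeries τ R}
    (hf : f ∈ lowIdeal τ R M) : MvPowerSeries.map φ f ∈ lowIdeal τ S M := by
  intro d hd
  rw [MvPowerSeries.coeff_map, hf d hd, map_zero]

theorem degree_smul_nat (p : ℕ) (d : τ →₀ ℕ) : (p • d).degree = p * d.degree := by
  rw [map_nsmul, smul_eq_mul]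

theorem expand_mem_lowIdeal {p : ℕ} (hp : p ≠ 0) {M : ℕ} {f : MvPowerSeries τ R}
    (hf : f ∈ lowIdeal τ R M) : MvPowerSeries.expand p hp f ∈ lowIdeal τ R (p * M) := by
  intro d hd
  by_cases h : ∀ i, p ∣ d i
  · have : d = p • Finsupp.mapRange (· / p) (Nat.zero_div p) d := by
      ext i; simp [Nat.mul_div_cancel' (h i)]
    rw [this] at hd ⊢
    rw [degree_smul_nat] at hd
    rw [MvPowerSeries.coeff_expand_smul, hf _ (lt_of_mul_lt_mul_left hd (Nat.zero_le p))]
  · push Not at h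
    obtain ⟨i, hi⟩ := h
    exact MvPowerSeries.coeff_expand_of_not_dvd p hp f hi

theorem X_pow_dvd_iff_mem_lowIdeal {M : ℕ} {f : R⟦X⟧} :
    PowerSeries.X ^ M ∣ f ↔ f ∈ lowIdeal Unit R M := by
  rw [PowerSeries.X_pow_dvd_iff]
  refine ⟨fun h d hd => ?_, fun h m hm => h _ (by simpa using hm)⟩
  have := h (d ()) (by
    have : d = Finsupp.single () (d ()) := by ext; simp
    rw [this] at hd; simpa using hd)
  have hd' : d = Finsupp.single () (d ()) := by ext; simp
  rw [hd']; exact this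

end LowDegree

/-! ### Logarithms and formal sums -/

section Logarithm
variable {R : Type*} [CommRing R] {τ : Type*}

/-- A power series `l` with `l(0) = 0` and `l'(0) = 1`. -/
structure IsNormalized (l : R⟦X⟧) : Prop where
  zero : PowerSeries.constantCoeff l = 0
  one : PowerSeries.coeff 1 l = 1

variable {l : R⟦X⟧}

theorem IsNormalized.isUnit (h : IsNormalized l) : IsUnit (PowerSeries.coeff 1 l) := by
  rw [h.one]; exact isUnit_one

/-- The compositional inverse of `l`. -/
noncomputable def IsNormalized.inverse (h : IsNormalized l) : R⟦X⟧ :=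
  l.substInvOfIsUnit h.isUnit

theorem IsNormalized.inverse_zero (h : IsNormalized l) :
    PowerSeries.constantCoeff h.inverse = 0 := by simp [IsNormalized.inverse]

theorem IsNormalized.inverse_subst (h : IsNormalized l) {a : MvPowerSeries τ R}
    (ha : MvPowerSeries.constantCoeff a = 0) : h.inverse.subst (l.subst a) = a := by
  have := PowerSeries.subst_comp_subst_apply (hasSubst_of_zero (a := l) h.zero)
    (hasSubst_of_zero ha) h.inverse
  rw [← this, IsNormalized.inverse, PowerSeries.subst_substInvOfIsUnit_left _ h.zero,
    PowerSeries.subst_X (hasSubst_of_zero ha)]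

theorem IsNormalized.subst_inverse (h : IsNormalized l) {a : MvPowerSeries τ R}
    (ha : MvPowerSeries.constantCoeff a = 0) : l.subst (h.inverse.subst a) = a := by
  have := PowerSeries.subst_comp_subst_apply (hasSubst_of_zero (a := h.inverse) h.inverse_zero)
    (hasSubst_of_zero ha) l
  rw [← this, IsNormalized.inverse, PowerSeries.subst_substInvOfIsUnit_right _ h.zero,
    PowerSeries.subst_X (hasSubst_of_zero ha)]

theorem IsNormalized.inj (h : IsNormalized l) {a b : MvPowerSeries τ R}
    (ha : MvPowerSeries.constantCoeff a = 0) (hb : MvPowerSeries.constantCoeff b = 0)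
    (hab : l.subst a = l.subst b) : a = b := by
  rw [← h.inverse_subst ha, hab, h.inverse_subst hb]

theorem hasSubst_pair' {a b : MvPowerSeries τ R}
    (ha : MvPowerSeries.constantCoeff a = 0) (hb : MvPowerSeries.constantCoeff b = 0) :
    MvPowerSeries.HasSubst ![a, b] :=
  MvPowerSeries.hasSubst_of_constantCoeff_zero (by intro s; fin_cases s <;> simpa)

/-- `l` is a logarithm of `F`. -/
def IsLog (F : MvPowerSeries (Fin 2) R) (l : R⟦X⟧) : Prop :=
  l.subst F = l.subst (MvPowerSeries.X 0 : MvPowerSeries (Fin 2) R) +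
    l.subst (MvPowerSeries.X 1 : MvPowerSeries (Fin 2) R)

theorem subst_pair_subst' {f : R⟦X⟧} {P : MvPowerSeries (Fin 2) R} {a b : MvPowerSeries τ R}
    (hP : MvPowerSeries.constantCoeff P = 0)
    (ha : MvPowerSeries.constantCoeff a = 0) (hb : MvPowerSeries.constantCoeff b = 0) :
    MvPowerSeries.subst ![a, b] (f.subst P) = f.subst (MvPowerSeries.subst ![a, b] P) := by
  rw [PowerSeries.subst, PowerSeries.subst,
    MvPowerSeries.subst_comp_subst_apply (hasSubst_of_zero hP).const (hasSubst_pair' ha hb)]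

theorem constantCoeff_subst_pair {F : MvPowerSeries (Fin 2) R} {a b : MvPowerSeries τ R}
    (hF : MvPowerSeries.constantCoeff F = 0)
    (ha : MvPowerSeries.constantCoeff a = 0) (hb : MvPowerSeries.constantCoeff b = 0) :
    MvPowerSeries.constantCoeff (MvPowerSeries.subst ![a, b] F) = 0 :=
  MvPowerSeries.constantCoeff_subst_eq_zero (hasSubst_pair' ha hb)
    (by intro s; fin_cases s <;> assumption) hF

theorem IsLog.subst_add {F : MvPowerSeries (Fin 2) R} (hl : IsLog F l)
    (hF : MvPowerSeries.constantCoeff F = 0) {a b : MvPowerSeries τ R}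
    (ha : MvPowerSeries.constantCoeff a = 0) (hb : MvPowerSeries.constantCoeff b = 0) :
    l.subst (MvPowerSeries.subst ![a, b] F) = l.subst a + l.subst b := by
  have h := congrArg (MvPowerSeries.subst ![a, b]) hl
  have hs := hasSubst_pair' ha hb
  rw [subst_pair_subst' hF ha hb, MvPowerSeries.subst_add hs,
    subst_pair_subst' (by simp) ha hb, subst_pair_subst' (by simp) ha hb,
    MvPowerSeries.subst_X hs, MvPowerSeries.subst_X hs] at h
  exact h

theorem IsNormalized.zero_subst (h : IsNormalized l) :
    l.subst (0 : MvPowerSeries τ R) = 0 :=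
  PowerSeries.subst_zero_of_constantCoeff_zero h.zero

theorem formalSum_constantCoeff (F : FormalGroup R) {f : ℕ → R⟦X⟧} {m : ℕ}
    (hf : ∀ i < m, PowerSeries.constantCoeff (f i) = 0) :
    PowerSeries.constantCoeff (formalSum F f m) = 0 := by
  induction m with
  | zero => simp [formalSum]
  | succ m ih =>
    exact constantCoeff_subst_pair F.zero_constantCoeff (ih fun i hi => hf i (by omega))
      (hf m (by omega))

theorem IsLog.formalSum {F : FormalGroup R} (hl : IsLog F.toPowerSeries l)
    (hn : IsNormalized l) {f : ℕ → R⟦X⟧} {m : ℕ}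
    (hf : ∀ i < m, PowerSeries.constantCoeff (f i) = 0) :
    l.subst (Morava.formalSum F f m) = ∑ i ∈ Finset.range m, (l.subst (f i) : R⟦X⟧) := by
  induction m with
  | zero => simpa [Morava.formalSum] using hn.zero_subst
  | succ m ih =>
    rw [Finset.sum_range_succ, ← ih fun i hi => hf i (by omega)]
    exact hl.subst_add F.zero_constantCoeff
      (formalSum_constantCoeff F fun i hi => hf i (by omega)) (hf m (by omega))

theorem formalSum_map {S : Type*} [CommRing S] (φ : R →+* S) (F : FormalGroup R) {f : ℕ → R⟦X⟧}
    {m : ℕ} (hf : ∀ i < m, PowerSeries.constantCoeff (f i) = 0) :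
    PowerSeries.map φ (formalSum F f m) =
      formalSum (F.map φ) (fun i => PowerSeries.map φ (f i)) m := by
  induction m with
  | zero => simp [formalSum]
  | succ m ih =>
    have h0 := formalSum_constantCoeff F fun i hi => hf i (Nat.lt_succ_of_lt hi)
    rw [formalSum, formalSum, ← ih fun i hi => hf i (by omega)]
    refine (MvPowerSeries.map_subst (hasSubst_pair' h0 (hf m (by omega))) _).trans ?_
    rw [FormalGroup.map_toPowerSeries]
    congr 1
    funext s
    fin_cases s <;> rfl

end Logarithm

/-! ### Power series supported on the exponents `p^k` -/

section TypicalSeries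
variable {p : ℕ} [Fact p.Prime] {τ R : Type*} [CommRing R]

/-- The power series `∑_k c_k x^{p^k}`. -/
noncomputable def typicalSeries (p : ℕ) (c : ℕ → R) : R⟦X⟧ :=
  PowerSeries.mk fun m => if m = p ^ Nat.log p m then c (Nat.log p m) else 0

/-- The truncation `∑_{k < N} c_k α^{p^k}` of the value at `α` of `∑_k c_k x^{p^k}`. -/
noncomputable def truncEval (p N : ℕ) (c : ℕ → R) (α : MvPowerSeries τ R) : MvPowerSeries τ R :=
  ∑ j ∈ Finset.range N, c j • α ^ p ^ j

theorem coeff_typicalSeries_pow (c : ℕ → R) (k : ℕ) :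
    PowerSeries.coeff (p ^ k) (typicalSeries p c) = c k := by
  have : Nat.log p (p ^ k) = k := Nat.log_pow (Fact.out : p.Prime).one_lt k
  simp [typicalSeries, this]

theorem eq_pow_of_coeff_typicalSeries_ne_zero {c : ℕ → R} {m : ℕ}
    (h : PowerSeries.coeff m (typicalSeries p c) ≠ 0) : ∃ k, m = p ^ k := by
  by_contra! h'
  simp [typicalSeries, h' (Nat.log p m)] at h

theorem typicalSeries_isNormalized {c : ℕ → R} (hc : c 0 = 1) :
    IsNormalized (typicalSeries p c) := by
  constructor
  · rw [← PowerSeries.coeff_zero_eq_constantCoeff_apply]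
    by_contra h
    obtain ⟨k, hk⟩ := eq_pow_of_coeff_typicalSeries_ne_zero (p := p) h
    exact pow_ne_zero k (Fact.out : p.Prime).ne_zero hk.symm
  · have := coeff_typicalSeries_pow (p := p) c 0
    rwa [pow_zero, hc] at this

theorem eq_typicalSeries {l : R⟦X⟧}
    (h : ∀ m, PowerSeries.coeff m l ≠ 0 → ∃ k, m = p ^ k) :
    l = typicalSeries p fun k => PowerSeries.coeff (p ^ k) l := by
  ext m
  by_cases hm : ∃ k, m = p ^ k
  · obtain ⟨k, rfl⟩ := hm
    rw [coeff_typicalSeries_pow]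
  · rw [not_imp_comm.1 (h m) hm,
      not_imp_comm.1 (eq_pow_of_coeff_typicalSeries_ne_zero (p := p)) hm]

theorem map_typicalSeries {S : Type*} [CommRing S] (φ : R →+* S) (c : ℕ → R) :
    PowerSeries.map φ (typicalSeries p c) = typicalSeries p fun k => φ (c k) := by
  ext m
  simp only [typicalSeries, PowerSeries.coeff_map, PowerSeries.coeff_mk]
  split_ifs <;> simp

/-- The value of `∑_k c_k x^{p^k}` at a series without constant term agrees in degrees less than
`p^N` with the truncated sum. -/
theorem typicalSeries_subst_sub_mem (c : ℕ → R) (N : ℕ) {α : MvPowerSeries τ R}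
    (hα : MvPowerSeries.constantCoeff α = 0) :
    (typicalSeries p c).subst α - truncEval p N c α ∈ lowIdeal τ R (p ^ N) := by
  have hp := (Fact.out : p.Prime).one_lt
  intro d hd
  rw [map_sub, sub_eq_zero, PowerSeries.coeff_subst (hasSubst_of_zero hα),
    finsum_eq_sum_of_support_subset (s := (Finset.range N).image (p ^ ·)),
    Finset.sum_image (fun a _ b _ h => Nat.pow_right_injective hp h), truncEval, map_sum]
  · simp [coeff_typicalSeries_pow]
  · intro m hm
    rw [Function.mem_support] at hm
    obtain ⟨k, rfl⟩ := eq_pow_of_coeff_typicalSeries_ne_zero (p := p) (left_ne_zero_of_smul hm)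
    have h2 : ¬ d.degree < p ^ k := fun h =>
      right_ne_zero_of_smul hm (pow_mem_lowIdeal_of_constantCoeff hα _ d h)
    simp only [Finset.coe_image, Finset.coe_range, Set.mem_image, Set.mem_Iio]
    exact ⟨k, (Nat.pow_lt_pow_iff_right hp).1 (by omega), rfl⟩

end TypicalSeries

/-! ### Lifts of Frobenius on power series rings -/

section Twist
variable (p : ℕ) [hp : Fact p.Prime] {τ R : Type*} [CommRing R]

/-- The endomorphism `f(x) ↦ f^σ(x^p)` of a power series ring. -/
noncomputable def twist (τ : Type*) (σ : R →+* R) : MvPowerSeries τ R →+* MvPowerSeries τ R :=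
  (MvPowerSeries.expand p hp.out.ne_zero).toRingHom.comp (MvPowerSeries.map σ)

theorem twist_apply (σ : R →+* R) (f : MvPowerSeries τ R) :
    twist p τ σ f = MvPowerSeries.expand p hp.out.ne_zero (MvPowerSeries.map σ f) := rfl

theorem twist_smul (σ : R →+* R) (c : R) (f : MvPowerSeries τ R) :
    twist p τ σ (c • f) = σ c • twist p τ σ f := by
  rw [twist_apply, twist_apply, MvPowerSeries.smul_eq_C_mul, map_mul, MvPowerSeries.map_C, map_mul,
    MvPowerSeries.expand_C, ← MvPowerSeries.smul_eq_C_mul]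

theorem twist_X (σ : R →+* R) (i : τ) :
    twist p τ σ (MvPowerSeries.X i) = MvPowerSeries.X i ^ p := by
  rw [twist_apply, MvPowerSeries.map_X, MvPowerSeries.expand_X]

theorem twist_pow_X (σ : R →+* R) (i : τ) (k : ℕ) :
    (twist p τ σ ^ k) (MvPowerSeries.X i) = MvPowerSeries.X i ^ p ^ k := by
  induction k with
  | zero => simp
  | succ k ih => rw [pow_succ', RingHom.mul_def, RingHom.comp_apply, ih, map_pow, twist_X,
      ← pow_mul, pow_succ']

theorem twist_pow_smul (σ : R →+* R) (k : ℕ) (c : R) (f : MvPowerSeries τ R) :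
    (twist p τ σ ^ k) (c • f) = (σ ^ k) c • (twist p τ σ ^ k) f := by
  induction k with
  | zero => simp
  | succ k ih => simp only [pow_succ', RingHom.mul_def, RingHom.comp_apply, ih, twist_smul]

theorem twist_pow_mem_lowIdeal (σ : R →+* R) (k : ℕ) {M : ℕ} {f : MvPowerSeries τ R}
    (hf : f ∈ lowIdeal τ R M) : (twist p τ σ ^ k) f ∈ lowIdeal τ R (p ^ k * M) := by
  induction k with
  | zero => simpa using hf
  | succ k ih =>
    rw [pow_succ' (twist p τ σ), RingHom.mul_def, RingHom.comp_apply, pow_succ' p, mul_assoc]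
    exact expand_mem_lowIdeal hp.out.ne_zero (map_mem_lowIdeal σ ih)

theorem map_twist {S : Type*} [CommRing S] (φ : R →+* S) {σ : R →+* R} {σ' : S →+* S}
    (h : φ.comp σ = σ'.comp φ) (f : MvPowerSeries τ R) :
    MvPowerSeries.map φ (twist p τ σ f) = twist p τ σ' (MvPowerSeries.map φ f) := by
  rw [twist_apply, twist_apply, MvPowerSeries.map_expand]
  congr 1
  ext d
  simpa using congrArg (fun g => g (MvPowerSeries.coeff d f)) h

theorem map_twist_pow {S : Type*} [CommRing S] (φ : R →+* S) {σ : R →+* R} {σ' : S →+* S}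
    (h : φ.comp σ = σ'.comp φ) (k : ℕ) (f : MvPowerSeries τ R) :
    MvPowerSeries.map φ ((twist p τ σ ^ k) f) = (twist p τ σ' ^ k) (MvPowerSeries.map φ f) := by
  induction k with
  | zero => simp
  | succ k ih =>
    rw [pow_succ', RingHom.mul_def, RingHom.comp_apply, map_twist p φ h, ih, pow_succ',
      RingHom.mul_def, RingHom.comp_apply]

theorem natCast_dvd_iff_coeff {m : ℕ} {f : MvPowerSeries τ R} :
    (m : MvPowerSeries τ R) ∣ f ↔ ∀ d, (m : R) ∣ MvPowerSeries.coeff d f := by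
  constructor
  · rintro ⟨g, rfl⟩ d
    rw [← nsmul_eq_mul, map_nsmul, nsmul_eq_mul]
    exact dvd_mul_right _ _
  · intro h
    choose g hg using h
    obtain ⟨g', hg'⟩ : ∃ g' : MvPowerSeries τ R, ∀ d, MvPowerSeries.coeff d g' = g d :=
      ⟨g, fun _ => rfl⟩
    refine ⟨g', ?_⟩
    ext d
    rw [← nsmul_eq_mul, map_nsmul, nsmul_eq_mul, hg, hg']

/-- A lift of Frobenius on coefficients gives a lift of Frobenius on power series. -/
theorem dvd_twist_sub_pow {σ : R →+* R} (h : ∀ a, (p : R) ∣ σ a - a ^ p)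
    (f : MvPowerSeries τ R) : (p : MvPowerSeries τ R) ∣ twist p τ σ f - f ^ p := by
  set q := Ideal.Quotient.mk (Ideal.span {(p : R)})
  rw [natCast_dvd_iff_coeff]
  intro d
  rw [← Ideal.mem_span_singleton, ← Ideal.Quotient.eq_zero_iff_mem]
  rcases subsingleton_or_nontrivial (R ⧸ Ideal.span {(p : R)}) with hs | hn
  · exact Subsingleton.elim _ _
  have : CharP (R ⧸ Ideal.span {(p : R)}) p := by
    rw [CharP.charP_iff_prime_eq_zero hp.out, ← map_natCast q]
    exact Ideal.Quotient.eq_zero_iff_mem.2 (Ideal.mem_span_singleton_self _)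
  -- Modulo `p` the lift `σ` is the `p`-th power map. In characteristic `p`, raising the
  -- coefficients to the `p`-th power and substituting `x^p` amounts to taking the `p`-th power of
  -- the series.
  have hq : q.comp σ = (frobenius _ p).comp q := by
    ext a
    rw [RingHom.comp_apply, RingHom.comp_apply, frobenius_def, ← map_pow, ← sub_eq_zero,
      ← map_sub]
    exact Ideal.Quotient.eq_zero_iff_mem.2 (Ideal.mem_span_singleton.2 (h a))
  change q _ = 0
  rw [← MvPowerSeries.coeff_map, map_sub, map_pow, twist_apply, MvPowerSeries.map_expand]
  have : MvPowerSeries.map q (MvPowerSeries.map σ f) =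
      MvPowerSeries.map (frobenius _ p) (MvPowerSeries.map q f) := by
    ext d
    simpa using congrArg (fun g => g (MvPowerSeries.coeff d f)) hq
  rw [this, ← MvPowerSeries.map_expand, MvPowerSeries.map_frobenius_expand, sub_self, map_zero]

theorem dvd_twist_pow_sub_pow {σ : R →+* R} (h : ∀ a, (p : R) ∣ σ a - a ^ p) (k : ℕ)
    (f : MvPowerSeries τ R) :
    (p : MvPowerSeries τ R) ∣ (twist p τ σ ^ k) f - f ^ p ^ k := by
  induction k with
  | zero => simp
  | succ k ih =>
    rw [pow_succ', RingHom.mul_def, RingHom.comp_apply, pow_succ, pow_mul]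
    have h1 := dvd_twist_sub_pow p h ((twist p τ σ ^ k) f)
    have h2 := ih.trans (sub_dvd_pow_sub_pow _ _ p)
    have := dvd_add h1 h2
    rwa [sub_add_sub_cancel] at this

end Twist

/-! ### Araki parameters and the coefficients of the logarithm -/

/-- The data defining a `p`-typical formal group law over `A` with `p`-series
`p x + v_1 x^p + v_2 x^{p^2} + ⋯` (formal sum): a lift of Frobenius `σ` and a sequence `v`
with `σ v_i = v_i^p`. -/
structure ArakiDatum (p : ℕ) (A : Type*) [CommRing A] where
  /-- A lift of Frobenius. -/
  σ : A →+* A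
  /-- The Araki parameters. -/
  v : ℕ → A
  dvd_frob : ∀ a, (p : A) ∣ σ a - a ^ p
  v_zero : v 0 = p
  σ_v : ∀ i, σ (v (i + 1)) = v (i + 1) ^ p
  isUnit : ∀ a : A, IsUnit (1 - (p : A) * a)
  regular : (p : A) ∈ nonZeroDivisors A

namespace ArakiDatum
variable {p : ℕ} [hp : Fact p.Prime] {A : Type*} [CommRing A] (D : ArakiDatum p A)

/-- The pair `(p s_k, p^k ℓ_k)`, where `∑ ℓ_k x^{p^k}` is the logarithm and `s_k` are the
coefficients of its functional equation `ℓ_k = ∑_{0 < m ≤ k} s_m σ^m(ℓ_{k-m})`. -/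
noncomputable def coeffPair : ℕ → A × A
  | 0 => (0, 1)
  | k + 1 =>
    -- This solves the relation of `v_succ` for `w_{k+1} = p s_{k+1}`, whose coefficient there is
    -- `p^{p^{k+1}-1} - 1`. The exponents of `p` are what remains after cancelling the denominator
    -- `p^{j+1}` of `s_{m+1} σ^{m+1}(ℓ_j)`, where `j = k - m`. They involve no truncated
    -- subtraction, since `j < p^j`.
    let w := Ring.inverse (1 - (p : A) ^ (p ^ (k + 1) - 1)) *
      (D.v (k + 1) + ∑ m : Fin k, (coeffPair (m + 1)).1 * (D.σ ^ (m + 1 : ℕ)) (coeffPair (k - m)).2 *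
        ((p : A) ^ (p ^ (k + 1) - (k - m) - 1) - (p : A) ^ (p ^ (k - m : ℕ) - (k - m) - 1)))
    (w, ∑ m : Fin k, (p : A) ^ (m : ℕ) * (coeffPair (m + 1)).1 *
      (D.σ ^ (m + 1 : ℕ)) (coeffPair (k - m)).2 + (p : A) ^ k * w)

/-- `w_k = p s_k`. -/
noncomputable def w (k : ℕ) : A := (D.coeffPair k).1

/-- `p^k ℓ_k`. -/
noncomputable def lam (k : ℕ) : A := (D.coeffPair k).2

theorem lam_zero : D.lam 0 = 1 := by rw [lam, coeffPair]

theorem w_succ (k : ℕ) : D.w (k + 1) = Ring.inverse (1 - (p : A) ^ (p ^ (k + 1) - 1)) *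
      (D.v (k + 1) + ∑ m ∈ Finset.range k, D.w (m + 1) * (D.σ ^ (m + 1 : ℕ)) (D.lam (k - m)) *
        ((p : A) ^ (p ^ (k + 1) - (k - m) - 1) - (p : A) ^ (p ^ (k - m : ℕ) - (k - m) - 1))) := by
  rw [w, coeffPair, Finset.sum_range]
  rfl

theorem lam_succ (k : ℕ) : D.lam (k + 1) = ∑ m ∈ Finset.range (k + 1),
    (p : A) ^ (m : ℕ) * D.w (m + 1) * (D.σ ^ (m + 1 : ℕ)) (D.lam (k - m)) := by
  rw [Finset.sum_range_succ, Nat.sub_self, lam_zero, RingHom.map_one, mul_one, lam, coeffPair,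
    Finset.sum_range, w, coeffPair]
  rfl

theorem mul_w_succ (k : ℕ) : (1 - (p : A) ^ (p ^ (k + 1) - 1)) * D.w (k + 1) =
      D.v (k + 1) + ∑ m ∈ Finset.range k, D.w (m + 1) * (D.σ ^ (m + 1 : ℕ)) (D.lam (k - m)) *
        ((p : A) ^ (p ^ (k + 1) - (k - m) - 1) - (p : A) ^ (p ^ (k - m : ℕ) - (k - m) - 1)) := by
  have h1 : 1 < p ^ (k + 1) := Nat.one_lt_pow (by omega) hp.out.one_lt
  have h : IsUnit (1 - (p : A) ^ (p ^ (k + 1) - 1)) := by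
    obtain ⟨m, hm⟩ : ∃ m, p ^ (k + 1) - 1 = m + 1 := ⟨p ^ (k + 1) - 2, by omega⟩
    rw [hm, pow_succ']
    exact D.isUnit _
  rw [w_succ, ← mul_assoc, Ring.mul_inverse_cancel _ h, one_mul]

end ArakiDatum

/-- The ring `A[1/p]`. -/
abbrev InvP (p : ℕ) (A : Type*) [CommRing A] := Localization.Away (p : A)

section InvP
variable (p : ℕ) {A A' : Type*} [CommRing A] [CommRing A']

theorem powers_le_comap (φ : A →+* A') :
    Submonoid.powers (p : A) ≤ (Submonoid.powers (p : A')).comap φ := by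
  rw [Submonoid.powers_le, Submonoid.mem_comap, map_natCast]
  exact Submonoid.mem_powers _

/-- The map `A[1/p] → A'[1/p]` induced by a ring homomorphism. -/
noncomputable def invPMap (φ : A →+* A') : InvP p A →+* InvP p A' :=
  IsLocalization.map (InvP p A') φ (powers_le_comap p φ)

theorem invPMap_algebraMap (φ : A →+* A') (a : A) :
    invPMap p φ (algebraMap A (InvP p A) a) = algebraMap A' (InvP p A') (φ a) :=
  IsLocalization.map_eq (powers_le_comap p φ) a

theorem invPMap_comp_algebraMap (φ : A →+* A') :
    (invPMap p φ).comp (algebraMap A (InvP p A)) = (algebraMap A' (InvP p A')).comp φ :=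
  RingHom.ext fun a => invPMap_algebraMap p φ a

variable (A) in
/-- The inverse of `p` in `A[1/p]`. -/
noncomputable def invP : InvP p A := IsLocalization.Away.invSelf (p : A)

theorem natCast_mul_invP : (p : InvP p A) * invP p A = 1 := by
  rw [← map_natCast (algebraMap A (InvP p A))]
  exact IsLocalization.Away.mul_invSelf (p : A)

theorem invPMap_invP (φ : A →+* A') : invPMap p φ (invP p A) = invP p A' := by
  have h := congrArg (invPMap p φ) (natCast_mul_invP p (A := A))
  rw [map_mul, map_one, map_natCast] at h
  calc invPMap p φ (invP p A) = (p * invP p A') * invPMap p φ (invP p A) := by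
        rw [natCast_mul_invP, one_mul]
    _ = (p * invPMap p φ (invP p A)) * invP p A' := by ring
    _ = _ := by rw [h, one_mul]

theorem invPMap_pow_algebraMap (φ : A →+* A) (k : ℕ) (a : A) :
    (invPMap p φ ^ k) (algebraMap A (InvP p A) a) = algebraMap A (InvP p A) ((φ ^ k) a) := by
  induction k with
  | zero => simp
  | succ k ih => simp only [pow_succ', RingHom.mul_def, RingHom.comp_apply, ih, invPMap_algebraMap]

theorem invPMap_pow_invP (φ : A →+* A) (k : ℕ) : (invPMap p φ ^ k) (invP p A) = invP p A := by
  induction k with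
  | zero => simp
  | succ k ih => rw [pow_succ', RingHom.mul_def, RingHom.comp_apply, ih, invPMap_invP]

theorem algebraMap_invP_injective (h : (p : A) ∈ nonZeroDivisors A) :
    Function.Injective (algebraMap A (InvP p A)) :=
  IsLocalization.injective _ (Submonoid.powers_le.2 h)

end InvP

/-- A power series over `A[1/p]` with coefficients in `A`. -/
def HasIntegralCoeffs {p : ℕ} {A : Type*} [CommRing A] {τ : Type*} (f : MvPowerSeries τ (InvP p A)) :
    Prop := ∀ d, MvPowerSeries.coeff d f ∈ (algebraMap A (InvP p A)).range

namespace ArakiDatum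
variable {p : ℕ} [hp : Fact p.Prime] {A : Type*} [CommRing A] (D : ArakiDatum p A) {τ : Type*}

/-- The inclusion of power series over `A` into power series over `A[1/p]`. -/
noncomputable def incl (p : ℕ) (τ A : Type*) [CommRing A] :
    MvPowerSeries τ A →+* MvPowerSeries τ (InvP p A) :=
  MvPowerSeries.map (algebraMap A (InvP p A))

theorem coeff_incl (f : MvPowerSeries τ A) (d : τ →₀ ℕ) :
    MvPowerSeries.coeff d (incl p τ A f) = algebraMap A (InvP p A) (MvPowerSeries.coeff d f) :=
  MvPowerSeries.coeff_map _ _ _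

theorem constantCoeff_incl {f : MvPowerSeries τ A} (hf : MvPowerSeries.constantCoeff f = 0) :
    MvPowerSeries.constantCoeff (incl p τ A f) = 0 := by
  rw [incl, MvPowerSeries.constantCoeff_map, hf, map_zero]

include D in
theorem incl_injective : Function.Injective (incl p τ A) := by
  intro f g h
  ext d
  apply algebraMap_invP_injective p D.regular
  rw [← coeff_incl, h, coeff_incl]

/-- The extension of the Frobenius lift to `A[1/p]`. -/
noncomputable abbrev σB : InvP p A →+* InvP p A := invPMap p D.σ

/-- The coefficients of the functional equation of the logarithm. -/
noncomputable def s (k : ℕ) : InvP p A := invP p A * algebraMap A (InvP p A) (D.w k)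

/-- The coefficients of the logarithm. -/
noncomputable def ell (k : ℕ) : InvP p A := invP p A ^ k * algebraMap A (InvP p A) (D.lam k)

theorem ell_zero : D.ell 0 = 1 := by simp [ell, lam_zero]

theorem σB_pow_ell (m k : ℕ) : (D.σB ^ m) (D.ell k) =
    invP p A ^ k * algebraMap A (InvP p A) ((D.σ ^ m) (D.lam k)) := by
  rw [ell, map_mul, map_pow, invPMap_pow_invP, invPMap_pow_algebraMap]

theorem ell_succ (k : ℕ) : D.ell (k + 1) = ∑ m ∈ Finset.range (k + 1),
    D.s (m + 1) * (D.σB ^ (m + 1)) (D.ell (k - m)) := by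
  rw [ell, lam_succ, map_sum, Finset.mul_sum]
  refine Finset.sum_congr rfl fun m hm => ?_
  rw [Finset.mem_range] at hm
  rw [σB_pow_ell, s, map_mul, map_mul, map_pow, map_natCast]
  obtain ⟨j, rfl⟩ : ∃ j, k = m + j := ⟨k - m, by omega⟩
  rw [Nat.add_sub_cancel_left]
  have h : (p : InvP p A) ^ m * invP p A ^ m = 1 := by
    rw [← mul_pow, natCast_mul_invP, one_pow]
  linear_combination (invP p A ^ (j + 1) * algebraMap A (InvP p A) (D.w (m + 1)) *
    algebraMap A (InvP p A) ((D.σ ^ (m + 1)) (D.lam j))) * h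

/-- This is the difference between the Araki relation for `p ℓ_{k+1}` and the functional equation of
the logarithm. It is the recursion for `w` with its denominators restored, and it serves to prove
the former relation from the latter. -/
theorem v_succ (k : ℕ) : algebraMap A (InvP p A) (D.v (k + 1)) +
    ∑ m ∈ Finset.range (k + 1), D.s (m + 1) * (D.σB ^ (m + 1)) (D.ell (k - m)) *
      ((p : InvP p A) ^ p ^ (k + 1) - (p : InvP p A) ^ p ^ (k - m)) = 0 := by
  have key : ∀ j, invP p A ^ (j + 1) * (p : InvP p A) ^ (j + 1) = 1 := fun j => by
    rw [← mul_pow, mul_comm, natCast_mul_invP, one_pow]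
  have h := congrArg (algebraMap A (InvP p A)) (D.mul_w_succ k)
  simp only [map_mul, map_sub, map_one, map_pow, map_add, map_sum, map_natCast] at h
  rw [Finset.sum_range_succ, Nat.sub_self, ell_zero, map_one, mul_one, pow_zero, pow_one]
  have e : ∀ m ∈ Finset.range k, D.s (m + 1) * (D.σB ^ (m + 1)) (D.ell (k - m)) *
      ((p : InvP p A) ^ p ^ (k + 1) - (p : InvP p A) ^ p ^ (k - m)) =
      algebraMap A (InvP p A) (D.w (m + 1)) *
        algebraMap A (InvP p A) ((D.σ ^ (m + 1)) (D.lam (k - m))) *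
        ((p : InvP p A) ^ (p ^ (k + 1) - (k - m) - 1) -
          (p : InvP p A) ^ (p ^ (k - m) - (k - m) - 1)) := by
    intro m hm
    rw [σB_pow_ell, s]
    generalize (D.σ ^ (m + 1)) (D.lam (k - m)) = y
    generalize hj : k - m = j
    have h1 : j < p ^ j := Nat.lt_pow_self hp.out.one_lt
    have h2 : p ^ j ≤ p ^ (k + 1) := Nat.pow_le_pow_right hp.out.pos (by omega)
    obtain ⟨a, ha⟩ : ∃ a, p ^ j = j + 1 + a := ⟨p ^ j - (j + 1), by omega⟩
    obtain ⟨b, hb⟩ : ∃ b, p ^ (k + 1) = j + 1 + b := ⟨p ^ (k + 1) - (j + 1), by omega⟩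
    rw [ha, hb, show j + 1 + b - j - 1 = b by omega, show j + 1 + a - j - 1 = a by omega,
      pow_add, pow_add]
    linear_combination (algebraMap A (InvP p A) (D.w (m + 1)) *
        algebraMap A (InvP p A) y * (p ^ b - p ^ a)) * key j
  rw [Finset.sum_congr rfl e]
  have h1 : 1 < p ^ (k + 1) := Nat.one_lt_pow (by omega) hp.out.one_lt
  obtain ⟨b, hb⟩ : ∃ b, p ^ (k + 1) = 1 + b := ⟨p ^ (k + 1) - 1, by omega⟩
  have h2 := key 0
  rw [zero_add, pow_one, pow_one] at h2
  rw [hb, Nat.add_sub_cancel_left] at h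
  rw [hb, s, pow_add, pow_one]
  linear_combination -h + algebraMap A (InvP p A) (D.w (k + 1)) * (p ^ b - 1) * h2

/-- The relation between the coefficients of the logarithm that expresses the `p`-series. -/
theorem natCast_mul_ell (k : ℕ) : p * D.ell k = ∑ i ∈ Finset.range (k + 1),
    D.ell (k - i) * algebraMap A (InvP p A) (D.v i) ^ p ^ (k - i) := by
  induction k using Nat.strong_induction_on with
  | _ k ih =>
  rcases k with _ | k
  · simp [D.v_zero, ell_zero]
  have e1 : p * D.ell (k + 1) = ∑ m ∈ Finset.range (k + 1), ∑ i ∈ Finset.range (k - m + 1),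
      D.s (m + 1) * ((D.σB ^ (m + 1)) (D.ell (k - m - i)) *
        algebraMap A (InvP p A) ((D.σ ^ (m + 1)) (D.v i)) ^ p ^ (k - m - i)) := by
    rw [ell_succ, Finset.mul_sum]
    refine Finset.sum_congr rfl fun m hm => ?_
    have := congrArg (D.σB ^ (m + 1)) (ih (k - m) (by omega))
    rw [map_mul, map_natCast, map_sum] at this
    rw [mul_left_comm, this, Finset.mul_sum]
    refine Finset.sum_congr rfl fun i _ => ?_
    rw [map_mul, map_pow, invPMap_pow_algebraMap]
  have σv : ∀ m i, (D.σ ^ m) (D.v (i + 1)) = D.v (i + 1) ^ p ^ m := by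
    intro m i
    induction m with
    | zero => simp
    | succ m ih => rw [pow_succ', RingHom.mul_def, RingHom.comp_apply, ih, map_pow, D.σ_v,
        ← pow_mul, pow_succ']
  -- The term `i = 0` is separated because `σ` fixes `v_0 = p` and raises every other parameter to
  -- the `p`-th power. It is the source of the correction treated in `v_succ`.
  have e2 : ∀ m ∈ Finset.range (k + 1), ∑ i ∈ Finset.range (k - m + 1),
      D.s (m + 1) * ((D.σB ^ (m + 1)) (D.ell (k - m - i)) *
        algebraMap A (InvP p A) ((D.σ ^ (m + 1)) (D.v i)) ^ p ^ (k - m - i)) =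
      (∑ i ∈ Finset.range (k - m), D.s (m + 1) * (D.σB ^ (m + 1)) (D.ell (k - m - 1 - i)) *
        algebraMap A (InvP p A) (D.v (i + 1)) ^ p ^ (k - i)) +
      D.s (m + 1) * (D.σB ^ (m + 1)) (D.ell (k - m)) * (p : InvP p A) ^ p ^ (k - m) := by
    intro m hm
    rw [Finset.mem_range] at hm
    rw [Finset.sum_range_succ', Nat.sub_zero, D.v_zero, map_natCast, map_natCast, mul_assoc]
    congr 1
    refine Finset.sum_congr rfl fun i hi => ?_
    rw [Finset.mem_range] at hi
    rw [σv, map_pow, ← pow_mul, ← pow_add, mul_assoc,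
      show k - m - (i + 1) = k - m - 1 - i by omega, show m + 1 + (k - m - 1 - i) = k - i by omega]
  -- After the sums are interchanged, the inner sum over `m` is the functional equation for
  -- `ℓ_{k-i}`.
  have e3 : ∑ m ∈ Finset.range (k + 1), ∑ i ∈ Finset.range (k - m),
      D.s (m + 1) * (D.σB ^ (m + 1)) (D.ell (k - m - 1 - i)) *
        algebraMap A (InvP p A) (D.v (i + 1)) ^ p ^ (k - i) =
      ∑ i ∈ Finset.range k, D.ell (k - i) * algebraMap A (InvP p A) (D.v (i + 1)) ^ p ^ (k - i) := by
    rw [Finset.sum_range_succ, Nat.sub_self, Finset.range_zero, Finset.sum_empty, add_zero]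
    rw [Finset.sum_comm' (t' := Finset.range k) (s' := fun i => Finset.range (k - i))
      (by intro x y; simp only [Finset.mem_range]; omega)]
    refine Finset.sum_congr rfl fun i hi => ?_
    rw [Finset.mem_range] at hi
    obtain ⟨j, hj⟩ : ∃ j, k - i = j + 1 := ⟨k - i - 1, by omega⟩
    rw [← Finset.sum_mul, hj, ell_succ]
    congr 1
    refine Finset.sum_congr rfl fun m hm => ?_
    rw [show k - m - 1 - i = j - m by omega]
  rw [e1, Finset.sum_congr rfl e2, Finset.sum_add_distrib, e3]
  have hv := D.v_succ k
  simp only [mul_sub, Finset.sum_sub_distrib] at hv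
  rw [← Finset.sum_mul, ← ell_succ] at hv
  have e4 : ∑ i ∈ Finset.range (k + 1 + 1), D.ell (k + 1 - i) *
      algebraMap A (InvP p A) (D.v i) ^ p ^ (k + 1 - i) =
      ∑ i ∈ Finset.range k, D.ell (k - i) * algebraMap A (InvP p A) (D.v (i + 1)) ^ p ^ (k - i) +
        algebraMap A (InvP p A) (D.v (k + 1)) + D.ell (k + 1) * (p : InvP p A) ^ p ^ (k + 1) := by
    rw [Finset.sum_range_succ', Nat.sub_zero, D.v_zero, map_natCast, Finset.sum_range_succ]
    simp only [Nat.reduceSubDiff, Nat.sub_self, pow_zero, pow_one, ell_zero, one_mul]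
  rw [e4]
  linear_combination -hv

end ArakiDatum

/-! ### The functional equation lemma -/

namespace ArakiDatum
variable {p : ℕ} [hp : Fact p.Prime] {A : Type*} [CommRing A] (D : ArakiDatum p A) {τ : Type*}

/-- The truncated logarithm `∑_{j < N} σ^i(ℓ_j) α^{p^j}`. -/
noncomputable def truncLog (i N : ℕ) (α : MvPowerSeries τ (InvP p A)) :
    MvPowerSeries τ (InvP p A) :=
  truncEval p N (fun j => (D.σB ^ i) (D.ell j)) α

theorem truncLog_def (i N : ℕ) (α : MvPowerSeries τ (InvP p A)) :
    D.truncLog i N α = ∑ j ∈ Finset.range N, (D.σB ^ i) (D.ell j) • α ^ p ^ j := rfl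

/-- The functional equation operator `β ↦ β - ∑_{0 < i ≤ N} s_i T^i β`, where
`T f = f^σ(x^p)`. -/
noncomputable def feOp (N : ℕ) (β : MvPowerSeries τ (InvP p A)) : MvPowerSeries τ (InvP p A) :=
  β - ∑ i ∈ Finset.range N, D.s (i + 1) • (twist p τ D.σB ^ (i + 1)) β

/-- The difference between the functional equation operator applied to the logarithm of `α`
and `α`, up to terms of high degree. -/
noncomputable def feErr (N : ℕ) (α : MvPowerSeries τ (InvP p A)) : MvPowerSeries τ (InvP p A) :=
  ∑ i ∈ Finset.range N, D.s (i + 1) • (D.truncLog (i + 1) (N - i) (α ^ p ^ (i + 1)) -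
    D.truncLog (i + 1) (N - i) ((twist p τ D.σB ^ (i + 1)) α))

/-- The truncated functional equation `ℓ(α) = α + ∑ s_i (σ^i ℓ)(α^{p^i})`, obtained by regrouping
the recursion `ell_succ` according to the index of `s`. -/
theorem truncLog_succ (N : ℕ) (α : MvPowerSeries τ (InvP p A)) :
    D.truncLog 0 (N + 1) α = α + ∑ i ∈ Finset.range N,
      D.s (i + 1) • D.truncLog (i + 1) (N - i) (α ^ p ^ (i + 1)) := by
  have h := Finset.sum_range_diag_flip N fun i j =>
    (D.s (i + 1) * (D.σB ^ (i + 1)) (D.ell j)) • α ^ p ^ (i + j + 1)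
  have e : D.truncLog 0 (N + 1) α = α + ∑ m ∈ Finset.range N, ∑ k ∈ Finset.range (m + 1),
      (D.s (k + 1) * (D.σB ^ (k + 1)) (D.ell (m - k))) • α ^ p ^ (k + (m - k) + 1) := by
    rw [truncLog_def, Finset.sum_range_succ', add_comm]
    congr 1
    · simp [ell_zero]
    · refine Finset.sum_congr rfl fun m _ => ?_
      rw [pow_zero, RingHom.one_def, RingHom.id_apply, ell_succ, Finset.sum_smul]
      refine Finset.sum_congr rfl fun k hk => ?_
      rw [Finset.mem_range] at hk
      rw [show k + (m - k) = m by omega]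
  rw [e, h]
  congr 1
  refine Finset.sum_congr rfl fun i _ => ?_
  rw [truncLog_def, Finset.smul_sum]
  refine Finset.sum_congr rfl fun j _ => ?_
  rw [mul_smul, ← pow_mul, ← pow_add, show i + 1 + j = i + j + 1 by omega]

theorem twist_pow_truncLog (i N : ℕ) (α : MvPowerSeries τ (InvP p A)) :
    (twist p τ D.σB ^ i) (D.truncLog 0 N α) = D.truncLog i N ((twist p τ D.σB ^ i) α) := by
  rw [truncLog_def, truncLog_def, map_sum]
  refine Finset.sum_congr rfl fun j _ => ?_
  rw [twist_pow_smul, map_pow, pow_zero, RingHom.one_def, RingHom.id_apply]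

/-- The logarithm. -/
noncomputable def log : (InvP p A)⟦X⟧ := typicalSeries p D.ell

theorem log_isNormalized : IsNormalized D.log := typicalSeries_isNormalized D.ell_zero

theorem log_subst_sub_mem (N : ℕ) {α : MvPowerSeries τ (InvP p A)}
    (hα : MvPowerSeries.constantCoeff α = 0) :
    D.log.subst α - D.truncLog 0 N α ∈ lowIdeal τ (InvP p A) (p ^ N) := by
  have := typicalSeries_subst_sub_mem (p := p) D.ell N hα
  simpa [truncLog, log, RingHom.one_def] using this

theorem smul_mem_lowIdeal {R : Type*} [CommRing R] {M : ℕ} (c : R) {f : MvPowerSeries τ R}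
    (hf : f ∈ lowIdeal τ R M) : c • f ∈ lowIdeal τ R M := by
  rw [MvPowerSeries.smul_eq_C_mul]
  exact Ideal.mul_mem_left _ _ hf

/-- The operator `T^i` takes `ℓ(α)` to `(σ^i ℓ)(T^i α)`, whereas the functional equation contains
`(σ^i ℓ)(α^{p^i})`. The error `feErr` collects the differences. Each truncation level is chosen so
that the neglected terms have degree at least `p^{N+1}`. -/
theorem feOp_log_sub_mem (N : ℕ) {α : MvPowerSeries τ (InvP p A)}
    (hα : MvPowerSeries.constantCoeff α = 0) :
    D.feOp N (D.log.subst α) - (α + D.feErr N α) ∈ lowIdeal τ (InvP p A) (p ^ (N + 1)) := by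
  have e : D.feOp N (D.log.subst α) - (α + D.feErr N α) =
      (D.log.subst α - D.truncLog 0 (N + 1) α) - ∑ i ∈ Finset.range N, D.s (i + 1) •
        (twist p τ D.σB ^ (i + 1)) (D.log.subst α - D.truncLog 0 (N - i) α) := by
    rw [feOp, feErr, truncLog_succ]
    simp only [map_sub, twist_pow_truncLog, smul_sub, Finset.sum_sub_distrib]
    abel
  rw [e]
  refine Ideal.sub_mem _ (D.log_subst_sub_mem _ hα) (Ideal.sum_mem _ fun i hi => ?_)
  rw [Finset.mem_range] at hi
  have := twist_pow_mem_lowIdeal p D.σB (i + 1) (D.log_subst_sub_mem (N - i) hα)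
  rw [← pow_add, show i + 1 + (N - i) = N + 1 by omega] at this
  exact smul_mem_lowIdeal _ this

/-- The error involves `α` only through powers with exponent at least `2` and through `T^i α` with
`i > 0`. Its terms of degree `M` are thus determined by the coefficients of `α` of degree less than
`M`. -/
theorem feErr_sub_mem (N : ℕ) {M : ℕ} (hM : 1 ≤ M) {α β : MvPowerSeries τ (InvP p A)}
    (hα : MvPowerSeries.constantCoeff α = 0) (hβ : MvPowerSeries.constantCoeff β = 0)
    (h : α - β ∈ lowIdeal τ (InvP p A) M) :
    D.feErr N α - D.feErr N β ∈ lowIdeal τ (InvP p A) (M + 1) := by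
  rw [feErr, feErr, ← Finset.sum_sub_distrib]
  refine Ideal.sum_mem _ fun i _ => ?_
  rw [← smul_sub]
  refine smul_mem_lowIdeal _ ?_
  rw [sub_sub_sub_comm]
  have h2 : 2 ≤ p ^ (i + 1) :=
    hp.out.two_le.trans (Nat.le_self_pow (by omega) p)
  refine Ideal.sub_mem _ ?_ ?_
  · rw [truncLog_def, truncLog_def, ← Finset.sum_sub_distrib]
    refine Ideal.sum_mem _ fun j _ => ?_
    rw [← smul_sub, ← pow_mul, ← pow_mul]
    refine smul_mem_lowIdeal _ (pow_sub_pow_mem_lowIdeal ?_ hα hβ h)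
    exact h2.trans (Nat.le_mul_of_pos_right _ (pow_pos hp.out.pos j))
  · rw [truncLog_def, truncLog_def, ← Finset.sum_sub_distrib]
    refine Ideal.sum_mem _ fun j _ => ?_
    rw [← smul_sub]
    refine smul_mem_lowIdeal _ (Ideal.mem_of_dvd _ (sub_dvd_pow_sub_pow _ _ _) ?_)
    rw [← map_sub]
    refine lowIdeal_anti ?_ (twist_pow_mem_lowIdeal p D.σB (i + 1) h)
    nlinarith

section Integral

theorem hasIntegralCoeffs_iff {f : MvPowerSeries τ (InvP p A)} :
    HasIntegralCoeffs f ↔ f ∈ (incl p τ A).range := by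
  constructor
  · intro h
    choose g hg using h
    obtain ⟨g', hg'⟩ : ∃ g' : MvPowerSeries τ A, ∀ d, MvPowerSeries.coeff d g' = g d :=
      ⟨g, fun _ => rfl⟩
    refine ⟨g', ?_⟩
    ext d
    rw [coeff_incl, hg', hg]
  · rintro ⟨g, rfl⟩ d
    rw [coeff_incl]
    exact ⟨_, rfl⟩

theorem twist_pow_incl (k : ℕ) (f : MvPowerSeries τ A) :
    (twist p τ D.σB ^ k) (incl p τ A f) = incl p τ A ((twist p τ D.σ ^ k) f) :=
  (map_twist_pow p (algebraMap A (InvP p A)) (invPMap_comp_algebraMap p D.σ).symm k f).symm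

theorem algebraMap_smul_incl (a : A) (f : MvPowerSeries τ A) :
    algebraMap A (InvP p A) a • incl p τ A f = incl p τ A (a • f) := by
  ext d
  rw [MvPowerSeries.coeff_smul, coeff_incl, coeff_incl, MvPowerSeries.coeff_smul, map_mul]

/-- The congruence `T^i α ≡ α^{p^i}` modulo `p` implies a congruence of `p^j`-th powers modulo
`p^{j+1}`. This cancels the denominator `p^{j+1}` of `s_i σ^i(ℓ_j)`. -/
theorem feErr_incl_mem (N : ℕ) (α : MvPowerSeries τ A) :
    D.feErr N (incl p τ A α) ∈ (incl p τ A).range := by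
  rw [feErr]
  refine Subring.sum_mem _ fun i _ => ?_
  rw [truncLog_def, truncLog_def, ← Finset.sum_sub_distrib, Finset.smul_sum]
  refine Subring.sum_mem _ fun j _ => ?_
  obtain ⟨c, hc⟩ := dvd_sub_pow_of_dvd_sub ((dvd_sub_comm).1
    (dvd_twist_pow_sub_pow p D.dvd_frob (i + 1) α)) j
  rw [← smul_sub, twist_pow_incl, ← map_pow, ← map_pow, ← map_pow, ← map_sub, hc, σB_pow_ell, s]
  refine ⟨(D.w (i + 1) * (D.σ ^ (i + 1)) (D.lam j)) • c, ?_⟩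
  rw [← algebraMap_smul_incl, smul_smul, map_mul, map_mul, map_pow, map_natCast]
  have h : (p : InvP p A) ^ (j + 1) * invP p A ^ (j + 1) = 1 := by
    rw [← mul_pow, natCast_mul_invP, one_pow]
  generalize algebraMap A (InvP p A) ((D.σ ^ (i + 1)) (D.lam j)) = y
  generalize algebraMap A (InvP p A) (D.w (i + 1)) = z
  rw [MvPowerSeries.smul_eq_C_mul, MvPowerSeries.smul_eq_C_mul,
    ← map_natCast (MvPowerSeries.C (σ := τ) (R := InvP p A)), ← map_pow, ← mul_assoc, ← map_mul]
  congr 2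
  linear_combination (-(z * y)) * h

/-- A series without constant term on which the functional equation operator takes integral
values is the logarithm of an integral series. -/
theorem exists_log_subst_eq {β : MvPowerSeries τ (InvP p A)}
    (hβ : MvPowerSeries.constantCoeff β = 0)
    (h : ∀ N, ∀ d : τ →₀ ℕ, d.degree < p ^ (N + 1) →
      MvPowerSeries.coeff d (D.feOp N β) ∈ (algebraMap A (InvP p A)).range) :
    ∃ α : MvPowerSeries τ A, MvPowerSeries.constantCoeff α = 0 ∧
      D.log.subst (incl p τ A α) = β := by
  classical
  have hn := D.log_isNormalized
  set γ := hn.inverse.subst β with hγ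
  have hγ0 : MvPowerSeries.constantCoeff γ = 0 := constantCoeff_subst_zero hβ hn.inverse_zero
  have hlog : D.log.subst γ = β := hn.subst_inverse hβ
  suffices hint : HasIntegralCoeffs γ by
    obtain ⟨α, hα⟩ := hasIntegralCoeffs_iff.1 hint
    refine ⟨α, ?_, by rw [hα, hlog]⟩
    apply algebraMap_invP_injective p D.regular
    rw [map_zero, ← hγ0, ← hα]
    exact (MvPowerSeries.constantCoeff_map _ _).symm
  suffices ∀ m, ∀ d : τ →₀ ℕ, d.degree = m →
      MvPowerSeries.coeff d γ ∈ (algebraMap A (InvP p A)).range from fun d => this _ d rfl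
  intro m
  induction m using Nat.strong_induction_on with
  | _ m ih =>
  intro d hd
  rcases Nat.eq_zero_or_pos m with rfl | hm
  · rw [(Finsupp.degree_eq_zero_iff d).1 hd, MvPowerSeries.coeff_zero_eq_constantCoeff_apply, hγ0]
    exact Subring.zero_mem _
  -- By induction `γ` agrees in degrees less than `m` with an integral series `α`. The errors of `γ`
  -- and `α` then agree in degree `m`, and the error of `α` is integral.
  obtain ⟨α, hα⟩ : ∃ α : MvPowerSeries τ A, γ - incl p τ A α ∈ lowIdeal τ (InvP p A) m := by
    have hc : ∀ e : τ →₀ ℕ, ∃ a : A, e.degree < m →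
        algebraMap A (InvP p A) a = MvPowerSeries.coeff e γ := by
      intro e
      by_cases he : e.degree < m
      · obtain ⟨a, ha⟩ := ih _ he e rfl
        exact ⟨a, fun _ => ha⟩
      · exact ⟨0, fun h => absurd h he⟩
    choose a ha using hc
    obtain ⟨g, hg⟩ : ∃ g : MvPowerSeries τ A, ∀ d, MvPowerSeries.coeff d g = a d :=
      ⟨a, fun _ => rfl⟩
    refine ⟨g, fun e he => ?_⟩
    rw [map_sub, coeff_incl, hg, ha e he, sub_self]
  have hα0 : MvPowerSeries.constantCoeff (incl p τ A α) = 0 := by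
    have := hα 0 (by simpa using hm)
    rw [map_sub, MvPowerSeries.coeff_zero_eq_constantCoeff_apply,
      MvPowerSeries.coeff_zero_eq_constantCoeff_apply, hγ0, zero_sub, neg_eq_zero] at this
    exact this
  have hdN : d.degree < p ^ (m + 1) := by
    rw [hd]
    exact (Nat.lt_succ_self m).trans (Nat.lt_pow_self hp.out.one_lt)
  have h1 := D.feOp_log_sub_mem m hγ0 d hdN
  have h2 := D.feErr_sub_mem m hm hγ0 hα0 hα d (by omega)
  rw [hlog, map_sub, map_add] at h1
  rw [map_sub] at h2
  have h3 := hasIntegralCoeffs_iff.2 (D.feErr_incl_mem m α) d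
  have : MvPowerSeries.coeff d γ = MvPowerSeries.coeff d (D.feOp m β) -
      MvPowerSeries.coeff d (D.feErr m (incl p τ A α)) := by
    linear_combination -h1 - h2
  rw [this]
  exact Subring.sub_mem _ (h m d hdN) h3

/-- For a variable, `T x = x^p` holds exactly and not only modulo `p`. -/
theorem feErr_X (N : ℕ) (i : τ) : D.feErr N (MvPowerSeries.X i) = 0 := by
  simp [feErr, twist_pow_X]

theorem feOp_add (N : ℕ) (β γ : MvPowerSeries τ (InvP p A)) :
    D.feOp N (β + γ) = D.feOp N β + D.feOp N γ := by
  simp only [feOp, map_add, smul_add, Finset.sum_add_distrib]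
  abel

theorem coeff_feOp_log_X (N : ℕ) (i : τ) {d : τ →₀ ℕ} (hd : d.degree < p ^ (N + 1)) :
    MvPowerSeries.coeff d (D.feOp N (D.log.subst (MvPowerSeries.X i))) =
      MvPowerSeries.coeff d (MvPowerSeries.X i) := by
  have := D.feOp_log_sub_mem N (MvPowerSeries.constantCoeff_X i) d hd
  rwa [feErr_X, add_zero, map_sub, sub_eq_zero] at this

theorem coeff_X_mem_range (i : τ) (d : τ →₀ ℕ) :
    MvPowerSeries.coeff d (MvPowerSeries.X i : MvPowerSeries τ (InvP p A)) ∈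
      (algebraMap A (InvP p A)).range := by
  classical
  rw [MvPowerSeries.coeff_X]
  split_ifs
  · exact Subring.one_mem _
  · exact Subring.zero_mem _

end Integral

end ArakiDatum

/-! ### The formal group law of an Araki datum -/

namespace ArakiDatum
variable {p : ℕ} [hp : Fact p.Prime] {A : Type*} [CommRing A] (D : ArakiDatum p A)
variable {τ υ : Type*}

/-- The logarithm of a series over `A`, as a series over `A[1/p]`. -/
noncomputable def lg (f : MvPowerSeries τ A) : MvPowerSeries τ (InvP p A) :=
  D.log.subst (incl p τ A f)

/-- Identities between series over `A` are verified below after taking logarithms, which turn formal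
sums into ordinary sums. -/
theorem lg_inj {f g : MvPowerSeries τ A} (hf : MvPowerSeries.constantCoeff f = 0)
    (hg : MvPowerSeries.constantCoeff g = 0) (h : D.lg f = D.lg g) : f = g :=
  D.incl_injective (D.log_isNormalized.inj (constantCoeff_incl hf) (constantCoeff_incl hg) h)

theorem lg_zero : D.lg (0 : MvPowerSeries τ A) = 0 := by
  rw [lg, map_zero, D.log_isNormalized.zero_subst]

theorem incl_X (i : τ) : incl p τ A (MvPowerSeries.X i) = MvPowerSeries.X i :=
  MvPowerSeries.map_X _ i

theorem exists_lg_eq {β : MvPowerSeries τ (InvP p A)}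
    (hβ : MvPowerSeries.constantCoeff β = 0)
    (h : ∀ N, ∀ d : τ →₀ ℕ, d.degree < p ^ (N + 1) →
      MvPowerSeries.coeff d (D.feOp N β) ∈ (algebraMap A (InvP p A)).range) :
    ∃ α : MvPowerSeries τ A, MvPowerSeries.constantCoeff α = 0 ∧ D.lg α = β :=
  D.exists_log_subst_eq hβ h

theorem constantCoeff_lg {f : MvPowerSeries τ A} (hf : MvPowerSeries.constantCoeff f = 0) :
    MvPowerSeries.constantCoeff (D.lg f) = 0 :=
  constantCoeff_subst_zero (constantCoeff_incl hf) D.log_isNormalized.zero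

/-- The functional equation operator is additive and takes the logarithm of a variable to that
variable, up to high degree. Its value on `ℓ(x) + ℓ(y)` is therefore the integral series `x + y`. -/
theorem exists_group_series : ∃ F : MvPowerSeries (Fin 2) A,
    MvPowerSeries.constantCoeff F = 0 ∧
      D.lg F = D.lg (MvPowerSeries.X 0) + D.lg (MvPowerSeries.X 1) := by
  refine D.exists_lg_eq ?_ fun N d hd => ?_
  · rw [map_add, D.constantCoeff_lg (by simp), D.constantCoeff_lg (by simp), add_zero]
  · rw [feOp_add, map_add, lg, lg, incl_X, incl_X, coeff_feOp_log_X _ _ _ hd,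
      coeff_feOp_log_X _ _ _ hd]
    exact Subring.add_mem _ (coeff_X_mem_range _ _) (coeff_X_mem_range _ _)

/-- The power series `ℓ⁻¹(ℓ(x) + ℓ(y))`. -/
noncomputable def groupSeries : MvPowerSeries (Fin 2) A := D.exists_group_series.choose

theorem groupSeries_zero : MvPowerSeries.constantCoeff D.groupSeries = 0 :=
  D.exists_group_series.choose_spec.1

theorem lg_groupSeries :
    D.lg D.groupSeries = D.lg (MvPowerSeries.X 0) + D.lg (MvPowerSeries.X 1) :=
  D.exists_group_series.choose_spec.2

theorem groupSeries_isLog : IsLog (incl p _ A D.groupSeries) D.log := by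
  have := D.lg_groupSeries
  rwa [lg, lg, lg, incl_X, incl_X] at this

theorem incl_subst_pair {P : MvPowerSeries (Fin 2) A} {a b : MvPowerSeries τ A}
    (ha : MvPowerSeries.constantCoeff a = 0) (hb : MvPowerSeries.constantCoeff b = 0) :
    incl p τ A (MvPowerSeries.subst ![a, b] P) =
      MvPowerSeries.subst ![incl p τ A a, incl p τ A b] (incl p _ A P) := by
  refine (MvPowerSeries.map_subst (hasSubst_pair' ha hb) _).trans ?_
  congr 1
  funext s
  fin_cases s <;> rfl

theorem lg_subst_pair {a b : MvPowerSeries τ A}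
    (ha : MvPowerSeries.constantCoeff a = 0) (hb : MvPowerSeries.constantCoeff b = 0) :
    D.lg (MvPowerSeries.subst ![a, b] D.groupSeries) = D.lg a + D.lg b := by
  rw [lg, incl_subst_pair ha hb, D.groupSeries_isLog.subst_add
    (constantCoeff_incl D.groupSeries_zero) (constantCoeff_incl ha) (constantCoeff_incl hb)]
  rfl

theorem coeff_lg_of_degree_le_one {f : MvPowerSeries τ A}
    (hf : MvPowerSeries.constantCoeff f = 0) {d : τ →₀ ℕ} (hd : d.degree ≤ 1) :
    MvPowerSeries.coeff d (D.lg f) = algebraMap A (InvP p A) (MvPowerSeries.coeff d f) := by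
  have h := D.log_subst_sub_mem 1 (constantCoeff_incl hf) d
    (by rw [pow_one]; exact hd.trans_lt hp.out.one_lt)
  rw [map_sub, sub_eq_zero] at h
  rw [lg, h, ← coeff_incl]
  simp [truncLog_def, ell_zero]

theorem coeff_groupSeries_single (i : Fin 2) :
    MvPowerSeries.coeff (Finsupp.single i 1) D.groupSeries = 1 := by
  apply algebraMap_invP_injective p D.regular
  have h := congrArg (MvPowerSeries.coeff (Finsupp.single i 1)) D.lg_groupSeries
  have hd : (Finsupp.single i 1 : Fin 2 →₀ ℕ).degree ≤ 1 := by simp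
  rw [map_add, D.coeff_lg_of_degree_le_one D.groupSeries_zero hd,
    D.coeff_lg_of_degree_le_one (by simp) hd, D.coeff_lg_of_degree_le_one (by simp) hd] at h
  rw [h, map_one, MvPowerSeries.coeff_index_single_X, MvPowerSeries.coeff_index_single_X]
  fin_cases i <;> simp

/-- The `p`-typical formal group law over `A` with the given Araki parameters. -/
noncomputable def fgl : FormalGroup A where
  toPowerSeries := D.groupSeries
  zero_constantCoeff := D.groupSeries_zero
  lin_coeff_X := D.coeff_groupSeries_single 0
  lin_coeff_Y := D.coeff_groupSeries_single 1
  assoc := by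
    have h (i : Fin 3) : MvPowerSeries.constantCoeff (MvPowerSeries.X i : MvPowerSeries _ A) = 0 :=
      by simp
    have h0 := D.groupSeries_zero
    have h1 := constantCoeff_subst_pair h0 (h 0) (h 1)
    have h2 := constantCoeff_subst_pair h0 (h 1) (h 2)
    refine D.lg_inj (constantCoeff_subst_pair h0 h1 (h 2)) (constantCoeff_subst_pair h0 (h 0) h2) ?_
    rw [D.lg_subst_pair h1 (h 2), D.lg_subst_pair (h 0) h2, D.lg_subst_pair (h 0) (h 1),
      D.lg_subst_pair (h 1) (h 2), add_assoc]

theorem fgl_toPowerSeries : D.fgl.toPowerSeries = D.groupSeries := rfl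

instance : D.fgl.IsComm where
  comm := by
    change D.groupSeries = MvPowerSeries.subst _ D.groupSeries
    have h (i : Fin 2) : MvPowerSeries.constantCoeff (MvPowerSeries.X i : MvPowerSeries _ A) = 0 :=
      by simp
    refine D.lg_inj D.groupSeries_zero (constantCoeff_subst_pair D.groupSeries_zero (h 1) (h 0)) ?_
    rw [D.lg_subst_pair (h 1) (h 0), lg_groupSeries, add_comm]

theorem lg_subst {f : A⟦X⟧} (hf : PowerSeries.constantCoeff f = 0) {g : MvPowerSeries τ A}
    (hg : MvPowerSeries.constantCoeff g = 0) :
    D.lg (f.subst g) = PowerSeries.subst (incl p τ A g) (D.lg f : (InvP p A)⟦X⟧) := by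
  have hf' := constantCoeff_incl (p := p) (τ := Unit) hf
  have hg' := constantCoeff_incl (p := p) hg
  rw [lg, lg, PowerSeries.subst_comp_subst_apply (hasSubst_of_zero hf') (hasSubst_of_zero hg')]
  congr 1
  exact PowerSeries.map_subst (hasSubst_of_zero hg) f

/-- The condition on `a` says that multiplication by `a` commutes with the functional equation
operator. The operator thus takes `a ℓ(x)` to `a x`, which is integral, and `ℓ⁻¹(a ℓ(x))` has
coefficients in `A`. -/
theorem exists_mulSeries (a : A) (ha : ∀ i, D.s i * algebraMap A (InvP p A) ((D.σ ^ i) a) =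
      D.s i * algebraMap A (InvP p A) a) :
    ∃ f : A⟦X⟧, PowerSeries.constantCoeff f = 0 ∧
      D.lg f = algebraMap A (InvP p A) a • D.lg (PowerSeries.X : A⟦X⟧) := by
  refine D.exists_lg_eq ?_ fun N d hd => ?_
  · have : MvPowerSeries.constantCoeff (D.lg (PowerSeries.X : A⟦X⟧)) = 0 :=
      D.constantCoeff_lg (MvPowerSeries.constantCoeff_X ())
    rw [MvPowerSeries.constantCoeff_smul, this, smul_zero]
  · have : D.feOp N (algebraMap A (InvP p A) a • D.lg (PowerSeries.X : A⟦X⟧)) =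
        algebraMap A (InvP p A) a • D.feOp N (D.lg (PowerSeries.X : A⟦X⟧)) := by
      rw [feOp, feOp, smul_sub, Finset.smul_sum]
      congr 1
      refine Finset.sum_congr rfl fun i _ => ?_
      rw [twist_pow_smul, smul_smul, smul_smul, invPMap_pow_algebraMap, ha, mul_comm]
    rw [this, MvPowerSeries.coeff_smul, PowerSeries.X, lg, incl_X, coeff_feOp_log_X _ _ _ hd]
    exact Subring.mul_mem _ ⟨a, rfl⟩ (coeff_X_mem_range _ _)

/-- The coefficients of the logarithm are determined by the relation expressing the `p`-series. -/
theorem eq_ell_of_relation {K : Type*} [CommRing K] [IsDomain K] [CharZero K]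
    (φ : InvP p A →+* K) {c : ℕ → K} (h0 : c 0 = 1)
    (h : ∀ k, p * c k = ∑ i ∈ Finset.range (k + 1),
      c (k - i) * φ (algebraMap A (InvP p A) (D.v i)) ^ p ^ (k - i)) (k : ℕ) :
    c k = φ (D.ell k) := by
  induction k using Nat.strong_induction_on with
  | _ k ih =>
  rcases k with _ | k
  · rw [h0, ell_zero, map_one]
  have e1 := h (k + 1)
  have e2 := congrArg φ (D.natCast_mul_ell (k + 1))
  rw [map_mul, map_natCast, map_sum] at e2
  rw [Finset.sum_range_succ'] at e1 e2
  have e3 : ∀ i ∈ Finset.range (k + 1), c (k + 1 - (i + 1)) *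
      φ (algebraMap A (InvP p A) (D.v (i + 1))) ^ p ^ (k + 1 - (i + 1)) =
      φ (D.ell (k + 1 - (i + 1)) *
        algebraMap A (InvP p A) (D.v (i + 1)) ^ p ^ (k + 1 - (i + 1))) := by
    intro i hi
    rw [ih _ (by omega), map_mul, map_pow]
  rw [Finset.sum_congr rfl e3] at e1
  simp only [Nat.sub_zero, D.v_zero, map_natCast, map_mul, map_pow] at e1 e2
  -- The unknown of index `k + 1` occurs twice: with factor `p` on the left, and through `v_0 = p`
  -- with factor `p^{p^{k+1}}` on the right. In characteristic zero the difference of these factors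
  -- is not zero.
  have e4 : ((p : K) - (p : K) ^ p ^ (k + 1)) * (c (k + 1) - φ (D.ell (k + 1))) = 0 := by
    linear_combination e1 - e2
  rcases mul_eq_zero.1 e4 with e | e
  · have : (p : K) ^ 1 = (p : K) ^ p ^ (k + 1) := by rw [pow_one]; exact sub_eq_zero.1 e
    have h1 := Nat.pow_right_injective hp.out.two_le
      (show p ^ 1 = p ^ p ^ (k + 1) by exact_mod_cast this)
    have h2 : 1 < p ^ (k + 1) := Nat.one_lt_pow (by omega) hp.out.one_lt
    omega
  · exact sub_eq_zero.1 e

section Functoriality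
variable {A' : Type*} [CommRing A'] {D' : ArakiDatum p A'} {D}

/-- The recursion uses only ring operations, inverses of units, the lift of Frobenius and the
parameters, so it is natural in the datum. -/
theorem map_coeffPair {θ : A →+* A'} (hσ : θ.comp D.σ = D'.σ.comp θ)
    (hv : ∀ k, θ (D.v k) = D'.v k) (k : ℕ) :
    θ (D.w k) = D'.w k ∧ θ (D.lam k) = D'.lam k := by
  have hσk : ∀ m a, θ ((D.σ ^ m) a) = (D'.σ ^ m) (θ a) := by
    intro m
    induction m with
    | zero => simp
    | succ m ih =>
      intro a
      rw [pow_succ', RingHom.mul_def, RingHom.comp_apply, pow_succ', RingHom.mul_def,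
        RingHom.comp_apply, ← ih]
      exact congrArg (fun g => g ((D.σ ^ m) a)) hσ
  induction k using Nat.strong_induction_on with
  | _ k ih =>
  rcases k with _ | k
  · rw [lam_zero, lam_zero, map_one]
    refine ⟨?_, rfl⟩
    rw [w, w, coeffPair, coeffPair]
    exact map_zero θ
  have hw : θ (D.w (k + 1)) = D'.w (k + 1) := by
    obtain ⟨m, hm⟩ : ∃ m, p ^ (k + 1) - 1 = m + 1 :=
      ⟨p ^ (k + 1) - 2, by have : 1 < p ^ (k + 1) := Nat.one_lt_pow (Nat.succ_ne_zero k) hp.out.one_lt; omega⟩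
    have hu : IsUnit (1 - (p : A') ^ (p ^ (k + 1) - 1)) := by
      rw [hm, pow_succ']; exact D'.isUnit _
    rw [← hu.mul_right_inj, D'.mul_w_succ]
    have h := congrArg θ (D.mul_w_succ k)
    simp only [map_mul, map_sub, map_one, map_pow, map_natCast, map_add, map_sum, hσk, hv] at h
    rw [h]
    congr 1
    refine Finset.sum_congr rfl fun i hi => ?_
    rw [Finset.mem_range] at hi
    rw [(ih (i + 1) (by omega)).1, (ih (k - i) (by omega)).2]
  refine ⟨hw, ?_⟩
  rw [lam_succ, lam_succ, map_sum]
  refine Finset.sum_congr rfl fun i hi => ?_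
  rw [Finset.mem_range] at hi
  rw [map_mul, map_mul, map_pow, map_natCast, hσk, (ih (k - i) (by omega)).2]
  rcases (Nat.lt_succ_iff.1 hi).lt_or_eq with h | rfl
  · rw [(ih (i + 1) (by omega)).1]
  · rw [hw]

variable {θ : A →+* A'} (hσ : θ.comp D.σ = D'.σ.comp θ) (hv : ∀ k, θ (D.v k) = D'.v k)
include hσ hv

theorem map_ell (k : ℕ) : invPMap p θ (D.ell k) = D'.ell k := by
  rw [ell, map_mul, map_pow, invPMap_invP, invPMap_algebraMap, (map_coeffPair hσ hv k).2, ell]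

theorem map_log : PowerSeries.map (invPMap p θ) D.log = D'.log := by
  rw [log, map_typicalSeries, log]
  simp only [map_ell hσ hv]

theorem map_lg {f : MvPowerSeries τ A} (hf : MvPowerSeries.constantCoeff f = 0) :
    MvPowerSeries.map (invPMap p θ) (D.lg f) = D'.lg (MvPowerSeries.map θ f) := by
  rw [lg, PowerSeries.map_subst (hasSubst_of_zero (constantCoeff_incl hf)), map_log hσ hv, lg]
  congr 1
  ext d
  simp only [MvPowerSeries.coeff_map, coeff_incl, invPMap_algebraMap]

theorem map_fgl : D.fgl.map θ = D'.fgl := by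
  refine FormalGroup.ext ?_
  rw [FormalGroup.map_toPowerSeries, fgl_toPowerSeries]
  refine D'.lg_inj (by rw [MvPowerSeries.constantCoeff_map, groupSeries_zero, map_zero])
    D'.groupSeries_zero ?_
  rw [← map_lg hσ hv D.groupSeries_zero, lg_groupSeries, fgl_toPowerSeries, lg_groupSeries, map_add,
    map_lg hσ hv (by simp), map_lg hσ hv (by simp), MvPowerSeries.map_X, MvPowerSeries.map_X]

end Functoriality

end ArakiDatum

/-! ### The `p`-series in terms of the logarithm -/

section
variable {p : ℕ} [hp : Fact p.Prime] {R : Type*} [CommRing R]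

theorem constantCoeff_C_mul_X_pow (a : R) (i : ℕ) :
    PowerSeries.constantCoeff (PowerSeries.C a * PowerSeries.X ^ p ^ i : R⟦X⟧) = 0 := by
  rw [map_mul, map_pow, PowerSeries.constantCoeff_X,
    zero_pow (pow_ne_zero i hp.out.ne_zero), mul_zero]

theorem typicalSeries_subst_monomial (c : ℕ → R) (a : R) (i : ℕ) :
    (typicalSeries p c).subst (PowerSeries.C a * PowerSeries.X ^ p ^ i : R⟦X⟧) =
      typicalSeries p fun k => if i ≤ k then c (k - i) * a ^ p ^ (k - i) else 0 := by
  have hinj := Nat.pow_right_injective hp.out.two_le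
  have h0 : MvPowerSeries.constantCoeff (PowerSeries.C a * PowerSeries.X ^ p ^ i : R⟦X⟧) = 0 :=
    constantCoeff_C_mul_X_pow a i
  ext m
  -- Truncation after `m + 1` terms does not affect the coefficient of `x^m`, because `m < p^{m+1}`.
  have h := typicalSeries_subst_sub_mem (p := p) c (m + 1) h0 (Finsupp.single () m)
    (by rw [Finsupp.degree_single]
        exact (Nat.lt_succ_self m).trans (Nat.lt_pow_self hp.out.one_lt))
  rw [map_sub, sub_eq_zero, truncEval, map_sum] at h
  refine h.trans ?_
  have e : ∀ j, MvPowerSeries.coeff (Finsupp.single () m)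
      (c j • (PowerSeries.C a * PowerSeries.X ^ p ^ i : R⟦X⟧) ^ p ^ j) =
      if m = p ^ (i + j) then c j * a ^ p ^ j else 0 := by
    intro j
    change PowerSeries.coeff m (c j • (PowerSeries.C a * PowerSeries.X ^ p ^ i : R⟦X⟧) ^ p ^ j) = _
    rw [PowerSeries.coeff_smul, mul_pow, ← map_pow, ← pow_mul, ← pow_add,
      PowerSeries.coeff_C_mul, PowerSeries.coeff_X_pow]
    split_ifs <;> simp
  rw [Finset.sum_congr rfl fun j _ => e j]
  by_cases hm : ∃ k, m = p ^ k
  · obtain ⟨k, rfl⟩ := hm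
    rw [coeff_typicalSeries_pow]
    split_ifs with hik
    · rw [Finset.sum_eq_single (k - i)]
      · rw [if_pos (by congr 1; omega)]
      · intro j _ hj
        rw [if_neg]
        intro h'
        have := hinj h'
        omega
      · intro h'
        have : k < p ^ k := Nat.lt_pow_self hp.out.one_lt
        simp only [Finset.mem_range] at h'
        omega
    · refine Finset.sum_eq_zero fun j _ => if_neg fun h' => ?_
      have := hinj h'
      omega
  · rw [not_imp_comm.1 (eq_pow_of_coeff_typicalSeries_ne_zero (p := p)) hm]
    exact Finset.sum_eq_zero fun j _ => if_neg fun h' => hm ⟨_, h'⟩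

theorem typicalSeries_sum (c : ℕ → ℕ → R) (N : ℕ) :
    ∑ i ∈ Finset.range N, typicalSeries p (c i) =
      typicalSeries p fun k => ∑ i ∈ Finset.range N, c i k := by
  ext m
  rw [map_sum]
  simp only [typicalSeries, PowerSeries.coeff_mk]
  split_ifs <;> simp

theorem natCast_mul_typicalSeries (c : ℕ → R) :
    (p : R⟦X⟧) * typicalSeries p c = typicalSeries p fun k => p * c k := by
  ext m
  rw [← nsmul_eq_mul, map_nsmul, nsmul_eq_mul]
  simp only [typicalSeries, PowerSeries.coeff_mk]
  split_ifs <;> simp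

theorem typicalSeries_injective : Function.Injective (typicalSeries (R := R) p) := by
  intro c d h
  ext k
  rw [← coeff_typicalSeries_pow (p := p) c, h, coeff_typicalSeries_pow]

/-- The `p`-series of a `p`-typical formal group law, in terms of its logarithm. -/
theorem sum_subst_monomial {c a : ℕ → R} {N : ℕ} (ha : ∀ i, N ≤ i → a i = 0) :
    ∑ i ∈ Finset.range N,
      ((typicalSeries p c).subst (PowerSeries.C (a i) * PowerSeries.X ^ p ^ i : R⟦X⟧) : R⟦X⟧) =
      typicalSeries p fun k => ∑ i ∈ Finset.range (k + 1), c (k - i) * a i ^ p ^ (k - i) := by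
  simp only [typicalSeries_subst_monomial]
  rw [typicalSeries_sum]
  congr 1
  ext k
  -- The range is enlarged by terms that vanish with `a_i`, so that it contains all `i ≤ k`.
  have e : ∀ M, N ≤ M → ∑ i ∈ Finset.range N, (if i ≤ k then c (k - i) * a i ^ p ^ (k - i) else 0) =
      ∑ i ∈ Finset.range M, if i ≤ k then c (k - i) * a i ^ p ^ (k - i) else 0 := by
    intro M hM
    refine Finset.sum_subset (Finset.range_mono hM) fun i _ hi => ?_
    rw [Finset.mem_range, not_lt] at hi
    rw [ha i hi, zero_pow (pow_ne_zero _ hp.out.ne_zero), mul_zero, ite_self]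
  rw [e (N + (k + 1)) (by omega), ← Finset.sum_filter]
  refine Finset.sum_congr ?_ fun _ _ => rfl
  ext i
  simp only [Finset.mem_filter, Finset.mem_range]
  omega

end

/-! ### Existence and uniqueness for a given `p`-series -/

namespace ArakiDatum
variable {p : ℕ} [hp : Fact p.Prime] {A : Type*} [CommRing A] (D : ArakiDatum p A)

theorem lg_formalSum {f : ℕ → A⟦X⟧} {m : ℕ}
    (hf : ∀ i < m, PowerSeries.constantCoeff (f i) = 0) :
    D.lg (formalSum D.fgl f m) = ∑ i ∈ Finset.range m, D.lg (f i) := by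
  induction m with
  | zero => exact D.lg_zero
  | succ m ih =>
    rw [Finset.sum_range_succ, ← ih fun i hi => hf i (by omega)]
    exact D.lg_subst_pair (formalSum_constantCoeff D.fgl fun i hi => hf i (by omega))
      (hf m (by omega))

theorem incl_C_mul_X_pow (a : A) (i : ℕ) :
    incl p Unit A (PowerSeries.C a * PowerSeries.X ^ i : A⟦X⟧) =
      (PowerSeries.C (algebraMap A (InvP p A) a) * PowerSeries.X ^ i : (InvP p A)⟦X⟧) := by
  change PowerSeries.map _ (_ : A⟦X⟧) = _
  simp

theorem log_subst_X : D.log.subst (PowerSeries.X : (InvP p A)⟦X⟧) = D.log :=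
  PowerSeries.X_subst _

theorem lg_X : D.lg (PowerSeries.X : A⟦X⟧) = D.log := by
  rw [lg, PowerSeries.X, incl_X]
  exact D.log_subst_X

/-- The `p`-series of the formal group law attached to an Araki datum. -/
theorem formalSum_X_eq {N : ℕ} (hN : ∀ i, N ≤ i → D.v i = 0) :
    formalSum D.fgl (fun _ => PowerSeries.X) p =
      formalSum D.fgl (fun i => PowerSeries.C (D.v i) * PowerSeries.X ^ p ^ i) N := by
  have hX : ∀ i, PowerSeries.constantCoeff
      (PowerSeries.C (D.v i) * PowerSeries.X ^ p ^ i : A⟦X⟧) = 0 := fun i =>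
    constantCoeff_C_mul_X_pow _ i
  refine D.lg_inj (formalSum_constantCoeff _ fun _ _ => by simp)
    (formalSum_constantCoeff _ fun i _ => hX i) ?_
  rw [lg_formalSum D fun _ _ => by simp, lg_formalSum D fun i _ => hX i]
  rw [Finset.sum_const, Finset.card_range, nsmul_eq_mul, lg_X]
  simp only [lg, incl_C_mul_X_pow]
  refine (natCast_mul_typicalSeries D.ell).trans ?_
  refine Eq.trans ?_ (sum_subst_monomial (p := p) (c := D.ell)
    (a := fun i => algebraMap A (InvP p A) (D.v i)) (N := N) fun i hi => ?_).symm
  · congr 1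
    ext k
    exact D.natCast_mul_ell k
  · rw [hN i hi, map_zero]

variable [IsDomain A] [CharZero A]

/-- The inclusion of `A[1/p]` into the field of fractions of `A`. -/
noncomputable def toFrac (p : ℕ) [hp : Fact p.Prime] (A : Type*) [CommRing A] [IsDomain A]
    [CharZero A] : InvP p A →+* FractionRing A :=
  IsLocalization.Away.lift (p : A) (g := algebraMap A (FractionRing A)) (by
    rw [map_natCast, isUnit_iff_ne_zero]
    have : (algebraMap A (FractionRing A)) (p : A) ≠ 0 := by
      rw [Ne, FaithfulSMul.algebraMap_eq_zero_iff]
      exact_mod_cast hp.out.ne_zero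
    rwa [map_natCast] at this)

theorem toFrac_algebraMap (a : A) :
    toFrac p A (algebraMap A (InvP p A) a) = algebraMap A (FractionRing A) a :=
  IsLocalization.Away.lift_eq _ _ _

theorem map_toFrac_incl {τ : Type*} (f : MvPowerSeries τ A) :
    MvPowerSeries.map (toFrac p A) (incl p τ A f) =
      MvPowerSeries.map (algebraMap A (FractionRing A)) f := by
  ext d
  simp only [MvPowerSeries.coeff_map, coeff_incl, toFrac_algebraMap]

theorem isLog_toFrac : IsLog (D.fgl.map (algebraMap A (FractionRing A))).toPowerSeries
    (PowerSeries.map (toFrac p A) D.log) := by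
  have hX (i : Fin 2) : MvPowerSeries.constantCoeff
    (MvPowerSeries.X i : MvPowerSeries (Fin 2) (InvP p A)) = 0 := by simp
  have h := congrArg (MvPowerSeries.map (toFrac p A)) D.groupSeries_isLog
  rwa [map_add, PowerSeries.map_subst
    (hasSubst_of_zero (constantCoeff_incl D.groupSeries_zero)),
    PowerSeries.map_subst (hasSubst_of_zero (hX 0)), PowerSeries.map_subst (hasSubst_of_zero (hX 1)),
    MvPowerSeries.map_X, MvPowerSeries.map_X, map_toFrac_incl] at h

theorem isPTypical_fgl : IsPTypical p D.fgl := by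
  refine ⟨PowerSeries.map (toFrac p A) D.log, ?_, fun m hm => ?_, D.isLog_toFrac⟩
  · rw [PowerSeries.coeff_map, D.log_isNormalized.one, map_one]
  · rw [PowerSeries.coeff_map] at hm
    exact eq_pow_of_coeff_typicalSeries_ne_zero fun h => hm (by rw [log, h, map_zero])

/-- A `p`-typical formal group law is determined by its `p`-series. -/
theorem eq_fgl {F : FormalGroup A} (hF : IsPTypical p F) {N : ℕ} (hN : ∀ i, N ≤ i → D.v i = 0)
    (h : formalSum F (fun _ => PowerSeries.X) p =
      formalSum F (fun i => PowerSeries.C (D.v i) * PowerSeries.X ^ p ^ i) N) : F = D.fgl := by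
  obtain ⟨l, hl1, hlp, hlog⟩ := hF
  set ι := algebraMap A (FractionRing A)
  set c : ℕ → FractionRing A := fun k => PowerSeries.coeff (p ^ k) l
  have hc : l = typicalSeries p c := eq_typicalSeries hlp
  have hc0 : c 0 = 1 := by simpa [c] using hl1
  have hn : IsNormalized l := by rw [hc]; exact typicalSeries_isNormalized hc0
  have hX : ∀ i, PowerSeries.constantCoeff
      (PowerSeries.C (D.v i) * PowerSeries.X ^ p ^ i : A⟦X⟧) = 0 := fun i =>
    constantCoeff_C_mul_X_pow _ i
  have hX' : ∀ i, PowerSeries.constantCoeff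
      (PowerSeries.C (ι (D.v i)) * PowerSeries.X ^ p ^ i : (FractionRing A)⟦X⟧) = 0 := fun i =>
    constantCoeff_C_mul_X_pow _ i
  have h1 := congrArg (PowerSeries.map ι) h
  rw [formalSum_map ι F fun _ _ => by simp, formalSum_map ι F fun i _ => hX i] at h1
  simp only [PowerSeries.map_X, map_mul, map_pow, PowerSeries.map_C] at h1
  have h2 := congrArg (fun f => (l.subst f : (FractionRing A)⟦X⟧)) h1
  beta_reduce at h2
  have hlog' : IsLog (F.map ι).toPowerSeries l := hlog
  rw [hlog'.formalSum hn fun _ _ => by simp, hlog'.formalSum hn fun i _ => hX' i,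
    PowerSeries.X_subst, Finset.sum_const, Finset.card_range, nsmul_eq_mul, hc,
    sum_subst_monomial (fun i hi => by rw [hN i hi, map_zero]), natCast_mul_typicalSeries] at h2
  -- The logarithm of the two sides of the `p`-series equation, compared at `x^{p^k}`, is the Araki
  -- relation. That relation determines the logarithm.
  have h3 : c = fun k => toFrac p A (D.ell k) := by
    ext k
    refine D.eq_ell_of_relation (toFrac p A) hc0 (fun k => ?_) k
    simp only [toFrac_algebraMap]
    exact congrFun (typicalSeries_injective h2) k
  have h4 : l = PowerSeries.map (toFrac p A) D.log := by
    rw [hc, h3, log, map_typicalSeries]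
  have h5 : (F.map ι).toPowerSeries = (D.fgl.map ι).toPowerSeries := by
    refine hn.inj (F.map ι).zero_constantCoeff (D.fgl.map ι).zero_constantCoeff ?_
    rw [hlog', h4]
    exact D.isLog_toFrac.symm
  refine FormalGroup.ext ?_
  ext d
  apply FaithfulSMul.algebraMap_injective A (FractionRing A)
  have := congrArg (MvPowerSeries.coeff d) h5
  rwa [FormalGroup.map_toPowerSeries, FormalGroup.map_toPowerSeries, MvPowerSeries.coeff_map,
    MvPowerSeries.coeff_map] at this

end ArakiDatum

/-! ### The Araki data over `E₀` and over `𝕎` -/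

section Witt
variable (p n : ℕ) [hp : Fact p.Prime]

instance : IsDomain (E0 p n) :=
  { (inferInstance : NoZeroDivisors (E0 p n)), (inferInstance : Nontrivial (E0 p n)) with }

/-- A positive characteristic would be `p`, as reduction to the residue field shows, but `p ≠ 0` in
`𝕎`. -/
instance : CharZero (W p n) := by
  obtain ⟨q, hq⟩ := CharP.exists (W p n)
  rcases CharP.char_is_prime_or_zero (W p n) q with h | rfl
  · have h0 := congrArg (WittVector.constantCoeff (p := p)) (CharP.cast_eq_zero (W p n) q)
    rw [map_natCast, map_zero, CharP.cast_eq_zero_iff (Fq p n) p,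
      Nat.prime_dvd_prime_iff_eq hp.out h] at h0
    subst h0
    exact absurd (CharP.cast_eq_zero (W p n) p) (WittVector.p_nonzero p (Fq p n))
  · exact CharP.charP_to_charZero _

instance : CharZero (E0 p n) :=
  charZero_of_injective_ringHom (f := MvPowerSeries.C (σ := Fin (n - 1)) (R := W p n))
    MvPowerSeries.C_injective

variable {p n}

theorem W.natCast_dvd_iff {x : W p n} : (p : W p n) ∣ x ↔ x.coeff 0 = 0 := by
  rw [← Ideal.mem_span_singleton, WittVector.mem_span_p_iff_coeff_zero_eq_zero]

theorem W.dvd_frobenius_sub_pow (a : W p n) :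
    (p : W p n) ∣ WittVector.frobenius a - a ^ p := by
  rw [W.natCast_dvd_iff]
  change WittVector.constantCoeff (WittVector.frobenius a - a ^ p) = 0
  rw [map_sub, map_pow, sub_eq_zero]
  exact WittVector.coeff_frobenius_charP p a 0

variable (p n)

/-- The Araki datum over `E₀` of the universal deformation. -/
noncomputable def E0datum : ArakiDatum p (E0 p n) where
  σ := twist p (Fin (n - 1)) WittVector.frobenius
  v := pSeriesCoeff p n
  dvd_frob := dvd_twist_sub_pow p W.dvd_frobenius_sub_pow
  v_zero := by simp [pSeriesCoeff]
  σ_v i := by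
    rw [pSeriesCoeff, if_neg (by omega)]
    split_ifs
    · rw [twist_X]
    · rw [map_one, one_pow]
    · rw [map_zero, zero_pow hp.out.ne_zero]
  isUnit a := by
    refine isUnit_of_residue_ne_zero ?_
    rw [map_sub, map_mul, map_one, map_natCast, CharP.cast_eq_zero, zero_mul, sub_zero]
    exact one_ne_zero
  regular := mem_nonZeroDivisors_of_ne_zero (by exact_mod_cast hp.out.ne_zero)

/-- The Araki datum over `𝕎` of the lift of the Honda formal group law with `p`-series
`p x + x^{p^n}`. -/
noncomputable def Wdatum [NeZero n] : ArakiDatum p (W p n) where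
  σ := WittVector.frobenius
  v i := if i = 0 then p else if i = n then 1 else 0
  dvd_frob := W.dvd_frobenius_sub_pow
  v_zero := by simp
  σ_v i := by
    rw [if_neg (by omega)]
    split_ifs
    · rw [map_one, one_pow]
    · rw [map_zero, zero_pow hp.out.ne_zero]
  isUnit a := by
    refine WittVector.isUnit_of_coeff_zero_ne_zero _ ?_
    change WittVector.constantCoeff (1 - (p : W p n) * a) ≠ 0
    rw [map_sub, map_mul, map_one, map_natCast, CharP.cast_eq_zero, zero_mul, sub_zero]
    exact one_ne_zero
  regular := mem_nonZeroDivisors_of_ne_zero (by exact_mod_cast hp.out.ne_zero)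

theorem E0datum_v_eq_zero {i : ℕ} (hi : n + 1 ≤ i) : (E0datum p n).v i = 0 := by
  change pSeriesCoeff p n i = 0
  rw [pSeriesCoeff, if_neg (by omega), dif_neg (by omega), if_neg (by omega)]

theorem isUniversalDeformation_fgl : IsUniversalDeformation p n (E0datum p n).fgl :=
  ⟨(E0datum p n).isPTypical_fgl,
    (E0datum p n).formalSum_X_eq (N := n + 1) fun _ hi => E0datum_v_eq_zero p n hi⟩

/-- Existence ensures that the chosen `univ` has the defining property, and uniqueness then
identifies it. -/
theorem univ_eq : univ p n = (E0datum p n).fgl := by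
  have h : IsUniversalDeformation p n (univ p n) :=
    Classical.epsilon_spec ⟨_, isUniversalDeformation_fgl p n⟩
  exact (E0datum p n).eq_fgl h.1 (fun _ hi => E0datum_v_eq_zero p n hi) h.2

/-- Setting all `u_i = 0` respects the lifts of Frobenius and the parameters, so by functoriality
reduction of `G_n` factors through a law over `𝕎`. The gain is a lift of `H_n` with a logarithm that
can be computed. -/
theorem honda_eq [NeZero n] :
    honda p n = (Wdatum p n).fgl.map (WittVector.constantCoeff (p := p) (R := Fq p n)) := by
  have h : (E0datum p n).fgl.map (MvPowerSeries.constantCoeff (R := W p n)) =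
      (Wdatum p n).fgl := by
    refine ArakiDatum.map_fgl (RingHom.ext fun f => ?_) fun k => ?_
    · change MvPowerSeries.constantCoeff (MvPowerSeries.expand p hp.out.ne_zero _) = _
      rw [MvPowerSeries.constantCoeff_expand, MvPowerSeries.constantCoeff_map]
      rfl
    · change MvPowerSeries.constantCoeff (pSeriesCoeff p n k) = if k = 0 then _ else _
      rw [pSeriesCoeff]
      have := NeZero.ne n
      split_ifs with h1 h2 h3 h4
      · rw [map_natCast]
      · omega
      · simp
      · simp
      · simp
  rw [honda, univ_eq, ← h]
  refine FormalGroup.ext ?_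
  ext d
  simp [residue]

end Witt

theorem IsHom.subst_add {R : Type*} [CommRing R] {F F' : FormalGroup R} {f : R⟦X⟧}
    (hf : IsHom F F' f) {τ : Type*} {a b : MvPowerSeries τ R}
    (ha : MvPowerSeries.constantCoeff a = 0) (hb : MvPowerSeries.constantCoeff b = 0) :
    f.subst (MvPowerSeries.subst ![a, b] F.toPowerSeries) =
      MvPowerSeries.subst ![f.subst a, f.subst b] F'.toPowerSeries := by
  have hX (i : Fin 2) : MvPowerSeries.constantCoeff
    (MvPowerSeries.X i : MvPowerSeries (Fin 2) R) = 0 := by simp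
  have h := congrArg (MvPowerSeries.subst ![a, b]) hf.2
  have hs := hasSubst_pair' ha hb
  rw [subst_pair_subst' F.zero_constantCoeff ha hb,
    MvPowerSeries.subst_comp_subst_apply (hasSubst_pair'
      (constantCoeff_subst_zero (hX 0) hf.1) (constantCoeff_subst_zero (hX 1) hf.1)) hs] at h
  rw [h]
  congr 1
  funext s
  fin_cases s
  · exact (subst_pair_subst' (hX 0) ha hb).trans (by rw [MvPowerSeries.subst_X hs]; rfl)
  · exact (subst_pair_subst' (hX 1) ha hb).trans (by rw [MvPowerSeries.subst_X hs]; rfl)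

theorem formalSum_eq_zero {R : Type*} [CommRing R] (F : FormalGroup R) {f : ℕ → R⟦X⟧} {m : ℕ}
    (hf : ∀ i < m, f i = 0) : formalSum F f m = 0 := by
  induction m with
  | zero => rfl
  | succ m ih =>
    rw [formalSum, ih fun i hi => hf i (by omega), hf m (by omega)]
    exact F.zero_add PowerSeries.HasSubst.zero

/-! ### The action of `𝕎` on the lift of the Honda formal group law -/

section HondaLift
variable (p n : ℕ) [hp : Fact p.Prime] [NeZero n]

open ArakiDatum

theorem Wdatum_v (k : ℕ) :
    (Wdatum p n).v k = if k = 0 then (p : W p n) else if k = n then 1 else 0 := rfl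

/-- Only `v_0` and `v_n` are nonzero, and the indices of `w` and `lam` in each product of the
recursion add up to the index being defined. So everything lives in degrees divisible by `n`. -/
theorem Wdatum_coeffPair_eq_zero (k : ℕ) (hk : ¬ n ∣ k) :
    (Wdatum p n).w k = 0 ∧ (Wdatum p n).lam k = 0 := by
  induction k using Nat.strong_induction_on with
  | _ k ih =>
  rcases k with _ | k
  · exact absurd (dvd_zero n) hk
  have key : ∀ m, m < k → (Wdatum p n).w (m + 1) *
      ((Wdatum p n).σ ^ (m + 1)) ((Wdatum p n).lam (k - m)) = 0 := by
    intro m hm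
    by_cases h : n ∣ m + 1
    · have h' : ¬ n ∣ k - m := fun h' => hk (by
        have := dvd_add h h'
        rwa [show m + 1 + (k - m) = k + 1 by omega] at this)
      rw [(ih _ (by omega) h').2, map_zero, mul_zero]
    · rw [(ih _ (by omega) h).1, zero_mul]
  have hv : (Wdatum p n).v (k + 1) = 0 := by
    have hkn : k + 1 ≠ n := by rintro rfl; exact hk dvd_rfl
    rw [Wdatum_v, if_neg (by omega), if_neg hkn]
  have hw : (Wdatum p n).w (k + 1) = 0 := by
    rw [w_succ, hv, Finset.sum_eq_zero fun m hm => by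
      rw [key m (Finset.mem_range.1 hm), zero_mul], add_zero, mul_zero]
  refine ⟨hw, ?_⟩
  rw [lam_succ, Finset.sum_range_succ, hw, mul_zero, zero_mul, add_zero]
  exact Finset.sum_eq_zero fun m hm => by
    rw [mul_assoc, key m (Finset.mem_range.1 hm), mul_zero]

variable {p n}

theorem Fq_pow (c : Fq p n) : c ^ p ^ n = c := by
  have : Fintype (Fq p n) := Fintype.ofFinite _
  have := FiniteField.pow_card c
  rwa [← Nat.card_eq_fintype_card, GaloisField.card p n (NeZero.ne n)] at this

theorem Fq_pow_mul (c : Fq p n) (k : ℕ) : c ^ p ^ (n * k) = c := by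
  induction k with
  | zero => simp
  | succ k ih => rw [Nat.mul_succ, pow_add, pow_mul, ih, Fq_pow]

theorem W.frobenius_pow_apply (a : W p n) (k : ℕ) :
    ((WittVector.frobenius : W p n →+* W p n) ^ (n * k)) a = a := by
  rw [RingHom.coe_pow]
  ext i
  rw [WittVector.iterate_frobenius_coeff, Fq_pow_mul]

/-- Either `s_i = 0`, or `n` divides `i` and then `φ^i` is the identity of `𝕎`. This is what makes
`exists_mulSeries` applicable to every `a ∈ 𝕎`. -/
theorem Wdatum_s_mul (a : W p n) (i : ℕ) :
    (Wdatum p n).s i * algebraMap (W p n) (InvP p (W p n)) (((Wdatum p n).σ ^ i) a) =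
      (Wdatum p n).s i * algebraMap (W p n) (InvP p (W p n)) a := by
  by_cases h : n ∣ i
  · obtain ⟨k, rfl⟩ := h
    congr 2
    exact W.frobenius_pow_apply a k
  · rw [s, (Wdatum_coeffPair_eq_zero p n i h).1, map_zero, mul_zero, zero_mul, zero_mul]

/-- Multiplication by `a ∈ 𝕎` on the lift of the Honda formal group law. -/
noncomputable def mulSeriesLift (a : W p n) : (W p n)⟦X⟧ :=
  ((Wdatum p n).exists_mulSeries a (Wdatum_s_mul a)).choose

theorem mulSeriesLift_zero (a : W p n) : PowerSeries.constantCoeff (mulSeriesLift a) = 0 :=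
  ((Wdatum p n).exists_mulSeries a (Wdatum_s_mul a)).choose_spec.1

theorem lg_mulSeriesLift (a : W p n) : (Wdatum p n).lg (mulSeriesLift a) =
    algebraMap (W p n) (InvP p (W p n)) a • (Wdatum p n).log := by
  have := ((Wdatum p n).exists_mulSeries a (Wdatum_s_mul a)).choose_spec.2
  exact this.trans (by rw [lg_X])

variable {τ : Type*}

theorem lg_mulSeriesLift_subst (a : W p n) {g : MvPowerSeries τ (W p n)}
    (hg : MvPowerSeries.constantCoeff g = 0) :
    (Wdatum p n).lg ((mulSeriesLift a).subst g) =
      algebraMap (W p n) (InvP p (W p n)) a • (Wdatum p n).lg g := by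
  rw [lg_subst _ (mulSeriesLift_zero a) hg, lg_mulSeriesLift,
    PowerSeries.subst_smul (hasSubst_of_zero (constantCoeff_incl hg))]
  rfl

theorem mulSeriesLift_isHom (a : W p n) :
    IsHom (Wdatum p n).fgl (Wdatum p n).fgl (mulSeriesLift a) := by
  have hX (i : Fin 2) : MvPowerSeries.constantCoeff
    (MvPowerSeries.X i : MvPowerSeries (Fin 2) (W p n)) = 0 := by simp
  have h0 := mulSeriesLift_zero a
  have hF := (Wdatum p n).groupSeries_zero
  have c0 := constantCoeff_subst_zero (hX 0) h0
  have c1 := constantCoeff_subst_zero (hX 1) h0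
  refine ⟨h0, (Wdatum p n).lg_inj (constantCoeff_subst_zero hF h0)
    (constantCoeff_subst_pair hF c0 c1) ?_⟩
  rw [fgl_toPowerSeries, lg_mulSeriesLift_subst a hF, lg_groupSeries, lg_subst_pair _ c0 c1,
    lg_mulSeriesLift_subst a (hX 0), lg_mulSeriesLift_subst a (hX 1), smul_add]

theorem mulSeriesLift_add (a b : W p n) : mulSeriesLift (a + b) =
    MvPowerSeries.subst ![mulSeriesLift a, mulSeriesLift b] (Wdatum p n).fgl.toPowerSeries := by
  have ha := mulSeriesLift_zero a
  have hb := mulSeriesLift_zero b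
  refine (Wdatum p n).lg_inj (mulSeriesLift_zero _)
    (constantCoeff_subst_pair (Wdatum p n).groupSeries_zero ha hb) ?_
  rw [fgl_toPowerSeries, lg_subst_pair _ ha hb, lg_mulSeriesLift, lg_mulSeriesLift,
    lg_mulSeriesLift, map_add, add_smul]

theorem mulSeriesLift_mul (a b : W p n) :
    mulSeriesLift (a * b) = (mulSeriesLift a).subst (mulSeriesLift b) := by
  refine (Wdatum p n).lg_inj (mulSeriesLift_zero _)
    (constantCoeff_subst_zero (mulSeriesLift_zero b) (mulSeriesLift_zero a)) ?_
  rw [lg_mulSeriesLift_subst a (mulSeriesLift_zero b), lg_mulSeriesLift, lg_mulSeriesLift, map_mul,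
    mul_smul]

theorem mulSeriesLift_one : mulSeriesLift (1 : W p n) = PowerSeries.X := by
  refine (Wdatum p n).lg_inj (mulSeriesLift_zero _) PowerSeries.constantCoeff_X ?_
  rw [lg_mulSeriesLift, lg_X, map_one, one_smul]

theorem mulSeriesLift_natCast : mulSeriesLift (p : W p n) = formalSum (Wdatum p n).fgl
    (fun i => PowerSeries.C ((Wdatum p n).v i) * PowerSeries.X ^ p ^ i) (n + 1) := by
  have hv : ∀ i, n + 1 ≤ i → (Wdatum p n).v i = 0 := fun i hi => by
    rw [Wdatum_v, if_neg (by omega), if_neg (by omega)]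
  rw [← (Wdatum p n).formalSum_X_eq hv]
  refine (Wdatum p n).lg_inj (mulSeriesLift_zero _)
    (formalSum_constantCoeff _ fun _ _ => PowerSeries.constantCoeff_X) ?_
  rw [lg_mulSeriesLift, lg_formalSum _ fun _ _ => PowerSeries.constantCoeff_X, Finset.sum_const,
    Finset.card_range, lg_X, map_natCast, Nat.cast_smul_eq_nsmul]

/-- The logarithm involves only the powers `x^{p^{nk}}`, and `c^{p^{nk}} = c`, so `ℓ([c] x) = [c]
ℓ(x)`. -/
theorem mulSeriesLift_teichmuller (c : Fq p n) : mulSeriesLift (WittVector.teichmuller p c) =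
    PowerSeries.C (WittVector.teichmuller p c) * PowerSeries.X := by
  have e : PowerSeries.C (WittVector.teichmuller p c) * PowerSeries.X =
    (PowerSeries.C (WittVector.teichmuller p c) * PowerSeries.X ^ p ^ 0 : (W p n)⟦X⟧) := by simp
  rw [e]
  refine (Wdatum p n).lg_inj (mulSeriesLift_zero _) (constantCoeff_C_mul_X_pow _ 0) ?_
  rw [lg_mulSeriesLift, lg, incl_C_mul_X_pow, log, typicalSeries_subst_monomial,
    PowerSeries.smul_eq_C_mul]
  ext m
  rw [PowerSeries.coeff_C_mul]
  by_cases hm : ∃ k, m = p ^ k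
  · obtain ⟨k, rfl⟩ := hm
    rw [coeff_typicalSeries_pow, coeff_typicalSeries_pow, if_pos (Nat.zero_le k), Nat.sub_zero]
    by_cases h : n ∣ k
    · obtain ⟨j, rfl⟩ := h
      rw [← map_pow, ← map_pow, Fq_pow_mul, mul_comm]
    · rw [ArakiDatum.ell, (Wdatum_coeffPair_eq_zero p n k h).2, map_zero, mul_zero, mul_zero, zero_mul]
  · rw [not_imp_comm.1 (eq_pow_of_coeff_typicalSeries_ne_zero (p := p)) hm,
      not_imp_comm.1 (eq_pow_of_coeff_typicalSeries_ne_zero (p := p)) hm, mul_zero]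

theorem Wdatum_map_v (σ : Fq p n →+* Fq p n) (k : ℕ) :
    WittVector.map σ ((Wdatum p n).v k) = (Wdatum p n).v k := by
  rw [Wdatum_v]
  split_ifs <;> simp

theorem Wdatum_map_σ (σ : Fq p n →+* Fq p n) :
    (WittVector.map σ).comp (Wdatum p n).σ = (Wdatum p n).σ.comp (WittVector.map σ) := by
  ext a i
  change (WittVector.map σ (WittVector.frobenius a)).coeff i =
    (WittVector.frobenius (WittVector.map σ a)).coeff i
  simp [WittVector.coeff_frobenius_charP]

/-- The parameters `p`, `0` and `1` are fixed by `σ`. This is the reason why `H_n` is defined over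
`𝔽_p`. -/
theorem map_Wdatum_fgl (σ : Fq p n →+* Fq p n) :
    (Wdatum p n).fgl.map (WittVector.map σ) = (Wdatum p n).fgl :=
  map_fgl (Wdatum_map_σ σ) (Wdatum_map_v σ)

theorem map_mulSeriesLift (σ : Fq p n →+* Fq p n) (a : W p n) :
    PowerSeries.map (WittVector.map σ) (mulSeriesLift a) = mulSeriesLift (WittVector.map σ a) := by
  have h0 : PowerSeries.constantCoeff
      (PowerSeries.map (WittVector.map σ) (mulSeriesLift a)) = 0 := by
    rw [← PowerSeries.coeff_zero_eq_constantCoeff_apply, PowerSeries.coeff_map,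
      PowerSeries.coeff_zero_eq_constantCoeff_apply, mulSeriesLift_zero, map_zero]
  refine (Wdatum p n).lg_inj h0 (mulSeriesLift_zero _) ?_
  refine (map_lg (Wdatum_map_σ σ) (Wdatum_map_v σ) (mulSeriesLift_zero a)).symm.trans ?_
  rw [lg_mulSeriesLift, lg_mulSeriesLift]
  change PowerSeries.map _ (_ : PowerSeries _) = _
  rw [PowerSeries.smul_eq_C_mul, PowerSeries.smul_eq_C_mul, map_mul, PowerSeries.map_C,
    map_log (Wdatum_map_σ σ) (Wdatum_map_v σ), invPMap_algebraMap]

end HondaLift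

/-! ### The action of `𝕎` on the Honda formal group law -/

section HondaMul
variable {p n : ℕ} [hp : Fact p.Prime] [NeZero n]

/-- Reduction modulo `p`, `𝕎 → 𝔽_{p^n}`. -/
noncomputable abbrev red (p n : ℕ) [Fact p.Prime] : W p n →+* Fq p n :=
  WittVector.constantCoeff (p := p) (R := Fq p n)

theorem isComm_map {R S : Type*} [CommRing R] [CommRing S] (φ : R →+* S) (F : FormalGroup R)
    [hF : F.IsComm] : (F.map φ).IsComm where
  comm := by
    have h := congrArg (MvPowerSeries.map φ) hF.comm
    rw [MvPowerSeries.map_subst MvPowerSeries.HasSubst.X_X] at h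
    rw [FormalGroup.map_toPowerSeries]
    refine h.trans ?_
    congr 1
    funext s
    fin_cases s <;> simp

instance : (honda p n).IsComm := by
  rw [honda_eq]
  exact isComm_map _ _

theorem honda_map (σ : Fq p n →+* Fq p n) : (honda p n).map σ = honda p n := by
  rw [honda_eq]
  conv_rhs => rw [← map_Wdatum_fgl σ]
  refine FormalGroup.ext ?_
  ext d
  simp

/-- Multiplication by `a ∈ 𝕎` on the Honda formal group law. -/
noncomputable def mulSeries (a : W p n) : (Fq p n)⟦X⟧ :=
  PowerSeries.map (red p n) (mulSeriesLift a)

theorem constantCoeff_map_eq_zero {R S : Type*} [CommRing R] [CommRing S] (φ : R →+* S)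
    {f : R⟦X⟧} (hf : PowerSeries.constantCoeff f = 0) :
    PowerSeries.constantCoeff (PowerSeries.map φ f) = 0 := by
  rw [← PowerSeries.coeff_zero_eq_constantCoeff_apply, PowerSeries.coeff_map,
    PowerSeries.coeff_zero_eq_constantCoeff_apply, hf, map_zero]

theorem mulSeries_zero (a : W p n) : PowerSeries.constantCoeff (mulSeries a) = 0 :=
  constantCoeff_map_eq_zero _ (mulSeriesLift_zero a)

theorem mulSeries_isHom (a : W p n) : IsHom (honda p n) (honda p n) (mulSeries a) := by
  have := (mulSeriesLift_isHom a).map (red p n)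
  rwa [← honda_eq] at this

theorem map_subst_pair {R S : Type*} [CommRing R] [CommRing S] (φ : R →+* S)
    (F : FormalGroup R) {f g : R⟦X⟧} (hf : PowerSeries.constantCoeff f = 0)
    (hg : PowerSeries.constantCoeff g = 0) :
    PowerSeries.map φ (MvPowerSeries.subst ![f, g] F.toPowerSeries : MvPowerSeries Unit R) =
      MvPowerSeries.subst ![PowerSeries.map φ f, PowerSeries.map φ g]
        (F.map φ).toPowerSeries := by
  refine (MvPowerSeries.map_subst (hasSubst_pair' hf hg) _).trans ?_
  congr 1
  funext s
  fin_cases s <;> rfl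

theorem mulSeries_add (a b : W p n) : mulSeries (a + b) =
    MvPowerSeries.subst ![mulSeries a, mulSeries b] (honda p n).toPowerSeries := by
  rw [mulSeries, mulSeriesLift_add, honda_eq]
  exact map_subst_pair _ _ (mulSeriesLift_zero a) (mulSeriesLift_zero b)

theorem mulSeries_mul (a b : W p n) :
    mulSeries (a * b) = (mulSeries a).subst (mulSeries b) := by
  rw [mulSeries, mulSeriesLift_mul]
  exact PowerSeries.map_subst (hasSubst_of_zero (mulSeriesLift_zero b)) _

theorem mulSeries_one : mulSeries (1 : W p n) = PowerSeries.X := by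
  rw [mulSeries, mulSeriesLift_one, PowerSeries.map_X]

theorem mulSeries_teichmuller (c : Fq p n) :
    mulSeries (WittVector.teichmuller p c) = PowerSeries.C c * PowerSeries.X := by
  rw [mulSeries, mulSeriesLift_teichmuller, map_mul, PowerSeries.map_C, PowerSeries.map_X]
  simp

/-- Modulo `p` the only nonzero term of the formal sum `p x +_F x^{p^n}` is the one with coefficient
`v_n = 1`. -/
theorem mulSeries_natCast : mulSeries (p : W p n) = PowerSeries.X ^ p ^ n := by
  rw [mulSeries, mulSeriesLift_natCast, formalSum_map _ _ fun i _ => constantCoeff_C_mul_X_pow _ i,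
    formalSum, formalSum_eq_zero]
  · have : (Wdatum p n).v n = 1 := by
      rw [Wdatum_v, if_neg (NeZero.ne n), if_pos rfl]
    rw [this, map_one, one_mul, map_pow, PowerSeries.map_X]
    exact FormalGroup.zero_add _ (PowerSeries.HasSubst.X_pow (pow_ne_zero _ hp.out.ne_zero))
  · intro i hi
    have : red p n ((Wdatum p n).v i) = 0 := by
      rw [Wdatum_v]
      split_ifs
      · rw [map_natCast, CharP.cast_eq_zero]
      · omega
      · rw [map_zero]
    rw [map_mul, PowerSeries.map_C, this, map_zero, zero_mul]

theorem map_mulSeries (σ : Fq p n →+* Fq p n) (a : W p n) :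
    PowerSeries.map σ (mulSeries a) = mulSeries (WittVector.map σ a) := by
  rw [mulSeries, mulSeries, ← map_mulSeriesLift]
  ext m
  simp

end HondaMul

/-! ### Substitution of congruent series -/

section SubstCongr
variable {R : Type*} [CommRing R] {τ : Type*}

/-- Substituting congruent series gives congruent results. -/
theorem subst_pair_sub_mem {N : ℕ} {a b a' b' : MvPowerSeries τ R}
    (ha : MvPowerSeries.constantCoeff a = 0) (hb : MvPowerSeries.constantCoeff b = 0)
    (ha' : MvPowerSeries.constantCoeff a' = 0) (hb' : MvPowerSeries.constantCoeff b' = 0)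
    (h : a - a' ∈ lowIdeal τ R N) (h' : b - b' ∈ lowIdeal τ R N) (F : MvPowerSeries (Fin 2) R) :
    MvPowerSeries.subst ![a, b] F - MvPowerSeries.subst ![a', b'] F ∈ lowIdeal τ R N := by
  intro d hd
  rw [map_sub, sub_eq_zero, MvPowerSeries.coeff_subst (hasSubst_pair' ha hb),
    MvPowerSeries.coeff_subst (hasSubst_pair' ha' hb')]
  refine finsum_congr fun e => ?_
  congr 1
  rw [← sub_eq_zero, ← map_sub]
  refine (?_ : _ ∈ lowIdeal τ R N) d hd
  rw [← Ideal.Quotient.eq, map_finsuppProd, map_finsuppProd]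
  refine Finsupp.prod_congr fun s _ => ?_
  rw [map_pow, map_pow]
  congr 1
  rw [Ideal.Quotient.eq]
  fin_cases s
  · exact h
  · exact h'

theorem subst_mem_lowIdeal {N : ℕ} {f : R⟦X⟧} (hf : PowerSeries.constantCoeff f = 0)
    {g : MvPowerSeries τ R} (hg : MvPowerSeries.constantCoeff g = 0)
    (h : g ∈ lowIdeal τ R N) : f.subst g ∈ lowIdeal τ R N := by
  obtain ⟨f', rfl⟩ := PowerSeries.X_dvd_iff.2 hf
  rw [PowerSeries.subst_mul (hasSubst_of_zero hg), PowerSeries.subst_X (hasSubst_of_zero hg)]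
  exact Ideal.mul_mem_right _ _ h

end SubstCongr

/-! ### The `𝕎`-module of curves in the Honda formal group law -/

section Curves
variable (p n : ℕ) [hp : Fact p.Prime] [NeZero n]

/-- Power series over `𝔽_{p^n}` without constant term, with the addition of the Honda formal
group law. -/
def Curve : Type := {f : (Fq p n)⟦X⟧ // PowerSeries.constantCoeff f = 0}

namespace Curve
variable {p n}

@[ext] theorem ext {f g : Curve p n} (h : f.1 = g.1) : f = g := Subtype.ext h

noncomputable instance : Add (Curve p n) where
  add f g := ⟨MvPowerSeries.subst ![f.1, g.1] (honda p n).toPowerSeries,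
    constantCoeff_subst_pair (honda p n).zero_constantCoeff f.2 g.2⟩

theorem add_val (f g : Curve p n) :
    (f + g).1 = MvPowerSeries.subst ![f.1, g.1] (honda p n).toPowerSeries := rfl

noncomputable instance : Zero (Curve p n) := ⟨⟨0, map_zero _⟩⟩

theorem zero_val : (0 : Curve p n).1 = 0 := rfl

/-- Composition of curves. -/
noncomputable def comp (f g : Curve p n) : Curve p n :=
  ⟨f.1.subst g.1, constantCoeff_subst_zero (R := Fq p n) (σ := Unit) g.2 f.2⟩

theorem comp_val (f g : Curve p n) : (f.comp g).1 = f.1.subst g.1 := rfl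

theorem hasSubst (f : Curve p n) : PowerSeries.HasSubst f.1 :=
  PowerSeries.HasSubst.of_constantCoeff_zero' f.2

theorem comp_assoc (f g h : Curve p n) : (f.comp g).comp h = f.comp (g.comp h) :=
  ext (PowerSeries.subst_comp_subst_apply g.hasSubst h.hasSubst f.1)

theorem add_comp (f g h : Curve p n) : (f + g).comp h = f.comp h + g.comp h := by
  apply ext
  have hh : MvPowerSeries.constantCoeff h.1 = 0 := h.2
  rw [comp_val, add_val, add_val, PowerSeries.subst,
    MvPowerSeries.subst_comp_subst_apply (hasSubst_pair' f.2 g.2) (hasSubst_of_zero hh).const]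
  congr 1
  funext s
  fin_cases s <;> rfl

/-- A curve that is an endomorphism of the Honda formal group law. -/
def IsEndo (f : Curve p n) : Prop := IsHom (honda p n) (honda p n) f.1

theorem IsEndo.comp_add {f : Curve p n} (hf : f.IsEndo) (g h : Curve p n) :
    f.comp (g + h) = f.comp g + f.comp h :=
  ext (hf.subst_add (τ := Unit) g.2 h.2)

/-- The identity curve. -/
noncomputable def id (p n : ℕ) [Fact p.Prime] [NeZero n] : Curve p n :=
  ⟨PowerSeries.X, PowerSeries.constantCoeff_X⟩

theorem id_comp (f : Curve p n) : (Curve.id p n).comp f = f :=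
  ext (PowerSeries.subst_X f.hasSubst)

theorem comp_id (f : Curve p n) : f.comp (Curve.id p n) = f :=
  ext (PowerSeries.X_subst f.1)

theorem zero_comp (f : Curve p n) : (0 : Curve p n).comp f = 0 := by
  apply ext
  rw [comp_val, zero_val, ← PowerSeries.coe_substAlgHom f.hasSubst, map_zero]

theorem comp_zero (f : Curve p n) : f.comp 0 = 0 :=
  ext (PowerSeries.subst_zero_of_constantCoeff_zero (τ := Unit) f.2)

/-- The curve `[a]`. -/
noncomputable def ofW (a : W p n) : Curve p n := ⟨mulSeries a, mulSeries_zero a⟩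

theorem ofW_isEndo (a : W p n) : (ofW a).IsEndo := mulSeries_isHom a

noncomputable instance : SMul (W p n) (Curve p n) where
  smul a f := (ofW a).comp f

theorem smul_def (a : W p n) (f : Curve p n) : a • f = (ofW a).comp f := rfl

theorem ofW_add (a b : W p n) : ofW (a + b) = ofW a + ofW b := ext (mulSeries_add a b)

theorem ofW_mul (a b : W p n) : ofW (a * b) = (ofW a).comp (ofW b) := ext (mulSeries_mul a b)

theorem ofW_one : ofW (1 : W p n) = Curve.id p n := ext mulSeries_one

theorem ofW_zero : ofW (0 : W p n) = 0 := by
  have h : WittVector.teichmuller p (0 : Fq p n) = 0 := WittVector.teichmuller_zero p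
  apply ext
  change mulSeries 0 = 0
  rw [← h, mulSeries_teichmuller, map_zero, zero_mul]

protected theorem zero_add' (f : Curve p n) : 0 + f = f :=
  ext (FormalGroup.zero_add _ f.hasSubst)

protected theorem add_comm' (f g : Curve p n) : f + g = g + f :=
  ext (FormalGroup.comm' _ f.hasSubst g.hasSubst)

protected theorem add_assoc' (f g h : Curve p n) : f + g + h = f + (g + h) :=
  ext (FormalGroup.assoc' _ f.hasSubst g.hasSubst h.hasSubst)

noncomputable instance : Neg (Curve p n) := ⟨fun f => (-1 : W p n) • f⟩

noncomputable instance : AddCommGroup (Curve p n) where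
  add_assoc := Curve.add_assoc'
  zero_add := Curve.zero_add'
  add_zero f := by rw [Curve.add_comm', Curve.zero_add']
  nsmul := nsmulRec
  zsmul := zsmulRec
  neg_add_cancel f := by
    have h : (-1 : W p n) • f + f = ((-1 : W p n) + 1) • f := by
      rw [smul_def, smul_def, ofW_add, add_comp, ofW_one, id_comp]
    change (-1 : W p n) • f + f = 0
    rw [h, neg_add_cancel, smul_def, ofW_zero, zero_comp]
  add_comm := Curve.add_comm'

noncomputable instance : Module (W p n) (Curve p n) where
  one_smul f := by rw [smul_def, ofW_one, id_comp]
  mul_smul a b f := by rw [smul_def, smul_def, smul_def, ofW_mul, comp_assoc]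
  smul_zero a := comp_zero _
  smul_add a f g := (ofW_isEndo a).comp_add f g
  add_smul a b f := by rw [smul_def, ofW_add, add_comp]; rfl
  zero_smul f := by rw [smul_def, ofW_zero, zero_comp]

/-- Composition with a fixed curve on the right is linear. -/
noncomputable def compRight (g : Curve p n) : Curve p n →ₗ[W p n] Curve p n where
  toFun f := f.comp g
  map_add' f f' := add_comp f f' g
  map_smul' a f := by rw [smul_def, comp_assoc, RingHom.id_apply, smul_def]

theorem compRight_apply (f g : Curve p n) : compRight g f = f.comp g := rfl

/-- Composition with an endomorphism on the left is additive. -/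
noncomputable def compLeft {f : Curve p n} (hf : f.IsEndo) : Curve p n →+ Curve p n where
  toFun g := f.comp g
  map_zero' := comp_zero f
  map_add' := hf.comp_add

/-- The action of an endomorphism of `𝔽_{p^n}` on the coefficients of a curve. -/
noncomputable def mapCoeff (σ : Fq p n →+* Fq p n) : Curve p n →+ Curve p n where
  toFun f := ⟨PowerSeries.map σ f.1, constantCoeff_map_eq_zero σ f.2⟩
  map_zero' := ext (map_zero _)
  map_add' f g := by
    apply ext
    change PowerSeries.map σ (f + g).1 = MvPowerSeries.subst ![_, _] _
    rw [add_val]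
    refine (map_subst_pair σ (honda p n) f.2 g.2).trans ?_
    rw [honda_map]

theorem mapCoeff_val (σ : Fq p n →+* Fq p n) (f : Curve p n) :
    (mapCoeff σ f).1 = PowerSeries.map σ f.1 := rfl

theorem mapCoeff_comp (σ : Fq p n →+* Fq p n) (f g : Curve p n) :
    mapCoeff σ (f.comp g) = (mapCoeff σ f).comp (mapCoeff σ g) :=
  ext (PowerSeries.map_subst g.hasSubst f.1)

theorem mapCoeff_smul (σ : Fq p n →+* Fq p n) (a : W p n) (f : Curve p n) :
    mapCoeff σ (a • f) = WittVector.map σ a • mapCoeff σ f := by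
  rw [smul_def, mapCoeff_comp, smul_def]
  congr 1
  exact ext (map_mulSeries σ a)

/-- The curve `S^m = x^{p^m}`. -/
noncomputable def S (p n : ℕ) [hp : Fact p.Prime] [NeZero n] (m : ℕ) : Curve p n :=
  ⟨PowerSeries.X ^ p ^ m, by
    rw [map_pow, PowerSeries.constantCoeff_X, zero_pow (pow_ne_zero m hp.out.ne_zero)]⟩

theorem S_val (m : ℕ) : (S p n m).1 = PowerSeries.X ^ p ^ m := rfl

theorem S_zero : S p n 0 = Curve.id p n := ext (by simp [S_val, Curve.id])

theorem S_comp_val (m : ℕ) (f : Curve p n) : ((S p n m).comp f).1 = f.1 ^ p ^ m := by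
  rw [comp_val, S_val, PowerSeries.subst_pow f.hasSubst, PowerSeries.subst_X f.hasSubst]

theorem S_add (a b : ℕ) : S p n (a + b) = (S p n a).comp (S p n b) :=
  ext (by rw [S_comp_val, S_val, S_val, ← pow_mul, ← pow_add, add_comm])

/-- In characteristic `p` one has `f(x)^p = f^φ(x^p)`. This yields the relation `S a = a^φ S` and
the Frobenius invariance of the determinant. -/
theorem S_comp (f : Curve p n) :
    (S p n 1).comp f = (mapCoeff (frobenius (Fq p n) p) f).comp (S p n 1) := by
  apply ext
  rw [S_comp_val, pow_one, comp_val, S_val, pow_one, mapCoeff_val]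
  have h := MvPowerSeries.map_frobenius_expand (R := Fq p n) (σ := Unit) p hp.out.ne_zero (f := f.1)
  rw [MvPowerSeries.map_expand, MvPowerSeries.expand, MvPowerSeries.coe_substAlgHom] at h
  exact h.symm

/-- The coefficients of `H_n` are fixed by Frobenius, so `H_n(x, y)^p = H_n(x^p, y^p)`. -/
theorem S_isEndo (m : ℕ) : (S p n m).IsEndo := by
  induction m with
  | zero => rw [S_zero]; exact IsHom.id _
  | succ m ih =>
    rw [S_add]
    refine IsHom.comp ih ⟨(S p n 1).2, ?_⟩
    have h0 := (honda p n).zero_constantCoeff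
    have hF : MvPowerSeries.map (frobenius (Fq p n) p) (honda p n).toPowerSeries =
        (honda p n).toPowerSeries := congrArg FormalGroup.toPowerSeries (honda_map _)
    have h := MvPowerSeries.map_frobenius_expand (R := Fq p n) p hp.out.ne_zero
      (f := (honda p n).toPowerSeries)
    rw [MvPowerSeries.map_expand, hF, MvPowerSeries.expand, MvPowerSeries.coe_substAlgHom] at h
    have e (a : MvPowerSeries (Fin 2) (Fq p n)) (ha : MvPowerSeries.constantCoeff a = 0) :
        (S p n 1).1.subst a = a ^ p := by
      rw [S_val, pow_one, PowerSeries.subst_pow (hasSubst_of_zero ha),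
        PowerSeries.subst_X (hasSubst_of_zero ha)]
    rw [e _ h0, e _ (by simp), e _ (by simp), ← h]
    congr 1
    funext s
    fin_cases s <;> rfl

theorem mapCoeff_S (σ : Fq p n →+* Fq p n) (m : ℕ) : mapCoeff σ (S p n m) = S p n m :=
  ext (by rw [mapCoeff_val, S_val, map_pow, PowerSeries.map_X])

theorem natCast_smul_id : (p : W p n) • Curve.id p n = S p n n := by
  rw [smul_def, comp_id]
  exact ext mulSeries_natCast

theorem natCast_smul (f : Curve p n) : (p : W p n) • f = (S p n n).comp f := by
  rw [← natCast_smul_id, smul_def, smul_def, comp_id]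

end Curve
end Curves

/-! ### Leading exponents of homomorphisms -/

section LeadingTerm
variable {R : Type*} [CommRing R] {τ : Type*}

theorem subst_pair_mem_lowIdeal {M N : ℕ} {a b : MvPowerSeries τ R}
    (ha : MvPowerSeries.constantCoeff a = 0) (hb : MvPowerSeries.constantCoeff b = 0)
    (h : a ∈ lowIdeal τ R N) (h' : b ∈ lowIdeal τ R N) {F : MvPowerSeries (Fin 2) R}
    (hF : F ∈ lowIdeal (Fin 2) R M) :
    MvPowerSeries.subst ![a, b] F ∈ lowIdeal τ R (M * N) := by
  intro d hd
  rw [MvPowerSeries.coeff_subst (hasSubst_pair' ha hb)]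
  refine finsum_eq_zero_of_forall_eq_zero fun e => ?_
  by_cases he : e.degree < M
  · rw [hF e he, zero_smul]
  · have : (e.prod fun s k => (![a, b] s) ^ k) ∈ lowIdeal τ R (e.degree * N) := by
      rw [Finsupp.prod_fintype _ _ fun s => pow_zero _, Fin.prod_univ_two, Finsupp.degree_eq_sum,
        Fin.sum_univ_two, add_mul]
      exact mul_mem_lowIdeal (pow_mem_lowIdeal h _) (pow_mem_lowIdeal h' _)
    rw [this d (hd.trans_le (Nat.mul_le_mul_right _ (not_lt.1 he))), smul_zero]

theorem FormalGroup.sub_X_sub_X_mem (F : FormalGroup R) :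
    F.toPowerSeries - (MvPowerSeries.X 0 + MvPowerSeries.X 1) ∈ lowIdeal (Fin 2) R 2 := by
  intro d hd
  rcases Nat.lt_succ_iff_lt_or_eq.1 hd with h | h
  · have : d = 0 := (Finsupp.degree_eq_zero_iff d).1 (by omega)
    subst this
    simp [F.zero_constantCoeff]
  · obtain ⟨i, rfl⟩ : ∃ i, d = Finsupp.single i 1 := by
      rw [Finsupp.degree_eq_sum, Fin.sum_univ_two] at h
      rcases Nat.eq_zero_or_pos (d 0) with h0 | h0
      · exact ⟨1, by ext i; fin_cases i <;> simp <;> omega⟩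
      · exact ⟨0, by ext i; fin_cases i <;> simp <;> omega⟩
    rw [map_sub, map_add, MvPowerSeries.coeff_index_single_X, MvPowerSeries.coeff_index_single_X]
    fin_cases i
    · simpa [sub_eq_zero] using F.lin_coeff_X
    · simpa [sub_eq_zero] using F.lin_coeff_Y

/-- A formal sum agrees with the ordinary sum up to terms of twice the order. -/
theorem subst_pair_sub_add_mem (F : FormalGroup R) {N : ℕ} {a b : MvPowerSeries τ R}
    (ha : MvPowerSeries.constantCoeff a = 0) (hb : MvPowerSeries.constantCoeff b = 0)
    (h : a ∈ lowIdeal τ R N) (h' : b ∈ lowIdeal τ R N) :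
    MvPowerSeries.subst ![a, b] F.toPowerSeries - (a + b) ∈ lowIdeal τ R (2 * N) := by
  have hs := hasSubst_pair' ha hb
  have := subst_pair_mem_lowIdeal ha hb h h' (FormalGroup.sub_X_sub_X_mem F)
  rwa [MvPowerSeries.subst_sub hs, MvPowerSeries.subst_add hs, MvPowerSeries.subst_X hs,
    MvPowerSeries.subst_X hs] at this

theorem subst_sub_leading_mem {m : ℕ} {f : R⟦X⟧} (hf : PowerSeries.X ^ m ∣ f)
    {g : MvPowerSeries τ R} (hg : MvPowerSeries.constantCoeff g = 0) :
    f.subst g - MvPowerSeries.C (PowerSeries.coeff m f) * g ^ m ∈ lowIdeal τ R (m + 1) := by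
  have h : PowerSeries.X ^ (m + 1) ∣ f - PowerSeries.C (PowerSeries.coeff m f) * PowerSeries.X ^ m := by
    rw [PowerSeries.X_pow_dvd_iff]
    intro k hk
    rw [map_sub, PowerSeries.coeff_C_mul, PowerSeries.coeff_X_pow]
    split_ifs with hkm
    · rw [hkm, mul_one, sub_self]
    · rw [PowerSeries.X_pow_dvd_iff.1 hf k (by omega), mul_zero, sub_zero]
  obtain ⟨q, hq⟩ := h
  have hs := hasSubst_of_zero hg
  have h2 := congrArg (fun s => (PowerSeries.subst g s : MvPowerSeries τ R)) hq
  beta_reduce at h2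
  rw [PowerSeries.subst_sub hs, PowerSeries.subst_mul hs, PowerSeries.subst_mul hs,
    PowerSeries.subst_pow hs, PowerSeries.subst_pow hs, PowerSeries.subst_X hs,
    PowerSeries.subst_C] at h2
  rw [h2]
  exact Ideal.mul_mem_right _ _ (pow_mem_lowIdeal_of_constantCoeff hg _)

/-- The leading exponent of a homomorphism of formal group laws satisfies the divisibility of
binomial coefficients that characterizes prime powers. -/
theorem IsHom.choose_mul_coeff_eq_zero {F F' : FormalGroup R} {f : R⟦X⟧} (hf : IsHom F F' f)
    {m : ℕ} (hm : PowerSeries.X ^ m ∣ f) {i : ℕ} (hi : 0 < i) (him : i < m) :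
    (m.choose i : R) * PowerSeries.coeff m f = 0 := by
  set c := PowerSeries.coeff m f
  have hX (i : Fin 2) : MvPowerSeries.constantCoeff
    (MvPowerSeries.X i : MvPowerSeries (Fin 2) R) = 0 := by simp
  have hXm (i : Fin 2) : f.subst (MvPowerSeries.X i : MvPowerSeries (Fin 2) R) ∈
      lowIdeal (Fin 2) R m := by
    obtain ⟨q, hq⟩ := hm
    rw [hq, PowerSeries.subst_mul (hasSubst_of_zero (hX i)),
      PowerSeries.subst_pow (hasSubst_of_zero (hX i)), PowerSeries.subst_X (hasSubst_of_zero (hX i))]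
    exact Ideal.mul_mem_right _ _ (pow_mem_lowIdeal_of_constantCoeff (hX i) m)
  have c0 := constantCoeff_subst_zero (hX 0) hf.1
  have c1 := constantCoeff_subst_zero (hX 1) hf.1
  have e1 := subst_sub_leading_mem hm F.zero_constantCoeff
  have e2 := lowIdeal_anti (show m + 1 ≤ 2 * m by omega)
    (subst_pair_sub_add_mem F' c0 c1 (hXm 0) (hXm 1))
  have e3 := subst_sub_leading_mem hm (hX 0)
  have e4 := subst_sub_leading_mem hm (hX 1)
  have e5 : F.toPowerSeries ^ m - (MvPowerSeries.X 0 + MvPowerSeries.X 1) ^ m ∈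
      lowIdeal (Fin 2) R (m + 1) := by
    rw [← Commute.mul_geom_sum₂ (Commute.all _ _) m, show m + 1 = 2 + (m - 1) by omega]
    refine mul_mem_lowIdeal (FormalGroup.sub_X_sub_X_mem F) (Ideal.sum_mem _ fun j hj => ?_)
    rw [Finset.mem_range] at hj
    rw [show m - 1 = j + (m - 1 - j) by omega, Nat.add_sub_cancel_left]
    exact mul_mem_lowIdeal (pow_mem_lowIdeal_of_constantCoeff F.zero_constantCoeff _)
      (pow_mem_lowIdeal_of_constantCoeff (by simp) _)
  -- Both group laws are `x + y` up to terms of degree two, so in degree `m` the homomorphism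
  -- property reads `c (x + y)^m = c x^m + c y^m`. The coefficient of `x^i y^{m-i}` gives the claim.
  have e6 : MvPowerSeries.C c * (MvPowerSeries.X 0 + MvPowerSeries.X 1) ^ m -
      MvPowerSeries.C c * (MvPowerSeries.X 0 : MvPowerSeries (Fin 2) R) ^ m -
      MvPowerSeries.C c * (MvPowerSeries.X 1 : MvPowerSeries (Fin 2) R) ^ m ∈
        lowIdeal (Fin 2) R (m + 1) := by
    rw [← hf.2] at e2
    have := Ideal.sub_mem _ (Ideal.add_mem _ (Ideal.add_mem _ e2 e3) e4)
      (Ideal.add_mem _ e1 (Ideal.mul_mem_left _ (MvPowerSeries.C c) e5))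
    convert this using 1
    ring
  set d : Fin 2 →₀ ℕ := Finsupp.single 0 i + Finsupp.single 1 (m - i)
  have hd0 : d 0 = i := by simp [d]
  have hd1 : d 1 = m - i := by simp [d]
  have h := e6 d (by rw [Finsupp.degree_eq_sum, Fin.sum_univ_two, hd0, hd1]; omega)
  have hpow := PowerSeries.coeff_subst_X_zero_add_X_one (PowerSeries.X ^ m : R⟦X⟧) d
  rw [PowerSeries.subst_pow (hasSubst_of_zero (by simp)),
    PowerSeries.subst_X (hasSubst_of_zero (by simp)), hd0, hd1, show i + (m - i) = m by omega,
    PowerSeries.coeff_X_pow_self, mul_one] at hpow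
  have hx0 : MvPowerSeries.coeff d ((MvPowerSeries.X 0 : MvPowerSeries (Fin 2) R) ^ m) = 0 := by
    classical
    rw [MvPowerSeries.coeff_X_pow, if_neg]
    intro h'
    have := DFunLike.congr_fun h' 0
    simp [hd0] at this
    omega
  have hx1 : MvPowerSeries.coeff d ((MvPowerSeries.X 1 : MvPowerSeries (Fin 2) R) ^ m) = 0 := by
    classical
    rw [MvPowerSeries.coeff_X_pow, if_neg]
    intro h'
    have := DFunLike.congr_fun h' 0
    simp [hd0] at this
    omega
  rw [map_sub, map_sub, MvPowerSeries.coeff_C_mul, MvPowerSeries.coeff_C_mul,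
    MvPowerSeries.coeff_C_mul, hx0, hx1, mul_zero, sub_zero, sub_zero, hpow, mul_comm] at h
  exact h

/-- Lucas's congruence removes one factor `p` from both entries at a time. -/
theorem choose_pow_mul_modEq (p : ℕ) [hp : Fact p.Prime] (k u : ℕ) :
    (p ^ k * u).choose (p ^ k) ≡ u [MOD p] := by
  induction k with
  | zero => simpa using Nat.ModEq.refl u
  | succ k ih =>
    have h := Choose.choose_modEq_choose_mod_mul_choose_div_nat (p := p) (n := p ^ (k + 1) * u)
      (k := p ^ (k + 1))
    rw [pow_succ', mul_assoc, Nat.mul_mod_right, Nat.mul_mod_right,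
      Nat.mul_div_cancel_left _ hp.out.pos, Nat.mul_div_cancel_left _ hp.out.pos, Nat.choose_self,
      one_mul] at h
    rw [pow_succ', mul_assoc]
    exact h.trans ih

/-- The leading exponent of a homomorphism of formal group laws in characteristic `p` is a power
of `p`. -/
theorem IsHom.coeff_eq_zero {p : ℕ} [hp : Fact p.Prime] {k : Type*} [Field k] [CharP k p]
    {F F' : FormalGroup k} {f : k⟦X⟧} (hf : IsHom F F' f) {m : ℕ} (hm : PowerSeries.X ^ m ∣ f)
    (hm0 : m ≠ 0) (hmp : ∀ i, m ≠ p ^ i) : PowerSeries.coeff m f = 0 := by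
  obtain ⟨i, u, hu, rfl⟩ := Nat.exists_eq_pow_mul_and_not_dvd hm0 p hp.out.ne_one
  have hu1 : u ≠ 1 := fun h => hmp i (by rw [h, mul_one])
  have hu0 : u ≠ 0 := right_ne_zero_of_mul hm0
  have hpi : 0 < p ^ i := pow_pos hp.out.pos i
  -- For `m = p^i u` with `u > 1` prime to `p`, the binomial coefficient of `m` over `p^i` is
  -- congruent to `u`, hence invertible in `k`.
  have h := hf.choose_mul_coeff_eq_zero hm hpi (by nlinarith [show 2 ≤ u by omega])
  refine (mul_eq_zero.1 h).resolve_left fun h0 => hu ?_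
  rw [CharP.cast_eq_zero_iff k p] at h0
  exact ((choose_pow_mul_modEq p i u).dvd_iff dvd_rfl).1 h0

end LeadingTerm

theorem W.pow_dvd_iff {p n : ℕ} [Fact p.Prime] {x : W p n} {K : ℕ} :
    (p : W p n) ^ K ∣ x ↔ ∀ m < K, x.coeff m = 0 := by
  rw [← Ideal.mem_span_singleton, WittVector.mem_span_p_pow_iff_le_coeff_eq_zero]

/-! ### Endomorphisms of the Honda formal group law and their coordinates -/

namespace Curve
variable {p n : ℕ} [hp : Fact p.Prime] [NeZero n]

theorem add_subst {τ : Type*} (f g : Curve p n) {a : MvPowerSeries τ (Fq p n)}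
    (ha : MvPowerSeries.constantCoeff a = 0) : (f + g).1.subst a =
      MvPowerSeries.subst ![f.1.subst a, g.1.subst a] (honda p n).toPowerSeries := by
  rw [add_val, PowerSeries.subst,
    MvPowerSeries.subst_comp_subst_apply (hasSubst_pair' f.2 g.2) (hasSubst_of_zero ha).const]
  congr 1
  funext s
  fin_cases s <;> rfl

/-- Both sides are formal sums of the same four series, in an order that commutativity of `H_n`
allows to change. -/
theorem IsEndo.add {f g : Curve p n} (hf : f.IsEndo) (hg : g.IsEndo) : (f + g).IsEndo := by
  refine ⟨(f + g).2, ?_⟩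
  have hX (i : Fin 2) : MvPowerSeries.constantCoeff
    (MvPowerSeries.X i : MvPowerSeries (Fin 2) (Fq p n)) = 0 := by simp
  rw [add_subst f g (honda p n).zero_constantCoeff, add_subst f g (hX 0), add_subst f g (hX 1),
    hf.2, hg.2]
  have c (h : Curve p n) (i : Fin 2) : PowerSeries.HasSubst
      (h.1.subst (MvPowerSeries.X i : MvPowerSeries (Fin 2) (Fq p n))) :=
    hasSubst_of_zero (constantCoeff_subst_zero (hX i) h.2)
  let P (h : Curve p n) (i : Fin 2) : (honda p n).Point (Fin 2) := ⟨_, c h i⟩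
  exact congrArg Subtype.val (add_add_add_comm (P f 0) (P f 1) (P g 0) (P g 1))

theorem IsEndo.comp {f g : Curve p n} (hf : f.IsEndo) (hg : g.IsEndo) : (f.comp g).IsEndo :=
  IsHom.comp hf hg

theorem IsEndo.smul {f : Curve p n} (hf : f.IsEndo) (a : W p n) : (a • f).IsEndo :=
  (ofW_isEndo a).comp hf

theorem IsEndo.neg {f : Curve p n} (hf : f.IsEndo) : (-f).IsEndo := by
  rw [← neg_one_smul (W p n)]
  exact hf.smul _

theorem IsEndo.sub {f g : Curve p n} (hf : f.IsEndo) (hg : g.IsEndo) : (f - g).IsEndo := by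
  rw [sub_eq_add_neg]
  exact hf.add hg.neg

variable (p n) in
/-- The curves that vanish to order at least `N`. -/
def fil (N : ℕ) : Submodule (W p n) (Curve p n) where
  carrier := {f | PowerSeries.X ^ N ∣ f.1}
  add_mem' {f g} hf hg := by
    have hf : PowerSeries.X ^ N ∣ f.1 := hf
    have hg : PowerSeries.X ^ N ∣ g.1 := hg
    change PowerSeries.X ^ N ∣ (f + g).1
    rw [X_pow_dvd_iff_mem_lowIdeal] at hf hg ⊢
    have := subst_pair_sub_add_mem (honda p n) (τ := Unit) f.2 g.2 hf hg
    rw [add_val, ← sub_add_cancel (MvPowerSeries.subst ![f.1, g.1] (honda p n).toPowerSeries)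
      (f.1 + g.1)]
    exact add_mem (lowIdeal_anti (by omega) this) (add_mem hf hg)
  zero_mem' := dvd_zero _
  smul_mem' a f hf := by
    have hf : PowerSeries.X ^ N ∣ f.1 := hf
    change PowerSeries.X ^ N ∣ (a • f).1
    rw [X_pow_dvd_iff_mem_lowIdeal] at hf ⊢
    exact subst_mem_lowIdeal (τ := Unit) (mulSeries_zero a) f.2 hf

theorem mem_fil {N : ℕ} {f : Curve p n} : f ∈ fil p n N ↔ PowerSeries.X ^ N ∣ f.1 := Iff.rfl

theorem fil_anti {M N : ℕ} (h : M ≤ N) : fil p n N ≤ fil p n M :=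
  fun _ hf => (pow_dvd_pow _ h).trans hf

theorem eq_zero_of_mem_fil {f : Curve p n} (h : ∀ N, f ∈ fil p n N) : f = 0 := by
  ext k
  exact PowerSeries.X_pow_dvd_iff.1 (h (k + 1)) k k.lt_succ_self

theorem mem_fil_one (f : Curve p n) : f ∈ fil p n 1 := by
  rw [mem_fil, pow_one, PowerSeries.X_dvd_iff]
  exact f.2

/-- Congruence of curves as series is congruence in the group of curves. -/
theorem sub_mem_fil {N : ℕ} {f g : Curve p n} :
    f - g ∈ fil p n N ↔ PowerSeries.X ^ N ∣ f.1 - g.1 := by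
  constructor
  · intro h
    rw [mem_fil, X_pow_dvd_iff_mem_lowIdeal] at h
    rw [X_pow_dvd_iff_mem_lowIdeal]
    have e : f.1 - g.1 = (f - g + g).1 - (0 + g).1 := by rw [sub_add_cancel, zero_add]
    rw [e]
    refine subst_pair_sub_mem (τ := Unit) (f - g).2 g.2 (map_zero _) g.2 ?_ ?_ _
    · exact (congrArg (· ∈ lowIdeal Unit (Fq p n) N) (sub_zero (f - g).1)).mpr h
    · rw [sub_self]; exact zero_mem _
  · intro h
    rw [X_pow_dvd_iff_mem_lowIdeal] at h
    rw [mem_fil, X_pow_dvd_iff_mem_lowIdeal]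
    have e : (f - g).1 = (f + -g).1 - (g + -g).1 := by
      rw [← sub_eq_add_neg, add_neg_cancel, zero_val, sub_zero]
    rw [e]
    refine subst_pair_sub_mem (τ := Unit) f.2 (-g).2 g.2 (-g).2 h ?_ _
    rw [sub_self]; exact zero_mem _

theorem mem_fil_succ {N : ℕ} {f : Curve p n} :
    f ∈ fil p n (N + 1) ↔ f ∈ fil p n N ∧ PowerSeries.coeff N f.1 = 0 := by
  simp only [mem_fil, PowerSeries.X_pow_dvd_iff]
  constructor
  · exact fun h => ⟨fun m hm => h m (by omega), h N (by omega)⟩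
  · rintro ⟨h, h'⟩ m hm
    obtain hm | rfl : m < N ∨ m = N := by omega
    · exact h m hm
    · exact h'

/-- Since leading exponents are powers of `p`, an order of vanishing above `p^M` is at least
`p^{M+1}`. -/
theorem IsEndo.mem_fil_pow_succ {f : Curve p n} (hf : f.IsEndo) {M : ℕ}
    (h : f ∈ fil p n (p ^ M + 1)) : f ∈ fil p n (p ^ (M + 1)) := by
  have key : ∀ N, N < p ^ (M + 1) → f ∈ fil p n (N + 1) := by
    intro N hN
    induction N with
    | zero => exact mem_fil_one f
    | succ N ih =>
      by_cases hNM : N + 1 ≤ p ^ M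
      · exact fil_anti (by omega) h
      have hf' := ih (by omega)
      refine mem_fil_succ.2 ⟨hf', hf.coeff_eq_zero hf' N.succ_ne_zero ?_⟩
      intro i hi
      rw [hi] at hN hNM
      have h1 := (Nat.pow_lt_pow_iff_right hp.out.one_lt).1 hN
      have h2 := (Nat.pow_le_pow_iff_right hp.out.one_lt).not.1 hNM
      omega
  have hpos : 0 < p ^ (M + 1) := pow_pos hp.out.pos _
  have := key (p ^ (M + 1) - 1) (by omega)
  rwa [Nat.sub_add_cancel hpos] at this

theorem teichmuller_smul_val (c : Fq p n) (f : Curve p n) :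
    (WittVector.teichmuller p c • f).1 = PowerSeries.C c * f.1 := by
  change (mulSeries _).subst f.1 = _
  rw [mulSeries_teichmuller, PowerSeries.subst_mul f.hasSubst, PowerSeries.subst_X f.hasSubst,
    PowerSeries.subst_C]
  rfl

theorem S_mem_fil (m : ℕ) : S p n m ∈ fil p n (p ^ m) := dvd_rfl

theorem S_comp_mem_fil {N : ℕ} {f : Curve p n} (m : ℕ) :
    (S p n m).comp f ∈ fil p n (p ^ m * N) ↔ f ∈ fil p n N := by
  rw [mem_fil, mem_fil, S_comp_val, mul_comm, pow_mul]
  exact UniqueFactorizationMonoid.pow_dvd_pow_iff_dvd (pow_ne_zero _ hp.out.ne_zero)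

theorem pow_smul_eq (K : ℕ) (f : Curve p n) :
    (p : W p n) ^ K • f = (S p n (n * K)).comp f := by
  induction K with
  | zero => rw [pow_zero, one_smul, mul_zero, S_zero, id_comp]
  | succ K ih => rw [pow_succ', mul_smul, ih, natCast_smul, ← comp_assoc, ← S_add, Nat.mul_succ,
      add_comm]

theorem pow_smul_S (K m : ℕ) : (p : W p n) ^ K • S p n m = S p n (n * K + m) := by
  rw [pow_smul_eq, S_add]

theorem smul_mem_fil_of_dvd {K : ℕ} {a : W p n} (h : (p : W p n) ^ K ∣ a) (f : Curve p n) :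
    a • f ∈ fil p n (p ^ (n * K)) := by
  obtain ⟨b, rfl⟩ := h
  rw [mul_smul, pow_smul_eq]
  have := (S_comp_mem_fil (n * K)).2 (mem_fil_one (b • f))
  rwa [mul_one] at this

section Expansion

/-- The remainders in the expansion of a curve in terms of the `[c] ∘ S^m`. -/
noncomputable def remainder (f : Curve p n) : ℕ → Curve p n
  | 0 => f
  | m + 1 => remainder f m -
      WittVector.teichmuller p (PowerSeries.coeff (p ^ m) (remainder f m).1) • S p n m

theorem IsEndo.remainder {f : Curve p n} (hf : f.IsEndo) (m : ℕ) : (f.remainder m).IsEndo := by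
  induction m with
  | zero => exact hf
  | succ m ih => exact ih.sub ((S_isEndo m).smul _)

theorem sub_teichmuller_smul_S_mem {f : Curve p n} {m : ℕ} (hf : f ∈ fil p n (p ^ m)) :
    f - WittVector.teichmuller p (PowerSeries.coeff (p ^ m) f.1) • S p n m ∈
      fil p n (p ^ m + 1) := by
  rw [sub_mem_fil, teichmuller_smul_val, S_val, PowerSeries.X_pow_dvd_iff]
  intro k hk
  rw [map_sub, PowerSeries.coeff_C_mul, PowerSeries.coeff_X_pow]
  split_ifs with h
  · rw [h]; simp
  · rw [PowerSeries.X_pow_dvd_iff.1 hf k (by omega)]; simp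

/-- Subtracting `[c] S^m` removes the term of degree `p^m` and leaves an endomorphism, whose order
then jumps to the next power of `p`. -/
theorem IsEndo.remainder_mem {f : Curve p n} (hf : f.IsEndo) (m : ℕ) :
    f.remainder m ∈ fil p n (p ^ m) := by
  induction m with
  | zero => rw [pow_zero]; exact mem_fil_one _
  | succ m ih => exact (hf.remainder (m + 1)).mem_fil_pow_succ (sub_teichmuller_smul_S_mem ih)

theorem formalSum_eq (e : ℕ → Fq p n) (M : ℕ) :
    formalSum (honda p n) (fun m => PowerSeries.C (e m) * PowerSeries.X ^ p ^ m) M =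
      (∑ m ∈ Finset.range M, WittVector.teichmuller p (e m) • S p n m).1 := by
  induction M with
  | zero => rfl
  | succ M ih =>
    rw [formalSum, ih, Finset.sum_range_succ, add_val, teichmuller_smul_val, S_val]

theorem isHondaExpansion_iff {f : Curve p n} {e : ℕ → Fq p n} : IsHondaExpansion f.1 e ↔
    ∀ M, f - ∑ m ∈ Finset.range M, WittVector.teichmuller p (e m) • S p n m ∈
      fil p n (p ^ M) := by
  simp only [IsHondaExpansion, formalSum_eq, sub_mem_fil]

theorem IsEndo.exists_expansion {f : Curve p n} (hf : f.IsEndo) :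
    ∃ e, IsHondaExpansion f.1 e := by
  refine ⟨fun m => PowerSeries.coeff (p ^ m) (f.remainder m).1, isHondaExpansion_iff.2 fun M => ?_⟩
  convert hf.remainder_mem M using 1
  induction M with
  | zero => simp [Curve.remainder]
  | succ M ih => rw [Finset.sum_range_succ, ← sub_sub, ih, Curve.remainder]

theorem IsEndo.isHondaExpansion {f : Curve p n} (hf : f.IsEndo) :
    IsHondaExpansion f.1 (hondaCoeff f.1) := Classical.epsilon_spec hf.exists_expansion

theorem IsEndo.hondaCoeff_zero {f : Curve p n} (hf : f.IsEndo) :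
    hondaCoeff f.1 0 = PowerSeries.coeff 1 f.1 := by
  have h := PowerSeries.X_pow_dvd_iff.1 (hf.isHondaExpansion 1) 1
    (by rw [pow_one]; exact hp.out.one_lt)
  rw [formalSum_eq, Finset.sum_range_one, teichmuller_smul_val, S_val, map_sub, sub_eq_zero] at h
  rw [h]
  simp

end Expansion

section Coordinates

/-- A Witt vector with coordinates `x_i` is the sum of the `p^i [x_i^{1/p^i}]`. The powers in the
definition of `wittCoeff` cancel these roots. -/
theorem dvd_wittCoeff_sub (f : (Fq p n)⟦X⟧) (j K : ℕ) : (p : W p n) ^ K ∣ wittCoeff f j -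
    ∑ i ∈ Finset.range K, WittVector.teichmuller p (hondaCoeff f (n * i + j)) * (p : W p n) ^ i := by
  rcases K with _ | K
  · simp
  have h := WittVector.dvd_sub_sum_teichmuller_iterateFrobeniusEquiv_coeff (wittCoeff f j) K
  rw [Nat.range_succ_eq_Iic]
  convert h using 5 with i _
  have : ∀ (i : ℕ) (x : Fq p n), ((frobeniusEquiv (Fq p n) p).symm ^ i) (x ^ p ^ i) = x := by
    intro i x
    induction i with
    | zero => simp
    | succ i ih =>
      rw [pow_succ, RingAut.mul_apply, pow_succ, pow_mul]
      have : (frobeniusEquiv (Fq p n) p).symm ((x ^ p ^ i) ^ p) = x ^ p ^ i :=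
        (frobeniusEquiv (Fq p n) p).symm_apply_apply _
      rw [this, ih]
  exact (this i _).symm

/-- The coordinates of an endomorphism in the basis `1, S, …, S^{n-1}`. -/
theorem IsEndo.eq_sum {f : Curve p n} (hf : f.IsEndo) :
    f = ∑ j : Fin n, wittCoeff f.1 j • S p n j := by
  rw [← sub_eq_zero]
  refine eq_zero_of_mem_fil fun N => ?_
  have hn : 0 < n := NeZero.pos n
  refine fil_anti (N := p ^ (n * N)) ?_ ?_
  · exact (Nat.le_mul_of_pos_left N hn).trans (Nat.lt_pow_self hp.out.one_lt).le
  have h1 := isHondaExpansion_iff.1 hf.isHondaExpansion (n * N)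
  -- The exponents are written as `m = n i + j` with `j < n`, and `S^{ni}` acts as `p^i`.
  have h2 : ∑ m ∈ Finset.range (n * N), WittVector.teichmuller p (hondaCoeff f.1 m) • S p n m =
      ∑ j : Fin n, (∑ i ∈ Finset.range N, WittVector.teichmuller p (hondaCoeff f.1 (n * i + j)) *
        (p : W p n) ^ i) • S p n j := by
    clear h1
    induction N with
    | zero => simp
    | succ N ih =>
      rw [Nat.mul_succ, Finset.sum_range_add, ih]
      simp only [Finset.sum_range_succ _ N, add_smul, Finset.sum_add_distrib]
      congr 1
      rw [Finset.sum_range]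
      refine Finset.sum_congr rfl fun j _ => ?_
      rw [mul_smul, pow_smul_S]
  rw [h2] at h1
  rw [← sub_add_sub_cancel]
  refine Submodule.add_mem _ h1 ?_
  rw [← Finset.sum_sub_distrib]
  refine Submodule.sum_mem _ fun j _ => ?_
  rw [← sub_smul]
  refine smul_mem_fil_of_dvd ?_ _
  rw [dvd_sub_comm]
  exact dvd_wittCoeff_sub f.1 j N

/-- Quantitative independence of `1, S, …, S^{n-1}`. -/
theorem pow_dvd_of_sum_mem_fil {K : ℕ} {a : Fin n → W p n}
    (h : ∑ j, a j • S p n j ∈ fil p n (p ^ (n * K))) (j : Fin n) : (p : W p n) ^ K ∣ a j := by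
  induction K generalizing a j with
  | zero => simp
  | succ K ih =>
    have hp0 : ∀ j : Fin n, (a j).coeff 0 = 0 := by
      intro j
      induction j using WellFoundedLT.induction with
      | _ j hj =>
      have hb : ∀ i, ∃ b, a i = WittVector.teichmuller p ((a i).coeff 0) + (p : W p n) * b := by
        intro i
        obtain ⟨b, hb⟩ := W.natCast_dvd_iff.2
          (show (a i - WittVector.teichmuller p ((a i).coeff 0)).coeff 0 = 0 by
            change WittVector.constantCoeff (a i - WittVector.teichmuller p ((a i).coeff 0)) = 0
            rw [map_sub, sub_eq_zero]
            simp)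
        exact ⟨b, by rw [← hb, add_sub_cancel]⟩
      -- No other summand contributes to the coefficient of `x^{p^j}`. For `i < j` the scalar is
      -- already divisible by `p`, so the order is at least `p^n`. For `i > j` the order is at least
      -- `p^i`.
      have hmem : ∀ i ∈ Finset.univ.erase j, a i • S p n i ∈ fil p n (p ^ (j : ℕ) + 1) := by
        intro i hi
        rcases lt_or_gt_of_ne (Finset.ne_of_mem_erase hi) with hij | hij
        · refine fil_anti ?_ (smul_mem_fil_of_dvd (K := 1) ?_ _)
          · rw [mul_one]
            exact Nat.pow_lt_pow_right hp.out.one_lt j.2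
          · rw [pow_one]
            exact W.natCast_dvd_iff.2 (hj i hij)
        · refine Submodule.smul_mem _ _ (fil_anti ?_ (S_mem_fil _))
          exact Nat.pow_lt_pow_right hp.out.one_lt hij
      have h1 : a j • S p n j ∈ fil p n (p ^ (j : ℕ) + 1) := by
        rw [← Finset.add_sum_erase _ _ (Finset.mem_univ j)] at h
        refine (Submodule.add_mem_iff_left _ (Submodule.sum_mem _ hmem)).1 (fil_anti ?_ h)
        refine Nat.pow_lt_pow_right hp.out.one_lt (j.2.trans_le ?_)
        exact Nat.le_mul_of_pos_right n K.succ_pos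
      obtain ⟨b, hb⟩ := hb j
      have h2 : WittVector.teichmuller p ((a j).coeff 0) • S p n j ∈ fil p n (p ^ (j : ℕ) + 1) := by
        rw [hb, add_smul] at h1
        refine (Submodule.add_mem_iff_left _ ?_).1 h1
        refine fil_anti ?_ (smul_mem_fil_of_dvd (K := 1) ?_ _)
        · rw [mul_one]
          exact Nat.pow_lt_pow_right hp.out.one_lt j.2
        · rw [pow_one]
          exact dvd_mul_right _ _
      have h3 := (mem_fil_succ.1 h2).2
      rw [teichmuller_smul_val, S_val] at h3
      simpa using h3
    -- Now all `a_j` are divisible by `p`, which acts as `S^n`. Cancelling it divides the order of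
    -- vanishing by `p^n`, and the induction continues with the quotients `b_j`.
    choose b hb using fun j => W.natCast_dvd_iff.2 (hp0 j)
    have : ∑ j, a j • S p n j = (S p n n).comp (∑ j, b j • S p n j) := by
      rw [← natCast_smul, Finset.smul_sum]
      exact Finset.sum_congr rfl fun j _ => by rw [hb, mul_smul]
    rw [this, Nat.mul_succ, add_comm, pow_add, S_comp_mem_fil] at h
    rw [hb, pow_succ']
    exact mul_dvd_mul_left _ (ih h j)

theorem eq_zero_of_sum_eq_zero {a : Fin n → W p n} (h : ∑ j, a j • S p n j = 0) : a = 0 := by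
  funext j
  have : ∀ K, (p : W p n) ^ K ∣ a j := fun K => pow_dvd_of_sum_mem_fil (by rw [h]; exact zero_mem _) j
  ext i
  rw [W.pow_dvd_iff.1 (this (i + 1)) i i.lt_succ_self]
  exact (WittVector.zero_coeff p _ i).symm

end Coordinates
end Curve

/-! ### The subring `ℤ_p` of `𝕎` -/

section Frobenius
variable {p n : ℕ} [hp : Fact p.Prime] [NeZero n]

theorem exists_algebraMap_of_pow_eq {c : Fq p n} (h : c ^ p = c) :
    ∃ b : ZMod p, algebraMap (ZMod p) (Fq p n) b = c := by
  have hs := FiniteField.splits_X_pow_card_sub_X (K := ZMod p) p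
  rw [ZMod.card, Algebra.algebraMap_self, Polynomial.map_id] at hs
  refine hs.mem_range_of_isRoot (i := algebraMap (ZMod p) (Fq p n)) ?_ ?_
  · exact FiniteField.X_pow_card_sub_X_ne_zero _ hp.out.one_lt
  · simp [Polynomial.IsRoot.def, h]

theorem toW_injective : Function.Injective (toW p n) :=
  (WittVector.map_injective _ (algebraMap (ZMod p) (Fq p n)).injective).comp
    (WittVector.equiv p).symm.injective

/-- Frobenius raises the coordinates to the `p`-th power, so the coordinates of a fixed vector lie
in `𝔽_p`. Without this the junk value of `ofW` outside `ℤ_p` would be possible. -/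
theorem toW_ofW {a : W p n} (h : WittVector.frobenius a = a) : toW p n (ofW p n a) = a := by
  refine Function.invFun_eq (f := toW p n) ?_
  have h' : ∀ i, ∃ b : ZMod p, algebraMap (ZMod p) (Fq p n) b = a.coeff i := fun i =>
    exists_algebraMap_of_pow_eq (by rw [← WittVector.coeff_frobenius_charP, h])
  choose b hb using h'
  refine ⟨WittVector.equiv p (WittVector.mk p b), ?_⟩
  ext i
  change (WittVector.map _ ((WittVector.equiv p).symm (WittVector.equiv p _))).coeff i = _
  rw [RingEquiv.symm_apply_apply, WittVector.map_coeff, ← hb, WittVector.coeff_mk]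

theorem pow_dvd_toW {x : ℤ_[p]} {K : ℕ} : (p : W p n) ^ K ∣ toW p n x ↔ (p : ℤ_[p]) ^ K ∣ x := by
  constructor
  · intro h
    have h1 : (p : WittVector p (ZMod p)) ^ K ∣ (WittVector.equiv p).symm x := by
      rw [← Ideal.mem_span_singleton, WittVector.mem_span_p_pow_iff_le_coeff_eq_zero]
      intro m hm
      have := W.pow_dvd_iff.1 h m hm
      change (WittVector.map _ ((WittVector.equiv p).symm x)).coeff m = 0 at this
      rw [WittVector.map_coeff] at this
      exact (map_eq_zero _).1 this
    have := map_dvd (WittVector.equiv p) h1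
    rwa [RingEquiv.apply_symm_apply, map_pow, map_natCast] at this
  · intro h
    have := map_dvd (toW p n) h
    rwa [map_pow, map_natCast] at this

theorem map_toW (σ : Gal p n) (x : ℤ_[p]) :
    WittVector.map (σ : Fq p n →+* Fq p n) (toW p n x) = toW p n x := by
  ext i
  rw [WittVector.map_coeff]
  change σ ((WittVector.map _ ((WittVector.equiv p).symm x)).coeff i) = _
  rw [WittVector.map_coeff, σ.commutes]
  rfl

end Frobenius

/-! ### The matrix of right multiplication and its determinant -/

namespace Curve
variable {p n : ℕ} [hp : Fact p.Prime] [NeZero n]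

theorem S_comp_smul (m : ℕ) (a : W p n) (g : Curve p n) :
    (S p n m).comp (a • g) = (WittVector.frobenius^[m] a) • (S p n m).comp g := by
  induction m with
  | zero => rw [S_zero, id_comp, id_comp, Function.iterate_zero_apply]
  | succ m ih =>
    have h1 (a : W p n) (g : Curve p n) :
        (S p n 1).comp (a • g) = WittVector.frobenius a • (S p n 1).comp g := by
      have : ofW a = a • Curve.id p n := by rw [smul_def, comp_id]
      rw [smul_def, ← comp_assoc, S_comp, this, mapCoeff_smul, ← S_zero, mapCoeff_S, S_zero,
        WittVector.frobenius_eq_map_frobenius, smul_def, smul_def, comp_id, comp_assoc]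
    rw [add_comm, S_add, comp_assoc, ih, h1, comp_assoc, add_comm,
      Function.iterate_succ_apply']

theorem IsEndo.comp_sum {f : Curve p n} (hf : f.IsEndo) {ι : Type*} (s : Finset ι)
    (g : ι → Curve p n) : f.comp (∑ i ∈ s, g i) = ∑ i ∈ s, f.comp (g i) :=
  map_sum (compLeft hf) g s

theorem sum_smul_comp {ι : Type*} (s : Finset ι) (a : ι → W p n) (f : ι → Curve p n)
    (g : Curve p n) : (∑ i ∈ s, a i • f i).comp g = ∑ i ∈ s, a i • (f i).comp g := by
  rw [← compRight_apply, map_sum]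
  exact Finset.sum_congr rfl fun i _ => by rw [map_smul, compRight_apply]

/-- The columns of `A(f)` are the coordinates of the `S^j f`. -/
theorem IsEndo.S_comp_eq {f : Curve p n} (hf : f.IsEndo) (j : Fin n) :
    (S p n j).comp f = ∑ i, detMatrix f.1 i j • S p n i := by
  conv_lhs => rw [hf.eq_sum]
  -- The term `a_k S^k` of `f` contributes to row `k + j` modulo `n`. On wrapping around, `S^n = p`
  -- produces the factor `p` of the entries above the diagonal.
  rw [(S_isEndo _).comp_sum, ← Equiv.sum_comp (Equiv.addRight j) fun i => detMatrix f.1 i j • S p n i]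
  refine Finset.sum_congr rfl fun k _ => ?_
  rw [S_comp_smul, ← S_add, Equiv.coe_addRight, detMatrix, Fin.val_add]
  have hk := k.2
  have hj := j.2
  by_cases h : (k : ℕ) + j < n
  · rw [Nat.mod_eq_of_lt h, if_pos (by omega), Nat.add_sub_cancel, add_comm (j : ℕ)]
  · have h' : ((k : ℕ) + j) % n = k + j - n := by
      rw [Nat.mod_eq_sub_mod (by omega), Nat.mod_eq_of_lt (by omega)]
    have e (a : W p n) (m : ℕ) : ((p : W p n) * a) • S p n m = a • S p n (n + m) := by
      rw [mul_comm, mul_smul, natCast_smul, ← S_add]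
    rw [h', if_neg (by omega), e]
    rw [show n + ((k : ℕ) + j - n) = j + k by omega, Nat.add_sub_cancel_left]

theorem sum_smul_S_injective {a b : Fin n → W p n}
    (h : ∑ j, a j • S p n j = ∑ j, b j • S p n j) : a = b := by
  rw [← sub_eq_zero]
  refine eq_zero_of_sum_eq_zero ?_
  rw [← sub_eq_zero, ← Finset.sum_sub_distrib] at h
  rw [← h]
  exact Finset.sum_congr rfl fun j _ => by rw [Pi.sub_apply, sub_smul]

theorem IsEndo.detMatrix_eq {f : Curve p n} (hf : f.IsEndo) {B : Matrix (Fin n) (Fin n) (W p n)}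
    (h : ∀ j : Fin n, (S p n j).comp f = ∑ i, B i j • S p n i) : detMatrix f.1 = B := by
  ext1 i j
  exact congrFun (sum_smul_S_injective (a := fun i => detMatrix f.1 i j) (b := fun i => B i j)
    (by rw [← hf.S_comp_eq, h])) i

/-- Right multiplication by `f g` is right multiplication by `f` followed by that by `g`, and both
are left `𝕎`-linear. This reverses the order of the factors. -/
theorem IsEndo.detMatrix_comp {f g : Curve p n} (hf : f.IsEndo) (hg : g.IsEndo) :
    detMatrix (f.comp g).1 = detMatrix g.1 * detMatrix f.1 := by
  refine (hf.comp hg).detMatrix_eq fun j => ?_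
  rw [← comp_assoc, hf.S_comp_eq, sum_smul_comp]
  simp_rw [hg.S_comp_eq, Finset.smul_sum, smul_smul, Matrix.mul_apply, Finset.sum_smul]
  rw [Finset.sum_comm]
  simp_rw [mul_comm]

theorem IsEndo.mapCoeff {f : Curve p n} (hf : f.IsEndo) (σ : Fq p n →+* Fq p n) :
    (mapCoeff σ f).IsEndo := by
  have := IsHom.map σ hf
  rwa [honda_map] at this

theorem IsEndo.detMatrix_mapCoeff {f : Curve p n} (hf : f.IsEndo) (σ : Fq p n →+* Fq p n) :
    detMatrix (Curve.mapCoeff σ f).1 = (detMatrix f.1).map (WittVector.map σ) := by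
  refine (hf.mapCoeff σ).detMatrix_eq fun j => ?_
  rw [← mapCoeff_S σ j, ← mapCoeff_comp, hf.S_comp_eq, map_sum]
  exact Finset.sum_congr rfl fun i _ => by rw [mapCoeff_smul, mapCoeff_S, Matrix.map_apply]

theorem id_isEndo : (Curve.id p n).IsEndo := IsHom.id _

theorem detMatrix_id : detMatrix (Curve.id p n).1 = 1 := by
  refine id_isEndo.detMatrix_eq fun j => ?_
  rw [comp_id, Finset.sum_eq_single j]
  · rw [Matrix.one_apply_eq, one_smul]
  · intro i _ hi
    rw [Matrix.one_apply_ne hi, zero_smul]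
  · simp

theorem detMatrix_S_pow (m : ℕ) : detMatrix (S p n m).1 = detMatrix (S p n 1).1 ^ m := by
  induction m with
  | zero => rw [S_zero, detMatrix_id, pow_zero]
  | succ m ih => rw [S_add, (S_isEndo m).detMatrix_comp (S_isEndo 1), ih, pow_succ']

theorem detMatrix_S_n : detMatrix (S p n n).1 = (p : W p n) • 1 := by
  refine (S_isEndo n).detMatrix_eq fun j => ?_
  rw [← S_add, add_comm, S_add, ← natCast_smul, Finset.sum_eq_single j]
  · rw [Matrix.smul_apply, Matrix.one_apply_eq, smul_eq_mul, mul_one]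
  · intro i _ hi
    rw [Matrix.smul_apply, Matrix.one_apply_ne hi, smul_zero, zero_smul]
  · simp

/-- The `n`-th power of `A(S)` is `A(S^n) = p`, whose determinant `p^n` is nonzero. -/
theorem det_S_ne_zero : (detMatrix (S p n 1).1).det ≠ 0 := by
  intro h
  have := congrArg Matrix.det ((detMatrix_S_pow (p := p) (n := n) n).symm.trans detMatrix_S_n)
  rw [Matrix.det_pow, h, zero_pow (NeZero.ne n), Matrix.det_smul, Matrix.det_one, mul_one] at this
  exact pow_ne_zero _ (Nat.cast_ne_zero.2 hp.out.ne_zero) this.symm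

/-- Taking determinants in `S f = f^φ S` and cancelling `det A(S)` leaves `det A(f) = φ(det A(f))`.
-/
theorem IsEndo.frobenius_det {f : Curve p n} (hf : f.IsEndo) :
    WittVector.frobenius (detMatrix f.1).det = (detMatrix f.1).det := by
  have h := congrArg (fun g : Curve p n => (detMatrix g.1).det) (S_comp f)
  simp only [(S_isEndo 1).detMatrix_comp hf, (hf.mapCoeff _).detMatrix_comp (S_isEndo 1),
    hf.detMatrix_mapCoeff, Matrix.det_mul, mul_comm _ (detMatrix (S p n 1).1).det] at h
  rw [WittVector.frobenius_eq_map_frobenius, RingHom.map_det]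
  exact (mul_left_cancel₀ det_S_ne_zero h).symm

theorem r_eq : r p n = ∑ j : Fin n, p ^ (j : ℕ) := by
  rw [r, ← Nat.geomSum_eq hp.out.two_le, Finset.sum_range]

/-- Modulo `p` the entries above the diagonal vanish and the diagonal entries are the conjugates
`f'(0)^{p^j}` for `0 ≤ j < n`, whose exponents have sum `r(n)`. -/
theorem IsEndo.constantCoeff_det {f : Curve p n} (hf : f.IsEndo) :
    red p n (detMatrix f.1).det = PowerSeries.coeff 1 f.1 ^ r p n := by
  rw [RingHom.map_det, Matrix.det_of_isLowerTriangular]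
  · rw [r_eq, ← Finset.prod_pow_eq_pow_sum]
    refine Finset.prod_congr rfl fun j _ => ?_
    rw [RingHom.mapMatrix_apply, Matrix.map_apply, detMatrix, if_pos le_rfl, Nat.sub_self]
    change (WittVector.frobenius^[(j : ℕ)] (wittCoeff f.1 0)).coeff 0 = _
    rw [WittVector.iterate_frobenius_coeff, wittCoeff, WittVector.coeff_mk, pow_zero, pow_one,
      mul_zero, add_zero, hf.hondaCoeff_zero]
  · intro i j hij
    have hij : (i : ℕ) < j := hij
    rw [RingHom.mapMatrix_apply, Matrix.map_apply, detMatrix, if_neg (by omega), map_mul,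
      map_natCast, CharP.cast_eq_zero, zero_mul]

/-- Quantitative independence turns closeness of the power series into `p`-adic closeness of the
coordinates, hence of the matrices. This is the continuity of the determinant. -/
theorem IsEndo.dvd_det_sub {f g : Curve p n} (hf : f.IsEndo) (hg : g.IsEndo) {K : ℕ}
    (h : PowerSeries.X ^ p ^ (n * K) ∣ f.1 - g.1) :
    (p : W p n) ^ K ∣ (detMatrix f.1).det - (detMatrix g.1).det := by
  have e : f - g = ∑ j : Fin n, (wittCoeff f.1 j - wittCoeff g.1 j) • S p n j := by
    conv_lhs => rw [hf.eq_sum, hg.eq_sum]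
    rw [← Finset.sum_sub_distrib]
    exact Finset.sum_congr rfl fun j _ => (sub_smul _ _ _).symm
  rw [← sub_mem_fil, e] at h
  have hw (i : ℕ) (hi : i < n) (j : ℕ) : (p : W p n) ^ K ∣
      WittVector.frobenius^[j] (wittCoeff f.1 i) - WittVector.frobenius^[j] (wittCoeff g.1 i) := by
    have := W.pow_dvd_iff.1 (pow_dvd_of_sum_mem_fil h ⟨i, hi⟩)
    rw [← iterate_map_sub, W.pow_dvd_iff]
    intro m hm
    rw [WittVector.iterate_frobenius_coeff, this m hm, zero_pow (pow_ne_zero _ hp.out.ne_zero)]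
  rw [← Ideal.mem_span_singleton, ← Ideal.Quotient.eq, RingHom.map_det, RingHom.map_det]
  congr 1
  ext1 i j
  rw [RingHom.mapMatrix_apply, RingHom.mapMatrix_apply, Matrix.map_apply, Matrix.map_apply,
    Ideal.Quotient.eq, Ideal.mem_span_singleton, detMatrix, detMatrix]
  have hi := i.2
  have hj := j.2
  split_ifs
  · exact hw _ (by omega) _
  · rw [← mul_sub]
    exact (hw _ (by omega) _).mul_left _

end Curve

/-! ### The homomorphisms `det`, `τ` and `θ` on `𝔾_n` -/

section Det
variable {p n : ℕ} [hp : Fact p.Prime] [NeZero n]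

/-- The curve underlying an element of `𝔾_n`. -/
noncomputable def Stab.curve (γ : Stab p n) : Curve p n := ⟨γ.f, γ.isHom.1⟩

theorem Stab.curve_isEndo (γ : Stab p n) : γ.curve.IsEndo := by
  have := γ.isHom
  rwa [honda_map] at this

theorem Stab.curve_mul (γ δ : Stab p n) :
    (γ * δ).curve = γ.curve.comp (Curve.mapCoeff (γ.σ : Fq p n →+* Fq p n) δ.curve) := rfl

theorem toW_det (γ : Stab p n) : toW p n (det γ) = (detMatrix γ.f).det :=
  toW_ofW γ.curve_isEndo.frobenius_det

theorem det_one : det (1 : Stab p n) = 1 := by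
  refine toW_injective (n := n) ?_
  rw [toW_det, map_one]
  exact (congrArg Matrix.det Curve.detMatrix_id).trans Matrix.det_one

/-- In the product the second series is conjugated by the Galois component of `γ`. This conjugates
its determinant, which lies in `ℤ_p` and so does not change. -/
theorem det_mul (γ δ : Stab p n) : det (γ * δ) = det γ * det δ := by
  refine toW_injective (n := n) ?_
  rw [map_mul, toW_det, toW_det, ← map_toW γ.σ (det δ), toW_det]
  change (detMatrix (γ * δ).curve.1).det = (detMatrix γ.curve.1).det * _
  rw [γ.curve_mul, γ.curve_isEndo.detMatrix_comp (δ.curve_isEndo.mapCoeff _),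
    δ.curve_isEndo.detMatrix_mapCoeff, Matrix.det_mul, mul_comm, RingHom.map_det]
  rfl

variable (p n) in
/-- The determinant as a homomorphism. -/
noncomputable def detHom : Stab p n →* ℤ_[p] where
  toFun := det
  map_one' := det_one
  map_mul' := det_mul

theorem isUnit_det (γ : Stab p n) : IsUnit (det γ) := (Group.isUnit γ).map (detHom p n)

/-- The leading coefficient `f'(0)`. -/
noncomputable def Stab.lead (γ : Stab p n) : Fq p n := PowerSeries.coeff 1 γ.f

/-- This power of `f'(0)` is the residue of a determinant that is fixed by Frobenius. -/
theorem Stab.lead_pow (γ : Stab p n) : (γ.lead ^ r p n) ^ p = γ.lead ^ r p n := by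
  have h : red p n (detMatrix γ.f).det = γ.lead ^ r p n := γ.curve_isEndo.constantCoeff_det
  have h' : WittVector.frobenius (detMatrix γ.f).det = (detMatrix γ.f).det :=
    γ.curve_isEndo.frobenius_det
  rw [← h]
  conv_rhs => rw [← h']
  exact (WittVector.coeff_frobenius_charP p _ 0).symm

theorem Stab.lead_mul (γ δ : Stab p n) : (γ * δ).lead = γ.lead * γ.σ δ.lead := by
  rw [Stab.lead, Stab.mul_f, Stab.coeff_one_subst (δ.isHom.map _).1, PowerSeries.coeff_map]
  rfl

theorem Stab.map_lead_pow (γ : Stab p n) (σ : Gal p n) : σ (γ.lead ^ r p n) = γ.lead ^ r p n := by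
  obtain ⟨b, hb⟩ := exists_algebraMap_of_pow_eq γ.lead_pow
  rw [← hb, σ.commutes]

theorem frobenius_teichmuller {c : Fq p n} (h : c ^ p = c) :
    WittVector.frobenius (WittVector.teichmuller p c) = WittVector.teichmuller p c := by
  rw [WittVector.frobenius_eq_map_frobenius, WittVector.map_teichmuller, frobenius_def, h]

/-- The Teichmüller lift of `f'(0)^{r(n)}`, as an element of `ℤ_p`. -/
noncomputable def Stab.tau (γ : Stab p n) : ℤ_[p] :=
  ofW p n (WittVector.teichmuller p (γ.lead ^ r p n))

theorem Stab.toW_tau (γ : Stab p n) :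
    toW p n γ.tau = WittVector.teichmuller p (γ.lead ^ r p n) :=
  toW_ofW (frobenius_teichmuller γ.lead_pow)

/-- The leading coefficient is only a crossed homomorphism, but its `r(n)`-th power lies in `𝔽_p`,
where the Galois group acts trivially. -/
theorem Stab.tau_mul (γ δ : Stab p n) : (γ * δ).tau = γ.tau * δ.tau := by
  refine toW_injective (n := n) ?_
  rw [map_mul, toW_tau, toW_tau, toW_tau, lead_mul, mul_pow, map_mul, ← map_pow γ.σ, map_lead_pow]

theorem Stab.tau_mul_theta (γ : Stab p n) : γ.tau * theta γ = det γ := by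
  have h : (γ.lead⁻¹ ^ r p n) ^ p = γ.lead⁻¹ ^ r p n := by
    rw [inv_pow, inv_pow, γ.lead_pow]
  refine toW_injective (n := n) ?_
  rw [theta, map_mul, map_mul, toW_tau]
  change _ * (toW p n (ofW p n (WittVector.teichmuller p (γ.lead⁻¹ ^ r p n))) * _) = _
  have h0 : γ.lead ≠ 0 := γ.isIso
  rw [toW_ofW (frobenius_teichmuller h), ← mul_assoc, ← map_mul, ← mul_pow, mul_inv_cancel₀ h0, one_pow, _root_.map_one, one_mul]

theorem Stab.isUnit_tau (γ : Stab p n) : IsUnit γ.tau :=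
  isUnit_of_mul_isUnit_left (by rw [γ.tau_mul_theta]; exact isUnit_det γ)

theorem theta_mul (γ δ : Stab p n) : theta (γ * δ) = theta γ * theta δ := by
  refine (γ * δ).isUnit_tau.mul_left_cancel ?_
  rw [Stab.tau_mul_theta, det_mul, Stab.tau_mul, ← γ.tau_mul_theta, ← δ.tau_mul_theta]
  ring

theorem dvd_det_sub_tau (γ : Stab p n) : (p : ℤ_[p]) ∣ det γ - γ.tau := by
  have h : red p n (detMatrix γ.f).det = γ.lead ^ r p n := γ.curve_isEndo.constantCoeff_det
  rw [← pow_one (p : ℤ_[p]), ← pow_dvd_toW (n := n), pow_one, W.natCast_dvd_iff]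
  change red p n (toW p n (det γ - γ.tau)) = 0
  rw [map_sub, map_sub, toW_det, h, Stab.toW_tau, sub_eq_zero]
  exact (WittVector.teichmuller_coeff_zero p _).symm

theorem dvd_theta_sub_one (γ : Stab p n) : (p : ℤ_[p]) ∣ theta γ - 1 := by
  rw [← γ.isUnit_tau.dvd_mul_left, mul_sub, γ.tau_mul_theta, mul_one]
  exact dvd_det_sub_tau γ

theorem dvd_det_sub_det {γ δ : Stab p n} {K : ℕ}
    (h : PowerSeries.X ^ p ^ (n * K) ∣ γ.f - δ.f) : (p : ℤ_[p]) ^ K ∣ det γ - det δ := by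
  rw [← pow_dvd_toW (n := n), map_sub, toW_det, toW_det]
  exact γ.curve_isEndo.dvd_det_sub δ.curve_isEndo h

end Det
open Filter Topology

/-! ### The adic topology of `E₀` -/

section Topology
variable (p n : ℕ) [hp : Fact p.Prime]

/-- The maximal ideal of `E₀`. -/
noncomputable abbrev maxIdeal : Ideal (E0 p n) := IsLocalRing.maximalIdeal (E0 p n)

variable {p n}

theorem mem_maxIdeal {x : E0 p n} : x ∈ maxIdeal p n ↔ residue p n x = 0 := by
  rw [IsLocalRing.mem_maximalIdeal, mem_nonunits_iff, not_iff_comm]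
  exact ⟨isUnit_of_residue_ne_zero, fun h => (h.map (residue p n)).ne_zero⟩

theorem natCast_mem_maxIdeal : (p : E0 p n) ∈ maxIdeal p n := by
  rw [mem_maxIdeal, map_natCast, CharP.cast_eq_zero]

theorem mem_maxIdeal_pow_of_dvd {x : E0 p n} {k : ℕ} (h : (p : E0 p n) ^ k ∣ x) :
    x ∈ maxIdeal p n ^ k :=
  Ideal.mem_of_dvd _ h (Ideal.pow_mem_pow natCast_mem_maxIdeal k)

variable (p n) in
/-- Power series whose coefficients of degree `i` are divisible by `p^{k-i}`. -/
noncomputable def filtration (k : ℕ) : Ideal (E0 p n) where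
  carrier := {x | ∀ d : Fin (n - 1) →₀ ℕ, (p : W p n) ^ (k - d.degree) ∣ MvPowerSeries.coeff d x}
  add_mem' ha hb d := by rw [map_add]; exact dvd_add (ha d) (hb d)
  zero_mem' d := by rw [map_zero]; exact dvd_zero _
  smul_mem' c x hx d := by
    classical
    rw [smul_eq_mul, MvPowerSeries.coeff_mul]
    refine Finset.dvd_sum fun q hq => (Dvd.dvd.mul_left ?_ _)
    have h := congrArg Finsupp.degree (Finset.HasAntidiagonal.mem_antidiagonal.1 hq)
    rw [map_add] at h
    exact (pow_dvd_pow _ (by omega)).trans (hx q.2)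

theorem mul_mem_filtration {j k : ℕ} {x y : E0 p n} (hx : x ∈ filtration p n j)
    (hy : y ∈ filtration p n k) : x * y ∈ filtration p n (j + k) := by
  classical
  intro d
  rw [MvPowerSeries.coeff_mul]
  refine Finset.dvd_sum fun q hq => ?_
  have h := congrArg Finsupp.degree (Finset.HasAntidiagonal.mem_antidiagonal.1 hq)
  rw [map_add] at h
  refine (pow_dvd_pow _ ?_).trans ((pow_add _ _ _).dvd.trans (mul_dvd_mul (hx q.1) (hy q.2)))
  omega

/-- The filtration is multiplicative and its first step contains the maximal ideal. As its
intersection is visibly zero, the topology is Hausdorff. -/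
theorem maxIdeal_pow_le_filtration (k : ℕ) : maxIdeal p n ^ k ≤ filtration p n k := by
  induction k with
  | zero => intro x _ d; simp
  | succ k ih =>
    rw [pow_succ]
    refine Ideal.mul_le.2 fun x hx y hy => mul_mem_filtration (ih hx) fun d => ?_
    by_cases hd : d = 0
    · subst hd
      rw [map_zero, Nat.sub_zero, pow_one, W.natCast_dvd_iff]
      exact mem_maxIdeal.1 hy
    · have : d.degree ≠ 0 := fun h => hd ((Finsupp.degree_eq_zero_iff d).1 h)
      rw [Nat.sub_eq_zero_of_le (by omega), pow_zero]
      exact one_dvd _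

theorem eq_zero_of_mem_maxIdeal_pow {x : E0 p n} (h : ∀ k, x ∈ maxIdeal p n ^ k) : x = 0 := by
  ext d i
  rw [W.pow_dvd_iff.1 (maxIdeal_pow_le_filtration _ (h (i + 1 + d.degree)) d) i (by omega),
    map_zero, WittVector.zero_coeff]

theorem hasBasis_nhds_zero :
    HasBasis (𝓝 (0 : E0 p n)) (fun _ : ℕ => True) fun k => ((maxIdeal p n ^ k : Ideal _) : Set _) :=
  (maxIdeal p n).hasBasis_nhds_zero_adic

instance : T2Space (E0 p n) := by
  refine IsTopologicalAddGroup.t2Space_of_zero_sep fun x hx => ?_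
  obtain ⟨k, hk⟩ := not_forall.1 fun h => hx (eq_zero_of_mem_maxIdeal_pow h)
  exact ⟨_, hasBasis_nhds_zero.mem_of_mem trivial, hk⟩

theorem nonarchimedeanRing_E0 : NonarchimedeanRing (E0 p n) := (maxIdeal p n).nonarchimedean

theorem tendsto_iff_maxIdeal {X : Type*} {l : Filter X} {f : X → E0 p n} {a : E0 p n} :
    Tendsto f l (𝓝 a) ↔ ∀ k, ∀ᶠ x in l, f x - a ∈ maxIdeal p n ^ k := by
  rw [← tendsto_sub_nhds_zero_iff, hasBasis_nhds_zero.tendsto_right_iff]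
  simp

theorem isClosed_maxIdeal_pow (k : ℕ) : IsClosed ((maxIdeal p n ^ k : Ideal _) : Set (E0 p n)) := by
  refine AddSubgroup.isClosed_of_isOpen (Submodule.toAddSubgroup (maxIdeal p n ^ k)) ?_
  exact AddSubgroup.isOpen_of_mem_nhds _ (g := 0) (hasBasis_nhds_zero.mem_of_mem trivial)

theorem continuous_of_dvd {X : Type*} [TopologicalSpace X] {f : X → E0 p n}
    (h : ∀ x k, ∀ᶠ y in 𝓝 x, f y - f x ∈ maxIdeal p n ^ k) : Continuous f :=
  continuous_iff_continuousAt.2 fun x => tendsto_iff_maxIdeal.2 (h x)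

/-- A unit-valued map is continuous as soon as its underlying map is. -/
theorem continuous_units {X : Type*} [TopologicalSpace X] {f : X → (E0 p n)ˣ}
    (h : Continuous fun x => (f x : E0 p n)) : Continuous f := by
  refine Units.continuous_iff.2 ⟨h, continuous_of_dvd fun x k => ?_⟩
  filter_upwards [tendsto_iff_maxIdeal.1 (h.tendsto x) k] with y hy
  have e : ((f y)⁻¹ : (E0 p n)ˣ).1 - ((f x)⁻¹ : (E0 p n)ˣ).1 =
      -(((f y)⁻¹ : (E0 p n)ˣ).1 * ((f x)⁻¹ : (E0 p n)ˣ).1 * ((f y).1 - (f x).1)) := by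
    rw [mul_sub, mul_right_comm, Units.inv_mul, mul_assoc, Units.inv_mul]
    ring
  rw [e]
  exact neg_mem (Ideal.mul_mem_left _ _ hy)

/-- Series whose terms tend to zero `p`-adically converge. -/
theorem summable_of_dvd {a : ℕ → E0 p n} {N : ℕ → ℕ}
    (h : ∀ k i, N k ≤ i → (p : E0 p n) ^ k ∣ a i) : Summable a := by
  -- The bounds `N k` need not increase with `k`, whereas the `M k` do and dominate them. The
  -- partial sums up to `M k` are then Cauchy for divisibility by `p^k`, and their coefficients
  -- converge in the complete ring `𝕎`.
  set M : ℕ → ℕ := fun k => ∑ j ∈ Finset.range (k + 1), N j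
  have hM : ∀ {j k}, j ≤ k → N j ≤ M k := fun {j k} hjk =>
    Finset.single_le_sum (f := N) (fun _ _ => Nat.zero_le _) (Finset.mem_range.2 (by omega))
  set s : ℕ → E0 p n := fun k => ∑ i ∈ Finset.range (M k), a i
  have hs : ∀ {j k : ℕ}, j ≤ k → (p : E0 p n) ^ j ∣ s k - s j := by
    intro j k hjk
    have : M j ≤ M k := Finset.sum_le_sum_of_subset (Finset.range_mono (by omega))
    change _ ∣ ∑ i ∈ Finset.range (M k), a i - ∑ i ∈ Finset.range (M j), a i
    rw [← Finset.sum_Ico_eq_sub _ this]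
    exact Finset.dvd_sum fun i hi => h j i ((hM le_rfl).trans (Finset.mem_Ico.1 hi).1)
  have hL (d : Fin (n - 1) →₀ ℕ) : ∃ L : W p n, ∀ k,
      (p : W p n) ^ k ∣ MvPowerSeries.coeff d (s k) - L := by
    obtain ⟨L, hL⟩ := IsPrecomplete.prec' (I := Ideal.span {(p : W p n)})
      (fun k => MvPowerSeries.coeff d (s k)) (fun {j k} hjk => by
        have h1 := hs hjk
        rw [← Nat.cast_pow, natCast_dvd_iff_coeff] at h1
        have h1 := h1 d
        rw [Nat.cast_pow, map_sub] at h1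
        rw [SModEq.sub_mem, smul_eq_mul, Ideal.mul_top, Ideal.span_singleton_pow,
          Ideal.mem_span_singleton, dvd_sub_comm]
        exact h1)
    refine ⟨L, fun k => ?_⟩
    have := hL k
    rwa [SModEq.sub_mem, smul_eq_mul, Ideal.mul_top, Ideal.span_singleton_pow,
      Ideal.mem_span_singleton] at this
  choose L' hL using hL
  obtain ⟨L, rfl⟩ : ∃ L : E0 p n, L' = fun d => MvPowerSeries.coeff d L := ⟨L', rfl⟩
  refine ⟨L, tendsto_iff_maxIdeal.2 fun k => ?_⟩
  filter_upwards [eventually_ge_atTop (Finset.range (M k))] with F hF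
  refine mem_maxIdeal_pow_of_dvd ?_
  have h1 : (p : E0 p n) ^ k ∣ s k - L := by
    rw [← Nat.cast_pow, natCast_dvd_iff_coeff]
    intro d
    rw [Nat.cast_pow, map_sub]
    exact hL d k
  have h2 : (p : E0 p n) ^ k ∣ ∑ i ∈ F, a i - s k := by
    change _ ∣ _ - ∑ i ∈ Finset.range (M k), a i
    rw [← Finset.sum_sdiff hF, add_sub_cancel_right]
    refine Finset.dvd_sum fun i hi => h k i ((hM le_rfl).trans ?_)
    simpa using (Finset.mem_sdiff.1 hi).2
  rw [← sub_add_sub_cancel _ (s k)]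
  exact dvd_add h2 h1

theorem pow_dvd_toE0 {x : ℤ_[p]} {k : ℕ} (h : (p : ℤ_[p]) ^ k ∣ x) :
    (p : E0 p n) ^ k ∣ toE0 p n x := by
  have := map_dvd (toE0 p n) h
  rwa [map_pow, map_natCast] at this

end Topology

/-! ### The exponential on `E₀` -/

section Exp
variable {p n : ℕ} [hp : Fact p.Prime]

theorem expCoeff_mul (i j : ℕ) :
    expCoeff p i * expCoeff p j = (i + j).choose i * expCoeff p (i + j) := by
  refine Subtype.ext ?_
  change (p : ℚ_[p]) ^ i / (i.factorial : ℚ_[p]) * ((p : ℚ_[p]) ^ j / (j.factorial : ℚ_[p])) =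
    ((i + j).choose i : ℚ_[p]) * ((p : ℚ_[p]) ^ (i + j) / ((i + j).factorial : ℚ_[p]))
  have h' : ((i + j).choose i : ℚ_[p]) * i.factorial * j.factorial = (i + j).factorial := by
    have h := Nat.add_choose_mul_factorial_mul_factorial i j
    rw [← Nat.choose_symm_add] at h
    exact_mod_cast h
  have hi : (i.factorial : ℚ_[p]) ≠ 0 := by exact_mod_cast i.factorial_ne_zero
  have hj : (j.factorial : ℚ_[p]) ≠ 0 := by exact_mod_cast j.factorial_ne_zero
  have hij : ((i + j).factorial : ℚ_[p]) ≠ 0 := by exact_mod_cast (i + j).factorial_ne_zero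
  rw [pow_add]
  field_simp
  rw [← h']
  ring

/-- By Legendre's formula `(p - 1) v(i!) < i`, so `2 v(i!) < i` for odd `p` and the valuation of
`p^i/i!` is at least `(i + 1)/2`. For `p = 2` these coefficients would not tend to zero. -/
theorem pow_dvd_expCoeff (h2 : 2 < p) {i k : ℕ} (hi0 : i ≠ 0) (hk : 2 * k ≤ i + 2) :
    (p : ℤ_[p]) ^ k ∣ expCoeff p i := by
  rw [← Ideal.mem_span_singleton, ← PadicInt.norm_le_pow_iff_mem_span_pow]
  change ‖(p : ℚ_[p]) ^ i / (i.factorial : ℚ_[p])‖ ≤ _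
  have hi : (i.factorial : ℚ_[p]) ≠ 0 := by exact_mod_cast i.factorial_ne_zero
  have h1 : (1 : ℝ) < p := by exact_mod_cast hp.out.one_lt
  rw [norm_div, Padic.norm_p_pow, Padic.norm_eq_zpow_neg_valuation hi,
    ← zpow_sub₀ (by positivity), zpow_le_zpow_iff_right₀ h1, Padic.valuation_natCast]
  have h := sub_one_mul_padicValNat_factorial_lt_of_ne_zero p hi0
  have h3 : 2 * padicValNat p i.factorial ≤ (p - 1) * padicValNat p i.factorial :=
    Nat.mul_le_mul_right _ (by omega)
  omega

theorem expP_summable (h2 : 2 < p) (x : E0 p n) :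
    Summable fun i => toE0 p n (expCoeff p i) * x ^ i := by
  refine summable_of_dvd (N := fun k => 2 * k) fun k i hi => Dvd.dvd.mul_right ?_ _
  rcases Nat.eq_zero_or_pos k with rfl | hk
  · simp
  · exact pow_dvd_toE0 (pow_dvd_expCoeff h2 (by omega) (by omega))

theorem tsum_mul_tsum_antidiagonal_uniform {R : Type*} [CommRing R] [UniformSpace R] [IsUniformAddGroup R] [NonarchimedeanRing R]
    [T2Space R] {f g : ℕ → R} (hf : Summable f) (hg : Summable g) :
    (∑' i, f i) * ∑' i, g i = ∑' k, ∑ q ∈ Finset.HasAntidiagonal.antidiagonal k, f q.1 * g q.2 :=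
  hf.tsum_mul_tsum_eq_tsum_sum_antidiagonal hg (hf.mul_of_nonarchimedean hg)

/-- The Cauchy product is available for uniform rings, and an additive topological group carries a
uniform structure that induces its topology. -/
theorem tsum_mul_tsum_antidiagonal {R : Type*} [CommRing R] [t : TopologicalSpace R] [NonarchimedeanRing R]
    [T2Space R] {f g : ℕ → R} (hf : Summable f) (hg : Summable g) :
    (∑' i, f i) * ∑' i, g i = ∑' k, ∑ q ∈ Finset.HasAntidiagonal.antidiagonal k, f q.1 * g q.2 := by
  obtain ⟨u, hu, _⟩ : ∃ u : UniformSpace R, u.toTopologicalSpace = t ∧ IsUniformAddGroup R :=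
    ⟨IsTopologicalAddGroup.rightUniformSpace R, rfl, isUniformAddGroup_of_addCommGroup⟩
  subst hu
  exact tsum_mul_tsum_antidiagonal_uniform hf hg

theorem expCoeff_mul_add_pow {R : Type*} [CommRing R] (ι : ℤ_[p] →+* R) (x y : R) (k : ℕ) :
    ι (expCoeff p k) * (x + y) ^ k = ∑ q ∈ Finset.HasAntidiagonal.antidiagonal k,
      ι (expCoeff p q.1) * x ^ q.1 * (ι (expCoeff p q.2) * y ^ q.2) := by
  rw [(Commute.all x y).add_pow', Finset.mul_sum]
  refine Finset.sum_congr rfl fun q hq => ?_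
  obtain rfl := Finset.HasAntidiagonal.mem_antidiagonal.1 hq
  rw [nsmul_eq_mul, mul_mul_mul_comm, ← map_mul, expCoeff_mul, map_mul, map_natCast]
  ring

theorem tsum_exp_add {R : Type*} [CommRing R] [TopologicalSpace R] [NonarchimedeanRing R]
    [T2Space R] (ι : ℤ_[p] →+* R) (hs : ∀ x : R, Summable fun i => ι (expCoeff p i) * x ^ i)
    (x y : R) : ∑' i, ι (expCoeff p i) * (x + y) ^ i =
      (∑' i, ι (expCoeff p i) * x ^ i) * ∑' i, ι (expCoeff p i) * y ^ i :=
  (tsum_congr fun k => expCoeff_mul_add_pow ι x y k).trans (tsum_mul_tsum_antidiagonal (hs x) (hs y)).symm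

theorem expP_add (h2 : 2 < p) (x y : E0 p n) : expP (x + y) = expP x * expP y := by
  have := nonarchimedeanRing_E0 (p := p) (n := n)
  have h := tsum_exp_add (R := E0 p n) (toE0 p n)
  unfold expP
  exact h (expP_summable h2) x y

theorem expP_zero : expP (0 : E0 p n) = 1 := by
  rw [expP, tsum_eq_single 0]
  · have : expCoeff p 0 = 1 := Subtype.ext (by simp [expCoeff])
    rw [this, map_one, pow_zero, mul_one]
  · intro i hi
    rw [zero_pow hi, mul_zero]

theorem expP_sub_mem (h2 : 2 < p) {x y : E0 p n} {k : ℕ} (h : x - y ∈ maxIdeal p n ^ k) :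
    expP x - expP y ∈ maxIdeal p n ^ k := by
  have hs := (expP_summable h2 x).hasSum.sub (expP_summable h2 y).hasSum
  refine (isClosed_maxIdeal_pow k).mem_of_tendsto hs (Eventually.of_forall fun s => ?_)
  refine Ideal.sum_mem _ fun i _ => ?_
  rw [← mul_sub]
  exact Ideal.mul_mem_left _ _ (Ideal.mem_of_dvd _ (sub_dvd_pow_sub_pow x y i) h)

theorem continuous_expP (h2 : 2 < p) : Continuous (expP : E0 p n → E0 p n) :=
  continuous_of_dvd fun x k => by
    filter_upwards [tendsto_iff_maxIdeal.1 (continuous_id.tendsto x) k] with y hy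
    exact expP_sub_mem h2 hy

variable (p n) in
/-- The exponential `x ↦ exp(px)` with values in the units. -/
noncomputable def expUnit (h2 : 2 < p) (x : E0 p n) : (E0 p n)ˣ where
  val := expP x
  inv := expP (-x)
  val_inv := by rw [← expP_add h2, add_neg_cancel, expP_zero]
  inv_val := by rw [← expP_add h2, neg_add_cancel, expP_zero]

end Exp

/-! ### The action on `E₀` -/

section Act
variable {p n : ℕ} [hp : Fact p.Prime]

/-- If `φ(x)` had residue `c ≠ 0`, then `x - [c]` would be a unit with image `φ(x) - [c]` in the
maximal ideal. So a `𝕎`-algebra endomorphism is local, and continuity is automatic. -/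
theorem algHom_mem_maxIdeal (φ : E0 p n →ₐ[W p n] E0 p n) {x : E0 p n} (hx : x ∈ maxIdeal p n) :
    φ x ∈ maxIdeal p n := by
  rw [mem_maxIdeal] at hx ⊢
  by_contra hc
  set c := residue p n (φ x)
  set t : W p n := WittVector.teichmuller p c
  have ht : residue p n (MvPowerSeries.C t) = c := by simp [residue, t]
  have h1 : IsUnit (x - MvPowerSeries.C t) := by
    refine isUnit_of_residue_ne_zero ?_
    rw [map_sub, hx, ht, zero_sub]
    exact neg_ne_zero.2 hc
  have h2 := (h1.map φ).map (residue p n)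
  have h3 : φ (MvPowerSeries.C t) = MvPowerSeries.C t := φ.commutes t
  rw [map_sub, h3, map_sub, ht, sub_self] at h2
  exact h2.ne_zero rfl

theorem act_mem_maxIdeal (γ : Stab p n) {x : E0 p n} (hx : x ∈ maxIdeal p n) :
    act γ x ∈ maxIdeal p n := by
  refine algHom_mem_maxIdeal _ ?_
  rw [mem_maxIdeal] at hx ⊢
  have : residue p n (galAct p n γ.σ x) = γ.σ (residue p n x) := by
    simp [residue, galAct]
  exact this.trans (by rw [hx, map_zero])

theorem act_mem_maxIdeal_pow (γ : Stab p n) {k : ℕ} {x : E0 p n} (hx : x ∈ maxIdeal p n ^ k) :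
    act γ x ∈ maxIdeal p n ^ k := by
  have h : maxIdeal p n ≤ (maxIdeal p n).comap (act γ) := fun x hx => act_mem_maxIdeal γ hx
  exact Ideal.le_comap_pow (act γ) k (Ideal.pow_right_mono h k hx)

theorem continuous_act (γ : Stab p n) : Continuous (act γ) :=
  continuous_of_dvd fun x k => by
    filter_upwards [tendsto_iff_maxIdeal.1 (continuous_id.tendsto x) k] with y hy
    rw [← map_sub]
    exact act_mem_maxIdeal_pow γ hy

theorem act_toE0 [NeZero n] (γ : Stab p n) (x : ℤ_[p]) : act γ (toE0 p n x) = toE0 p n x := by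
  change (lubinTate γ.f).φ (galAct p n γ.σ (MvPowerSeries.C (toW p n x))) = _
  rw [galAct, MvPowerSeries.map_C, map_toW]
  exact (lubinTate γ.f).φ.commutes _

theorem act_expP [NeZero n] (h2 : 2 < p) (γ : Stab p n) (x : E0 p n) :
    act γ (expP x) = expP (act γ x) := by
  have h := (expP_summable h2 x).hasSum.map (act γ) (continuous_act γ)
  rw [expP, ← h.tsum_eq, expP]
  refine tsum_congr fun i => ?_
  rw [Function.comp_apply, map_mul, map_pow, act_toE0]

end Act

/-! ### Powers with exponent `λ` and Teichmüller representatives -/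

section UnitPow
variable {p n : ℕ} [hp : Fact p.Prime] [NeZero n]

/-- The cofactor `∑ x^i y^{p-1-i}` of `x - y` is congruent to `p y^{p-1}`, hence to zero, modulo the
maximal ideal. -/
theorem pow_sub_pow_mem {x y : E0 p n} {j : ℕ} (hj : j ≠ 0) (h : x - y ∈ maxIdeal p n ^ j) :
    x ^ p - y ^ p ∈ maxIdeal p n ^ (j + 1) := by
  rw [← Commute.mul_geom_sum₂ (Commute.all x y) p, pow_succ]
  refine Ideal.mul_mem_mul h ?_
  have hxy : residue p n x = residue p n y := by
    have := mem_maxIdeal.1 (Ideal.pow_le_self hj h)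
    rwa [map_sub, sub_eq_zero] at this
  rw [mem_maxIdeal, map_sum]
  have : ∀ i ∈ Finset.range p, residue p n (x ^ i * y ^ (p - 1 - i)) =
      residue p n y ^ (p - 1) := by
    intro i hi
    rw [map_mul, map_pow, map_pow, hxy, ← pow_add]
    congr 1
    have := Finset.mem_range.1 hi
    omega
  rw [Finset.sum_congr rfl this, Finset.sum_const, Finset.card_range, nsmul_eq_mul,
    CharP.cast_eq_zero, zero_mul]

theorem pow_pow_sub_mem {x y : E0 p n} (h : x - y ∈ maxIdeal p n) (k : ℕ) :
    x ^ p ^ k - y ^ p ^ k ∈ maxIdeal p n ^ (k + 1) := by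
  induction k with
  | zero => simpa using h
  | succ k ih =>
    rw [pow_succ p k, pow_mul, pow_mul]
    exact pow_sub_pow_mem k.succ_ne_zero ih

theorem unitPow_eq {x y : (E0 p n)ˣ} {a : Zfrak p n} (h : ∀ k : ℕ,
    (y : E0 p n) - (x : E0 p n) ^ (a.1 k).val ∈ maxIdeal p n ^ (k + 1)) : unitPow x a = y := by
  have h' := Classical.epsilon_spec (p := fun y : (E0 p n)ˣ => ∀ k : ℕ,
    (y : E0 p n) - (x : E0 p n) ^ (a.1 k).val ∈ maxIdeal p n ^ (k + 1)) ⟨y, h⟩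
  refine Units.ext (sub_eq_zero.1 (eq_zero_of_mem_maxIdeal_pow fun k => ?_))
  have := sub_mem (h' k) (h k)
  rw [sub_sub_sub_cancel_right] at this
  exact Ideal.pow_le_pow_right k.le_succ this

/-- The Teichmüller representative of the residue class of `x`. -/
noncomputable def teich (x : E0 p n) : E0 p n :=
  MvPowerSeries.C (WittVector.teichmuller p (residue p n x))

theorem sub_teich_mem (x : E0 p n) : x - teich x ∈ maxIdeal p n := by
  rw [mem_maxIdeal, map_sub, sub_eq_zero]
  simp [residue, teich]

theorem teich_pow (x : (E0 p n)ˣ) : teich (x : E0 p n) ^ (p ^ n - 1) = 1 := by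
  have hc : residue p n x ≠ 0 := (x.isUnit.map (residue p n)).ne_zero
  have : residue p n x ^ (p ^ n - 1) = 1 := by
    refine mul_left_cancel₀ hc ?_
    rw [← pow_succ', Nat.sub_add_cancel (Nat.one_le_pow _ _ hp.out.pos), Fq_pow, mul_one]
  rw [teich, ← map_pow, ← map_pow, this, map_one, map_one]

theorem sub_pow_mem {x : (E0 p n)ˣ} {y : E0 p n} {k v : ℕ} (hv : p ^ k ∣ v)
    (h : teich (x : E0 p n) ^ v = y) : y - (x : E0 p n) ^ v ∈ maxIdeal p n ^ (k + 1) := by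
  obtain ⟨q, rfl⟩ := hv
  rw [← h, pow_mul, pow_mul]
  refine Ideal.mem_of_dvd _ (sub_dvd_pow_sub_pow _ _ q) ?_
  rw [← neg_sub]
  exact neg_mem (pow_pow_sub_mem (sub_teich_mem _) k)

theorem teich_pow_congr (x : (E0 p n)ˣ) {a b : ℕ} (h : a ≡ b [MOD (p ^ n - 1)]) :
    teich (x : E0 p n) ^ a = teich (x : E0 p n) ^ b := by
  rw [← Nat.mod_add_div a (p ^ n - 1), ← Nat.mod_add_div b (p ^ n - 1), h, pow_add, pow_add,
    pow_mul, pow_mul, teich_pow, one_pow, one_pow]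

theorem pow_mul_r_modEq (k : ℕ) : p ^ (n * k) * r p n ≡ r p n [MOD (p ^ n - 1)] := by
  have h : p ^ n ≡ 1 [MOD (p ^ n - 1)] :=
    ((Nat.modEq_iff_dvd' (Nat.one_le_pow _ _ hp.out.pos)).2 dvd_rfl).symm
  have := (h.pow k).mul_right (r p n)
  rwa [← pow_mul, one_pow, one_mul] at this

theorem le_n_mul (k : ℕ) : k ≤ n * k := Nat.le_mul_of_pos_left k (NeZero.pos n)

/-- The exponents representing `λ` are divisible by `p^k`, so `x` may be replaced by its Teichmüller
representative modulo `𝔪^{k+1}`. For the latter only the exponent modulo `p^n - 1` matters, and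
there `p^{nk} r(n)` is `r(n)`. -/
theorem unitPow_lam {x y : (E0 p n)ˣ} (h : (y : E0 p n) = teich (x : E0 p n) ^ r p n) :
    unitPow x (lam p n) = y := by
  refine unitPow_eq fun k => ?_
  have e : ((lam p n).1 k).val = p ^ (n * k) * r p n % (p ^ k * (p ^ n - 1)) :=
    ZMod.val_natCast _ _
  rw [e]
  have h1 : p ^ (n * k) * r p n % (p ^ k * (p ^ n - 1)) ≡ p ^ (n * k) * r p n
      [MOD (p ^ k * (p ^ n - 1))] := Nat.mod_modEq _ _
  refine sub_pow_mem ?_ ?_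
  · exact (Nat.dvd_mod_iff (dvd_mul_right _ _)).2 ((pow_dvd_pow p (le_n_mul k)).mul_right _)
  · rw [h]
    exact teich_pow_congr x ((h1.of_mul_left _).trans (pow_mul_r_modEq k))

theorem unitPow_neg_lam {x y : (E0 p n)ˣ} (h : (y : E0 p n) = teich (x : E0 p n) ^ r p n) :
    unitPow x (-lam p n) = y⁻¹ := by
  refine unitPow_eq fun k => ?_
  have hpos : 0 < p ^ k * (p ^ n - 1) := Nat.mul_pos (pow_pos hp.out.pos _)
    (Nat.sub_pos_of_lt (Nat.one_lt_pow (NeZero.ne n) hp.out.one_lt))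
  have : NeZero (p ^ k * (p ^ n - 1)) := ⟨hpos.ne'⟩
  set v := ((-lam p n).1 k).val
  -- The representative `v` of `-λ` is known only through this divisibility. It gives both `p^k ∣ v`
  -- and `v ≡ -r(n)` modulo `p^n - 1`.
  have hv : p ^ k * (p ^ n - 1) ∣ v + p ^ (n * k) * r p n := by
    rw [← ZMod.natCast_eq_zero_iff, Nat.cast_add, ZMod.natCast_zmod_val]
    exact neg_add_cancel _
  refine sub_pow_mem ?_ ?_
  · exact (Nat.dvd_add_left ((pow_dvd_pow p (le_n_mul k)).mul_right _)).1
      ((dvd_mul_right _ _).trans hv)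
  · rw [← Units.mul_eq_one_iff_eq_inv, h, ← pow_add]
    have h1 : v + r p n ≡ 0 [MOD (p ^ n - 1)] :=
      ((pow_mul_r_modEq k).symm.add_left v).trans
        ((Nat.modEq_zero_iff_dvd.2 hv).of_mul_left _)
    rw [teich_pow_congr x h1, pow_zero]

end UnitPow
open Filter Topology

/-! ### The bijection `x ↦ exp(px)` from `ℤ_p` to `1 + pℤ_p` -/

section PadicExp
variable {p : ℕ} [hp : Fact p.Prime]

theorem norm_le_iff_pow_dvd {x : ℤ_[p]} {k : ℕ} :
    ‖x‖ ≤ (p : ℝ) ^ (-k : ℤ) ↔ (p : ℤ_[p]) ^ k ∣ x := by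
  rw [PadicInt.norm_le_pow_iff_mem_span_pow, Ideal.mem_span_singleton]

theorem eventually_pow_dvd_sub (x : ℤ_[p]) (k : ℕ) : ∀ᶠ y in 𝓝 x, (p : ℤ_[p]) ^ k ∣ y - x := by
  have h : (0 : ℝ) < (p : ℝ) ^ (-k : ℤ) := zpow_pos (by exact_mod_cast hp.out.pos) _
  filter_upwards [Metric.closedBall_mem_nhds x h] with y hy
  rwa [Metric.mem_closedBall, dist_eq_norm, norm_le_iff_pow_dvd] at hy

theorem tendsto_of_pow_dvd {X : Type*} {l : Filter X} {f : X → ℤ_[p]} {a : ℤ_[p]}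
    (h : ∀ k : ℕ, ∀ᶠ x in l, (p : ℤ_[p]) ^ k ∣ f x - a) : Tendsto f l (𝓝 a) := by
  rw [Metric.tendsto_nhds]
  intro ε hε
  obtain ⟨k, hk⟩ := PadicInt.exists_pow_neg_lt p hε
  filter_upwards [h k] with x hx
  rw [dist_eq_norm]
  exact (norm_le_iff_pow_dvd.2 hx).trans_lt hk

theorem pow_dvd_tsum {f : ℕ → ℤ_[p]} (hf : Summable f) {k : ℕ} (h : ∀ i, (p : ℤ_[p]) ^ k ∣ f i) :
    (p : ℤ_[p]) ^ k ∣ ∑' i, f i := by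
  rw [← norm_le_iff_pow_dvd]
  refine le_of_tendsto hf.hasSum.norm (Eventually.of_forall fun s => ?_)
  exact norm_le_iff_pow_dvd.2 (Finset.dvd_sum fun i _ => h i)

theorem continuous_toE0 (n : ℕ) : Continuous (toE0 p n) :=
  continuous_of_dvd fun x k => by
    filter_upwards [eventually_pow_dvd_sub x k] with y hy
    rw [← map_sub]
    exact mem_maxIdeal_pow_of_dvd (pow_dvd_toE0 hy)

/-- `exp(px)` for `x ∈ ℤ_p`. -/
noncomputable def padicExp (x : ℤ_[p]) : ℤ_[p] := ∑' i : ℕ, expCoeff p i * x ^ i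

theorem padicExp_summable (h2 : 2 < p) (x : ℤ_[p]) : Summable fun i => expCoeff p i * x ^ i := by
  refine NonarchimedeanAddGroup.summable_of_tendsto_cofinite_zero ?_
  rw [Nat.cofinite_eq_atTop]
  refine tendsto_of_pow_dvd fun k => ?_
  filter_upwards [eventually_gt_atTop (2 * k)] with i hi
  rw [sub_zero]
  exact (pow_dvd_expCoeff h2 (by omega) (by omega)).mul_right _

theorem padicExp_add (h2 : 2 < p) (x y : ℤ_[p]) :
    padicExp (x + y) = padicExp x * padicExp y := by
  have : NonarchimedeanRing ℤ_[p] :=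
    { is_nonarchimedean := NonarchimedeanAddGroup.is_nonarchimedean }
  exact tsum_exp_add (RingHom.id ℤ_[p]) (padicExp_summable h2) x y

theorem toE0_padicExp (h2 : 2 < p) (n : ℕ) (x : ℤ_[p]) :
    toE0 p n (padicExp x) = expP (toE0 p n x) := by
  have h := (padicExp_summable h2 x).hasSum.map (toE0 p n) (continuous_toE0 n)
  rw [padicExp, ← h.tsum_eq, expP]
  refine tsum_congr fun i => ?_
  rw [Function.comp_apply, map_mul, map_pow]

theorem expCoeff_zero : expCoeff p 0 = 1 := Subtype.ext (by simp [expCoeff])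

theorem expCoeff_one : expCoeff p 1 = p := Subtype.ext (by simp [expCoeff])

/-- For `i ≥ 2` the coefficient `p^i/i!` is divisible by `p^2` and `x^i` by `p^{2k}`. This
first-order estimate yields surjectivity, the estimate for the inverse and the comparison with the
logarithm. -/
theorem padicExp_sub (h2 : 2 < p) {x : ℤ_[p]} {k : ℕ} (h : (p : ℤ_[p]) ^ k ∣ x) :
    (p : ℤ_[p]) ^ (2 * k + 2) ∣ padicExp x - (1 + p * x) := by
  have hs := padicExp_summable h2 x
  rw [padicExp, ← hs.sum_add_tsum_nat_add 2, Finset.sum_range_succ, Finset.sum_range_one,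
    expCoeff_zero, expCoeff_one, pow_zero, mul_one, pow_one, add_sub_cancel_left]
  refine pow_dvd_tsum ((summable_nat_add_iff 2).2 hs) fun i => ?_
  rw [add_comm, pow_add, mul_comm (p ^ 2 : ℤ_[p])]
  rw [mul_comm]
  refine mul_dvd_mul (pow_dvd_expCoeff h2 (by omega) (by omega)) ?_
  rw [mul_comm 2 k, pow_mul]
  exact (pow_dvd_pow_of_dvd h 2).trans (pow_dvd_pow x (by omega))

theorem padicExp_zero : padicExp (0 : ℤ_[p]) = 1 := by
  rw [padicExp, tsum_eq_single 0]
  · rw [expCoeff_zero, pow_zero, mul_one]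
  · intro i hi
    rw [zero_pow hi, mul_zero]

theorem padicExp_congr (h2 : 2 < p) {x y : ℤ_[p]} {k : ℕ} (h : (p : ℤ_[p]) ^ k ∣ x - y) :
    (p : ℤ_[p]) ^ k ∣ padicExp x - padicExp y := by
  rw [padicExp, padicExp, ← (padicExp_summable h2 x).tsum_sub (padicExp_summable h2 y)]
  refine pow_dvd_tsum ((padicExp_summable h2 x).sub (padicExp_summable h2 y)) fun i => ?_
  rw [← mul_sub]
  exact (h.trans (sub_dvd_pow_sub_pow x y i)).mul_left _

theorem continuous_padicExp (h2 : 2 < p) : Continuous (padicExp (p := p)) :=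
  continuous_iff_continuousAt.2 fun x => tendsto_of_pow_dvd fun k => by
    filter_upwards [eventually_pow_dvd_sub x k] with y hy
    exact padicExp_congr h2 hy

theorem dvd_padicExp_sub_one (h2 : 2 < p) (x : ℤ_[p]) : (p : ℤ_[p]) ∣ padicExp x - 1 := by
  have h := padicExp_sub h2 (x := x) (k := 0) (by rw [pow_zero]; exact one_dvd x)
  have h1 := (dvd_pow_self (p : ℤ_[p]) (show 2 * 0 + 2 ≠ 0 by omega)).trans h
  have := dvd_add h1 (dvd_mul_right (p : ℤ_[p]) x)
  rwa [← sub_sub, sub_add_cancel] at this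

theorem exists_padicExp_congr (h2 : 2 < p) {w : ℤ_[p]} (hw : (p : ℤ_[p]) ∣ w - 1) (k : ℕ) :
    ∃ x, (p : ℤ_[p]) ^ (k + 1) ∣ padicExp x - w := by
  induction k with
  | zero =>
    refine ⟨0, ?_⟩
    rw [padicExp_zero, zero_add, pow_one, dvd_sub_comm]
    exact hw
  | succ k ih =>
    obtain ⟨x, u, hu⟩ := ih
    -- With `exp(px) - w = p^{k+1} u`, the correction multiplies `exp(px)` by about `1 - p^{k+1} u`.
    -- This cancels the error because `exp(px) ≡ 1` modulo `p`.
    refine ⟨x + (p : ℤ_[p]) ^ k * (-u), ?_⟩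
    obtain ⟨c, hc⟩ := padicExp_sub h2 (dvd_mul_right ((p : ℤ_[p]) ^ k) (-u))
    obtain ⟨b, hb⟩ := dvd_padicExp_sub_one h2 x
    have hc' : padicExp ((p : ℤ_[p]) ^ k * -u) =
        1 - (p : ℤ_[p]) ^ (k + 1) * u + (p : ℤ_[p]) ^ (2 * k + 2) * c := by
      rw [← hc]; ring
    refine ⟨padicExp x * (p : ℤ_[p]) ^ k * c - b * u, ?_⟩
    rw [padicExp_add h2, hc']
    linear_combination hu - (p : ℤ_[p]) ^ (k + 1) * u * hb

/-- The image of the compact ring `ℤ_p` is closed, so approximate solutions suffice. -/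
theorem exists_padicExp_eq (h2 : 2 < p) {w : ℤ_[p]} (hw : (p : ℤ_[p]) ∣ w - 1) :
    ∃ x, padicExp x = w := by
  have hc : IsClosed (Set.range (padicExp (p := p))) :=
    (isCompact_range (continuous_padicExp h2)).isClosed
  choose x hx using exists_padicExp_congr h2 hw
  have ht : Tendsto (fun k => padicExp (x k)) atTop (𝓝 w) := tendsto_of_pow_dvd fun k => by
    filter_upwards [eventually_ge_atTop k] with i hi
    exact (pow_dvd_pow _ (by omega)).trans (hx i)
  have : w ∈ Set.range (padicExp (p := p)) :=
    hc.mem_of_tendsto ht (Eventually.of_forall fun k => Set.mem_range_self _)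
  exact this

/-- If `p^j ∣ x`, then `exp(px) - 1 ≡ px` modulo `p^{2j+2}`, hence modulo `p^{j+2}`, and one more
factor `p` of `x` can be read off. -/
theorem pow_dvd_of_padicExp (h2 : 2 < p) {x : ℤ_[p]} {k : ℕ}
    (h : (p : ℤ_[p]) ^ (k + 1) ∣ padicExp x - 1) : (p : ℤ_[p]) ^ k ∣ x := by
  have key : ∀ j ≤ k, (p : ℤ_[p]) ^ j ∣ x := by
    intro j hj
    induction j with
    | zero => rw [pow_zero]; exact one_dvd x
    | succ j ih =>
      have h1 := (pow_dvd_pow (p : ℤ_[p]) (show j + 2 ≤ 2 * j + 2 by omega)).trans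
        (padicExp_sub h2 (ih (by omega)))
      have h3 := dvd_sub ((pow_dvd_pow (p : ℤ_[p]) (show j + 2 ≤ k + 1 by omega)).trans h) h1
      have e : padicExp x - 1 - (padicExp x - (1 + p * x)) = p * x := by ring
      rw [e, show j + 2 = (j + 1) + 1 by ring, pow_succ'] at h3
      exact (mul_dvd_mul_iff_left (Nat.cast_ne_zero.2 hp.out.ne_zero)).1 h3
  exact key k le_rfl

end PadicExp

/-! ### The logarithm series inverts the exponential -/

section PadicLog
variable {p : ℕ} [hp : Fact p.Prime]

theorem tendsto_pow_padic : Tendsto (fun k : ℕ => (p : ℚ_[p]) ^ k) atTop (𝓝 0) := by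
  refine tendsto_pow_atTop_nhds_zero_of_norm_lt_one ?_
  exact Padic.norm_p_lt_one

theorem choose_succ_div (N j : ℕ) (hN : N ≠ 0) : (N.choose (j + 1) : ℚ_[p]) =
    N * (((N - 1).choose j : ℚ_[p]) / (j + 1)) := by
  obtain ⟨M, rfl⟩ := Nat.exists_eq_succ_of_ne_zero hN
  have h : ((M + 1 : ℕ) : ℚ_[p]) * M.choose j = (M + 1).choose (j + 1) * ((j + 1 : ℕ) : ℚ_[p]) := by
    exact_mod_cast Nat.add_one_mul_choose_eq M j
  have hj : ((j : ℚ_[p]) + 1) ≠ 0 := by exact_mod_cast j.succ_ne_zero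
  rw [Nat.succ_eq_add_one, Nat.add_sub_cancel, mul_div_assoc', eq_div_iff hj]
  push_cast at h ⊢
  exact h.symm

theorem tendsto_choose (j : ℕ) :
    Tendsto (fun k : ℕ => ((p ^ k - 1).choose j : ℚ_[p])) atTop (𝓝 ((-1) ^ j)) := by
  induction j with
  | zero => simp
  | succ j ih =>
    have h : Tendsto (fun k : ℕ => ((p : ℚ_[p]) ^ k) * (((p ^ k - 1).choose j : ℚ_[p]) / (j + 1)) -
        ((p ^ k - 1).choose j : ℚ_[p])) atTop (𝓝 (0 * ((-1) ^ j / (j + 1)) - (-1) ^ j)) :=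
      (tendsto_pow_padic.mul (ih.div_const _)).sub ih
    rw [zero_mul, zero_sub, ← neg_one_mul, ← pow_succ'] at h
    refine h.congr fun k => ?_
    have h1 : p ^ k ≠ 0 := pow_ne_zero k hp.out.ne_zero
    rw [← Nat.cast_pow, ← choose_succ_div (p ^ k) j h1, sub_eq_iff_eq_add']
    obtain ⟨M, hM⟩ := Nat.exists_eq_succ_of_ne_zero h1
    rw [hM, Nat.succ_eq_add_one, Nat.add_sub_cancel, Nat.choose_succ_succ]
    push_cast
    ring

theorem norm_inv_natCast_le (m : ℕ) : ‖(m : ℚ_[p])‖⁻¹ ≤ m := by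
  rcases Nat.eq_zero_or_pos m with rfl | hm
  · simp
  have hm' : (m : ℚ_[p]) ≠ 0 := by exact_mod_cast hm.ne'
  rw [Padic.norm_eq_zpow_neg_valuation hm', Padic.valuation_natCast, zpow_neg, inv_inv,
    zpow_natCast]
  exact_mod_cast Nat.le_of_dvd hm pow_padicValNat_dvd

/-- By the binomial theorem the coefficient of `y^{i+1}` on the left is the binomial coefficient of
`p^k - 1` over `i`, divided by `i + 1`. It tends to `(-1)^i/(i + 1)`. The bound `|1/(i + 1)| ≤ i +
1` permits passing to the limit termwise. -/
theorem tendsto_log {y : ℚ_[p]} (hy : ‖y‖ < 1) :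
    Tendsto (fun k : ℕ => ((1 + y) ^ p ^ k - 1) / (p : ℚ_[p]) ^ k) atTop
      (𝓝 (∑' i : ℕ, (-1) ^ i * y ^ (i + 1) / (i + 1))) := by
  have hlim : Tendsto (fun k : ℕ => ∑' i : ℕ, ((p ^ k - 1).choose i : ℚ_[p]) * y ^ (i + 1) / (i + 1))
      atTop (𝓝 (∑' i : ℕ, (-1) ^ i * y ^ (i + 1) / (i + 1))) := by
    refine tendsto_tsum_of_dominated_convergence
      (bound := fun i : ℕ => ((i : ℝ) + 1) * ‖y‖ ^ (i + 1)) ?_ ?_ ?_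
    · have := summable_pow_mul_geometric_of_norm_lt_one 1 (r := ‖y‖) (by simpa using hy)
      have := (summable_nat_add_iff 1).2 this
      simpa using this
    · exact fun i => ((tendsto_choose i).mul_const _).div_const _
    · refine Eventually.of_forall fun k i => ?_
      rw [norm_div, norm_mul, norm_pow, div_eq_mul_inv, mul_comm]
      have h1 : ‖((i : ℚ_[p]) + 1)‖⁻¹ ≤ (i : ℝ) + 1 := by
        exact_mod_cast norm_inv_natCast_le (p := p) (i + 1)
      have h2 : ‖((p ^ k - 1).choose i : ℚ_[p])‖ ≤ 1 := by
        exact_mod_cast Padic.norm_int_le_one (p := p) ((p ^ k - 1).choose i : ℤ)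
      refine mul_le_mul h1 ?_ (by positivity) (by positivity)
      exact mul_le_of_le_one_left (by positivity) h2
  refine hlim.congr fun k => ?_
  have h1 : p ^ k ≠ 0 := pow_ne_zero k hp.out.ne_zero
  have hpk : (p : ℚ_[p]) ^ k ≠ 0 := pow_ne_zero k (by exact_mod_cast hp.out.ne_zero)
  rw [tsum_eq_sum (s := Finset.range (p ^ k)), eq_div_iff hpk, add_comm 1 y, add_pow,
    Finset.sum_range_succ', Finset.sum_mul]
  · simp only [one_pow, mul_one, pow_zero, Nat.choose_zero_right, Nat.cast_one,
      add_sub_cancel_right]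
    refine Finset.sum_congr rfl fun i _ => ?_
    rw [choose_succ_div (p ^ k) i h1]
    push_cast
    ring
  · intro i hi
    rw [Nat.choose_eq_zero_of_lt]
    · simp
    · have := Finset.mem_range.not.1 hi
      omega

theorem padicExp_natCast_mul (h2 : 2 < p) (m : ℕ) (x : ℤ_[p]) :
    padicExp ((m : ℤ_[p]) * x) = padicExp x ^ m := by
  induction m with
  | zero => rw [Nat.cast_zero, zero_mul, pow_zero, padicExp_zero]
  | succ m ih => rw [Nat.cast_succ, add_mul, one_mul, padicExp_add h2, ih, pow_succ]

/-- Expressed as a limit, the logarithm is easy to evaluate: `exp(px)^{p^k} = exp(p · p^k x)` is `1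
+ p^{k+1} x` modulo `p^{2k+2}`. Subtracting `1` and dividing by `p^k` leaves `px` up to a term that
tends to zero. -/
theorem log_padicExp (h2 : 2 < p) (x : ℤ_[p]) :
    ∑' i : ℕ, (-1) ^ i * ((padicExp x : ℚ_[p]) - 1) ^ (i + 1) / (i + 1) = (p : ℚ_[p]) * x := by
  have hy : ‖(padicExp x : ℚ_[p]) - 1‖ < 1 := by
    have h := dvd_padicExp_sub_one h2 x
    have := PadicInt.norm_lt_one_iff_dvd (padicExp x - 1) |>.2 h
    rw [PadicInt.norm_def] at this
    push_cast at this
    exact this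
  refine tendsto_nhds_unique (tendsto_log hy) ?_
  choose c hc using fun k : ℕ => padicExp_sub h2 (dvd_mul_right ((p : ℤ_[p]) ^ k) x)
  have h : Tendsto (fun k : ℕ => (p : ℚ_[p]) * x + (p : ℚ_[p]) ^ k * ((p : ℚ_[p]) ^ 2 * (c k : ℚ_[p])))
      atTop (𝓝 ((p : ℚ_[p]) * x)) := by
    have : Tendsto (fun k : ℕ => (p : ℚ_[p]) ^ k * ((p : ℚ_[p]) ^ 2 * (c k : ℚ_[p]))) atTop
        (𝓝 0) := by
      refine squeeze_zero_norm (a := fun k : ℕ => ‖(p : ℚ_[p]) ^ k‖) (fun k => ?_) ?_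
      · rw [norm_mul]
        refine mul_le_of_le_one_right (norm_nonneg _) ?_
        have := PadicInt.norm_le_one ((p : ℤ_[p]) ^ 2 * c k)
        rw [PadicInt.norm_def] at this
        push_cast at this
        exact this
      · simpa only [norm_zero] using (tendsto_pow_padic (p := p)).norm
    simpa using tendsto_const_nhds.add this
  refine h.congr fun k => ?_
  have hpk : (p : ℚ_[p]) ^ k ≠ 0 := pow_ne_zero k (by exact_mod_cast hp.out.ne_zero)
  have e := congrArg (fun z : ℤ_[p] => (z : ℚ_[p])) (hc k)
  have e2 := congrArg (fun z : ℤ_[p] => (z : ℚ_[p])) (padicExp_natCast_mul h2 (p ^ k) x)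
  rw [Nat.cast_pow] at e2
  push_cast at e e2
  rw [eq_div_iff hpk, add_sub_cancel, ← e2, ← sub_eq_zero]
  rw [← sub_eq_zero] at e
  linear_combination -e

theorem ell_padicExp (h2 : 2 < p) (x : ℤ_[p]) : ell (padicExp x) = x := by
  have hp0 : (p : ℚ_[p]) ≠ 0 := by exact_mod_cast hp.out.ne_zero
  have h : (p : ℚ_[p])⁻¹ * ∑' i : ℕ, (-1) ^ i * ((padicExp x : ℚ_[p]) - 1) ^ (i + 1) / (i + 1) =
      x := by
    rw [log_padicExp h2, inv_mul_cancel_left₀ hp0]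
  have hq : ‖(p : ℚ_[p])⁻¹ *
      ∑' i : ℕ, (-1) ^ i * ((padicExp x : ℚ_[p]) - 1) ^ (i + 1) / (i + 1)‖ ≤ 1 := by
    rw [h]
    exact x.2
  exact (dif_pos hq).trans (Subtype.ext h)

theorem padicExp_ell (h2 : 2 < p) {w : ℤ_[p]} (hw : (p : ℤ_[p]) ∣ w - 1) :
    padicExp (ell w) = w := by
  obtain ⟨x, rfl⟩ := exists_padicExp_eq h2 hw
  rw [ell_padicExp h2]

theorem ell_mul (h2 : 2 < p) {w w' : ℤ_[p]} (hw : (p : ℤ_[p]) ∣ w - 1)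
    (hw' : (p : ℤ_[p]) ∣ w' - 1) : ell (w * w') = ell w + ell w' := by
  obtain ⟨x, rfl⟩ := exists_padicExp_eq h2 hw
  obtain ⟨x', rfl⟩ := exists_padicExp_eq h2 hw'
  rw [← padicExp_add h2, ell_padicExp h2, ell_padicExp h2, ell_padicExp h2]

theorem pow_dvd_ell_sub (h2 : 2 < p) {w w' : ℤ_[p]} (hw : (p : ℤ_[p]) ∣ w - 1)
    (hw' : (p : ℤ_[p]) ∣ w' - 1) {k : ℕ} (h : (p : ℤ_[p]) ^ (k + 1) ∣ w - w') :
    (p : ℤ_[p]) ^ k ∣ ell w - ell w' := by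
  obtain ⟨x, rfl⟩ := exists_padicExp_eq h2 hw
  obtain ⟨x', rfl⟩ := exists_padicExp_eq h2 hw'
  rw [ell_padicExp h2, ell_padicExp h2]
  refine pow_dvd_of_padicExp h2 ?_
  have e : padicExp (x - x') - 1 = padicExp (-x') * (padicExp x - padicExp x') := by
    rw [mul_sub, ← padicExp_add h2, ← padicExp_add h2, neg_add_cancel, padicExp_zero,
      neg_add_eq_sub]
  rw [e]
  exact h.mul_left _

end PadicLog
open Filter Topology

/-! ### The crossed homomorphisms and the comparison of classes -/

section Cocycles
variable {p n : ℕ} [hp : Fact p.Prime]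

theorem Stab.eventually_dvd_sub (γ : Stab p n) (N : ℕ) :
    ∀ᶠ δ in 𝓝 γ, PowerSeries.X ^ N ∣ δ.f - γ.f := by
  let : TopologicalSpace (Fq p n) := ⊥
  have : DiscreteTopology (Fq p n) := ⟨rfl⟩
  have hc (i : ℕ) : Continuous fun δ : Stab p n => PowerSeries.coeff i δ.f := by
    have h1 : Continuous fun (δ : Stab p n) (i : ℕ) => PowerSeries.coeff i δ.f :=
      continuous_iff_le_induced.2 inf_le_left
    exact (continuous_apply i).comp h1
  have h : ∀ᶠ δ in 𝓝 γ, ∀ i ∈ Finset.range N, PowerSeries.coeff i δ.f = PowerSeries.coeff i γ.f := by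
    refine (Finset.eventually_all _).2 fun i _ => ?_
    exact (hc i).tendsto γ (show {PowerSeries.coeff i γ.f} ∈ 𝓝 (PowerSeries.coeff i γ.f) by simp)
  filter_upwards [h] with δ hδ
  rw [PowerSeries.X_pow_dvd_iff]
  intro i hi
  rw [map_sub, hδ i (Finset.mem_range.2 hi), sub_self]

theorem Stab.eventually_lead_eq (γ : Stab p n) : ∀ᶠ δ in 𝓝 γ, δ.lead = γ.lead := by
  filter_upwards [γ.eventually_dvd_sub 2] with δ hδ
  have := PowerSeries.X_pow_dvd_iff.1 hδ 1 one_lt_two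
  rwa [map_sub, sub_eq_zero] at this

theorem continuous_toE0_comp {X : Type*} [TopologicalSpace X] {f : X → ℤ_[p]}
    (h : ∀ x (k : ℕ), ∀ᶠ y in 𝓝 x, (p : ℤ_[p]) ^ k ∣ f y - f x) :
    Continuous fun x => toE0 p n (f x) :=
  (continuous_toE0 n).comp (continuous_iff_continuousAt.2 fun x => tendsto_of_pow_dvd (h x))

variable [NeZero n]

theorem eventually_dvd_det_sub (γ : Stab p n) (k : ℕ) :
    ∀ᶠ δ in 𝓝 γ, (p : ℤ_[p]) ^ k ∣ det δ - det γ := by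
  filter_upwards [γ.eventually_dvd_sub (p ^ (n * k))] with δ hδ
  exact dvd_det_sub_det hδ

theorem eventually_tau_eq (γ : Stab p n) : ∀ᶠ δ in 𝓝 γ, δ.tau = γ.tau := by
  filter_upwards [γ.eventually_lead_eq] with δ hδ
  rw [Stab.tau, hδ, Stab.tau]

theorem eventually_dvd_theta_sub (γ : Stab p n) (k : ℕ) :
    ∀ᶠ δ in 𝓝 γ, (p : ℤ_[p]) ^ k ∣ theta δ - theta γ := by
  filter_upwards [eventually_tau_eq γ, eventually_dvd_det_sub γ k] with δ h1 h2
  rwa [← γ.isUnit_tau.dvd_mul_left, mul_sub, γ.tau_mul_theta, ← h1, δ.tau_mul_theta]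

theorem eventually_dvd_zeta_sub (h2 : 2 < p) (γ : Stab p n) (k : ℕ) :
    ∀ᶠ δ in 𝓝 γ, (p : ℤ_[p]) ^ k ∣ zeta δ - zeta γ := by
  filter_upwards [eventually_dvd_theta_sub γ (k + 1)] with δ h
  exact pow_dvd_ell_sub h2 (dvd_theta_sub_one δ) (dvd_theta_sub_one γ) h

theorem zeta_mul (h2 : 2 < p) (γ δ : Stab p n) : zeta (γ * δ) = zeta γ + zeta δ := by
  rw [zeta, theta_mul, ell_mul h2 (dvd_theta_sub_one γ) (dvd_theta_sub_one δ), zeta, zeta]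

theorem expP_zeta (h2 : 2 < p) (γ : Stab p n) :
    expP (toE0 p n (zeta γ)) = toE0 p n (theta γ) := by
  rw [← toE0_padicExp h2, zeta, padicExp_ell h2 (dvd_theta_sub_one γ)]

/-- Since `ψ_g` lifts `g`, the residue of `t₀(g) = ψ_g'(0)` is `g'(0)`. Through `unitPow_lam` this
identifies `τ` with `t₀^λ`. -/
theorem toE0_tau (γ : Stab p n) : toE0 p n γ.tau = teich (t₀ γ : E0 p n) ^ r p n := by
  have h : residue p n (t₀ γ) = γ.lead := by
    have := congrArg (PowerSeries.coeff 1) (lubinTate γ.f).reduces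
    rwa [PowerSeries.coeff_map] at this
  rw [teich, h, ← map_pow, ← map_pow]
  exact congrArg MvPowerSeries.C γ.toW_tau

variable (p n) in
/-- The crossed homomorphism `ζ`. -/
noncomputable def zetaCocycle (h2 : 2 < p) : Z1 (addAct p n) :=
  ⟨fun γ => Multiplicative.ofAdd (toE0 p n (zeta γ)),
    continuous_toE0_comp (eventually_dvd_zeta_sub h2), fun γ δ => by
      change toE0 p n (zeta (γ * δ)) = toE0 p n (zeta γ) + act γ (toE0 p n (zeta δ))
      rw [zeta_mul h2, map_add, act_toE0]⟩

/-- A continuous multiplicative function with values in `ℤ_pˣ` as a crossed homomorphism. -/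
noncomputable def padicCocycle (f : Stab p n → ℤ_[p]) (hu : ∀ γ, IsUnit (f γ))
    (hc : ∀ γ (k : ℕ), ∀ᶠ δ in 𝓝 γ, (p : ℤ_[p]) ^ k ∣ f δ - f γ)
    (hm : ∀ γ δ, f (γ * δ) = f γ * f δ) : Z1 (unitAct p n) :=
  ⟨fun γ => ((hu γ).map (toE0 p n)).unit, continuous_units (continuous_toE0_comp hc),
    fun γ δ => Units.ext (by
      change toE0 p n (f (γ * δ)) = toE0 p n (f γ) * act γ (toE0 p n (f δ))
      rw [hm, map_mul, act_toE0])⟩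

variable (p n) in
/-- The crossed homomorphism `det`. -/
noncomputable def detCocycle : Z1 (unitAct p n) :=
  padicCocycle det isUnit_det eventually_dvd_det_sub det_mul

variable (p n) in
/-- The crossed homomorphism `t₀^λ`. -/
noncomputable def tauCocycle : Z1 (unitAct p n) :=
  padicCocycle Stab.tau Stab.isUnit_tau (fun γ k => by
    filter_upwards [eventually_tau_eq γ] with δ hδ
    rw [hδ, sub_self]
    exact dvd_zero _) Stab.tau_mul

/-- The crossed homomorphism `exp(pz)` for a crossed homomorphism `z`. -/
noncomputable def expCocycle (h2 : 2 < p) (z : Z1 (addAct p n)) : Z1 (unitAct p n) :=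
  ⟨fun γ => expUnit p n h2 (z.1 γ).toAdd,
    continuous_units ((continuous_expP h2).comp (continuous_toAdd.comp z.2.1)), fun γ δ =>
      Units.ext (by
        change expP (z.1 (γ * δ)).toAdd = expP (z.1 γ).toAdd * act γ (expP (z.1 δ).toAdd)
        rw [act_expP h2, ← expP_add h2, z.2.2]
        rfl)⟩

/-- If `ζ - z` is the coboundary of `m`, then `exp(pz)` and `exp(pζ) = τ⁻¹ det` differ by the
coboundary of `exp(pm)`, as the action commutes with the exponential. -/
theorem cls_expCocycle (h2 : 2 < p) {z : Z1 (addAct p n)} (h : cls z = cls (zetaCocycle p n h2)) :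
    cls (expCocycle h2 z) = cls (tauCocycle p n)⁻¹ * cls (detCocycle p n) := by
  obtain ⟨m, hm⟩ := QuotientGroup.eq.1 h
  refine QuotientGroup.eq.2 ⟨expUnit p n h2 m.toAdd, fun γ => ?_⟩
  have hm : -(z.1 γ).toAdd + toE0 p n (zeta γ) = act γ m.toAdd - m.toAdd := hm γ
  rw [eq_div_iff_mul_eq']
  change ((expUnit p n h2 (z.1 γ).toAdd)⁻¹ * (((tauCocycle p n).1 γ)⁻¹ * (detCocycle p n).1 γ)) *
    expUnit p n h2 m.toAdd = _
  rw [mul_left_comm, mul_assoc, inv_mul_eq_iff_eq_mul, mul_assoc, inv_mul_eq_iff_eq_mul]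
  refine Units.ext ?_
  change toE0 p n (det γ) * expP m.toAdd =
    expP (z.1 γ).toAdd * (toE0 p n γ.tau * act γ (expP m.toAdd))
  rw [act_expP h2, mul_left_comm, ← expP_add h2, ← γ.tau_mul_theta, map_mul, ← expP_zeta h2,
    mul_assoc, ← expP_add h2]
  congr 2
  linear_combination hm

theorem isoModP_det_tau : IsoModP (detCocycle p n) (tauCocycle p n) := by
  refine ⟨LinearEquiv.refl _ _, fun γ a => ?_⟩
  have h : Ideal.Quotient.mk (pIdeal p n) ((detCocycle p n).1 γ : E0 p n) =
      Ideal.Quotient.mk (pIdeal p n) ((tauCocycle p n).1 γ : E0 p n) := by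
    rw [Ideal.Quotient.eq, Ideal.mem_span_singleton]
    change _ ∣ toE0 p n (det γ) - toE0 p n γ.tau
    have := map_dvd (toE0 p n) (dvd_det_sub_tau γ)
    rwa [map_natCast, map_sub] at this
  rw [LinearEquiv.refl_apply, LinearEquiv.refl_apply, twistedActModP, twistedActModP, h]

end Cocycles

end Morava

theorem proposition3p4 (p n : ℕ) [Fact p.Prime] [NeZero n] (hp : 2 < p) :
    ∃ (z : Morava.Z1 (Morava.addAct p n)) (s t d : Morava.Z1 (Morava.unitAct p n)),
      (∀ γ, (z.1 γ).toAdd = Morava.toE0 p n (Morava.zeta γ)) ∧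
      (∀ γ, s.1 γ = Morava.unitPow (Morava.t₀ γ) (Morava.lam p n)) ∧
      (∀ γ, t.1 γ = Morava.unitPow (Morava.t₀ γ) (-Morava.lam p n)) ∧
      (∀ γ, (d.1 γ : Morava.E0 p n) = Morava.toE0 p n (Morava.det γ)) ∧
      (∀ z' : Morava.Z1 (Morava.addAct p n), Morava.cls z' = Morava.cls z →
        ∃ e : Morava.Z1 (Morava.unitAct p n),
          (∀ γ, (e.1 γ : Morava.E0 p n) = Morava.expP (z'.1 γ).toAdd) ∧
          Morava.cls e = Morava.cls t * Morava.cls d) ∧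
      Morava.IsoModP d s := by
  -- The cocycles for `t₀^λ` and `t₀^{-λ}` are `τ` and its inverse. What remains is to identify them
  -- with the powers of `t₀`.
  refine ⟨Morava.zetaCocycle p n hp, Morava.tauCocycle p n, (Morava.tauCocycle p n)⁻¹,
    Morava.detCocycle p n, fun γ => rfl, fun γ => ?_, fun γ => ?_, fun γ => rfl,
    fun z' hz' => ⟨Morava.expCocycle hp z', fun γ => rfl, Morava.cls_expCocycle hp hz'⟩,
    Morava.isoModP_det_tau⟩
  · exact (Morava.unitPow_lam (Morava.toE0_tau γ)).symm
  · exact (Morava.unitPow_neg_lam (y := (Morava.tauCocycle p n).1 γ) (Morava.toE0_tau γ)).symm
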